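/- **Setting.** Let $m,n,l\ge 1$ be integers. Agents $i\in\mathcal V=\{1,\dots,m\}$ are the vertices of an undirected connected graph $G$, and $\mathcal N_i$ denotes the set of neighbours of $i$. Let $\Theta\in\mathbb R^{l\times n}$. At every time $t=1,2,\dots$ agent $i$ observes $(x_{i,t},y_{i,t})$ with $y_{i,t}=\Theta x_{i,t}+\eta_{i,t}$, where all the random vectors $x_{i,t},\eta_{i,t}$ are mutually independent, $x_{i,t}\sim\mathcal N(\mu_{i,t},\sigma_x^2I_n)$, $\eta_{i,t}\sim\mathcal N(0,\sigma_\eta^2I_l)$, $\sigma_x>0$, $\sigma_\eta\ge0$, the means $\mu_{i,t}\in\mathbb R^n$ are deterministic, and $\hat\mu=\sup_{i,t}\|\mu_{i,t}\|<\infty$. **Weights.** $W\in\mathbb R^{m\times m}$ is symmetric with nonnegative entries, $W\mathbf 1=\mathbf 1$, $W(i,j)=0$ whenever $i\ne j$ and $j\notin\mathcal N_i$, and $\rho(W)=\max\{\lambda_2(W),-\lambda_m(W)\}<1$, where $\lambda_1(W)\ge\dots\ge\lambda_m(W)$ are the eigenvalues of $W$ with multiplicity (for $m=1$ put $\rho(W)=0$).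 **Algorithm.** Fix a communication period $\zeta\ge1$, a stopping time $S\ge0$ and a number $T\ge1$ of communication steps. Let $\alpha_{i,1}=0$, $\beta_{i,1}=0$, $\bar\Theta_{i,1}=0$ and, for $t\ge1$, $\alpha_{i,t+1}=\alpha_{i,t}+y_{i,t}x_{i,t}^*$ and $\beta_{i,t+1}=\beta_{i,t}+x_{i,t}x_{i,t}^*$. If $t\bmod\zeta=0$ and $t\le S$, set $\alpha^0_{i,t+1}=\alpha_{i,t+1}$, $\beta^0_{i,t+1}=\beta_{i,t+1}$; for $k=0,\dots,T-1$ let $$\alpha^{k+1}_{i,t+1}=W(i,i)\alpha^k_{i,t+1}+\sum_{j\in\mathcal N_i}W(i,j)\alpha^k_{j,t+1},\qquad \beta^{k+1}_{i,t+1}=W(i,i)\beta^k_{i,t+1}+\sum_{j\in\mathcal N_i}W(i,j)\beta^k_{j,t+1},$$ and let $\bar\Theta_{i,t+1}=\alpha^T_{i,t+1}(\beta^T_{i,t+1})^\dagger$ with the Moore–Penrose pseudoinverse $\dagger$. Otherwise $\bar\Theta_{i,t+1}=\bar\Theta_{i,t}$. **Theorem.** Let $\hat\delta>0$ and $\delta>0$,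 and let $t\ge1$ satisfy $t\bmod\zeta=0$, $t\le S$ and $t\ge\max(t_1,t_2,t_3)$, where $$t_1=8n+16\log\tfrac2{\hat\delta},\quad t_2=\Big(\tfrac{16\hat\mu(\sqrt{4n}+\sqrt{2\log(2/\hat\delta)})}{\sigma_x}\Big)^2,\quad t_3=2(n+l)\log\tfrac1{\hat\delta}.$$ Put $\bar\mu_t=\frac4{mt\sigma_x^2}\sum_{i=1}^m\sum_{j=1}^t\mu_{i,j}\mu_{i,j}^*$. Then, with probability at least $1-4m\hat\delta-4\delta$, simultaneously for all $i\in\mathcal V$, $$\|\bar\Theta_{i,t+1}-\Theta\|\le\rho(W)^T\,C_0+\frac{C_1}{\sqrt{mt}\,\sigma_x^2\,\lambda_{\min}(I_n+\bar\mu_t)}$$ in the spectral norm, where $\lambda_{\min}$ is the smallest eigenvalue and $$C_0=c_3(c_1+t^{-1/2}c_2)+\frac{8m^{3/2}\sqrt l\,(c_1+t^{-1/2}c_2)}{\sigma_x^2}+\rho(W)^Tm^{3/2}\sqrt l\,c_3(c_1+t^{-1/2}c_2),$$ $$C_1=8\sigma_\eta\Big(4\sigma_x\sqrt{(n+l)\log\tfrac9\delta}+\hat\mu\big(\sqrt{2(l+n)}+2\sqrt{\log\tfrac2\delta}\big)\Big),$$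 $$c_1=\|\Theta\|\big(\tfrac{19}8\sigma_x^2+\hat\mu^2\big),\qquad c_2=\sigma_\eta\Big(4\sigma_x\sqrt{(n+l)\log\tfrac9{\hat\delta}}+\hat\mu\big(\sqrt{2(l+n)}+\sqrt{2\log\tfrac2{\hat\delta}}\big)\Big),$$ $$c_3=\frac{152\,m^{3/2}\sqrt{5n}}{\sigma_x^2}+\frac{64\,m^{3/2}\sqrt{5n}}{\sigma_x^4}\hat\mu^2.$$ (If $\hat\delta$ or $\delta$ is so large that a logarithm under a square root is negative, then $1-4m\hat\delta-4\delta<0$ and the claim is void; roots of negative numbers are read as $0$.) -/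

import Mathlib

open MeasureTheory ProbabilityTheory
open scoped Matrix Matrix.Norms.L2Operator

noncomputable section

namespace DistributedEstimation

/-! ### Linear algebra -/

/-- `B` is a Moore-Penrose pseudoinverse of the real square matrix `A`:
the four Penrose equations hold. -/
structure IsPseudoinverse {n : ℕ} (A B : Matrix (Fin n) (Fin n) ℝ) : Prop where
  mul_mul_left : A * B * A = A
  mul_mul_right : B * A * B = B
  symm_left : (A * B)ᴴ = A * B
  symm_right : (B * A)ᴴ = B * A

/-- Every real square matrix has a Moore-Penrose pseudoinverse. -/
theorem exists_isPseudoinverse {n : ℕ} (A : Matrix (Fin n) (Fin n) ℝ) :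
    ∃ B, IsPseudoinverse A B := by
  set S := Aᴴ * A with hS
  have hSa : IsSelfAdjoint S := Matrix.isHermitian_conjTranspose_mul_self A
  set Q : Matrix (Fin n) (Fin n) ℝ := cfc (fun r : ℝ => r⁻¹) S with hQ
  have hfin : (spectrum ℝ S).Finite := Matrix.finite_real_spectrum
  have hc : ∀ f : ℝ → ℝ, ContinuousOn f (spectrum ℝ S) := fun f => hfin.continuousOn f
  have hid : cfc (fun r : ℝ => r) S = S := cfc_id' ℝ S
  have hQS : Q * S = cfc (fun r : ℝ => r⁻¹ * r) S := by
    rw [cfc_mul (fun r : ℝ => r⁻¹) (fun r => r) S (hc _) (hc _), hid]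
  have hSQ : S * Q = Q * S := by
    have h : S * Q = cfc (fun r : ℝ => r * r⁻¹) S := by
      rw [cfc_mul (fun r : ℝ => r) (fun r => r⁻¹) S (hc _) (hc _), hid]
    rw [h, hQS]
    congr 1
    funext r
    ring
  have hSQS : S * Q * S = S := by
    have h : cfc (fun r : ℝ => (r⁻¹ * r) * r) S = S := by
      conv_rhs => rw [← hid]
      congr 1
      funext r
      by_cases hr : r = 0
      · simp [hr]
      · field_simp
    rw [hSQ, hQS]
    nth_rewrite 2 [← hid]
    rw [← cfc_mul (fun r : ℝ => r⁻¹ * r) (fun r => r) S (hc _) (hc _), h]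
  have hQSQ : Q * S * Q = Q := by
    rw [hQS, hQ, ← cfc_mul (fun r : ℝ => r⁻¹ * r) (fun r => r⁻¹) S (hc _) (hc _)]
    congr 1
    funext r
    by_cases hr : r = 0
    · simp [hr]
    · field_simp
  have hQh : Qᴴ = Q := (cfc_predicate (fun r : ℝ => r⁻¹) S : IsSelfAdjoint Q)
  have hSh : Sᴴ = S := hSa
  refine ⟨Q * Aᴴ, ?_, ?_, ?_, ?_⟩
  · rw [← sub_eq_zero, ← Matrix.conjTranspose_mul_self_eq_zero]
    have e : A * (Q * Aᴴ) * A - A = A * (Q * S - 1) := by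
      rw [hS]
      noncomm_ring
    rw [e, Matrix.conjTranspose_mul, Matrix.conjTranspose_sub, Matrix.conjTranspose_mul, hQh, hSh,
      Matrix.conjTranspose_one]
    have e2 : (S * Q - 1) * Aᴴ * (A * (Q * S - 1)) = (S * Q * S - S) * (Q * S - 1) := by
      rw [hS]
      noncomm_ring
    rw [e2, hSQS, sub_self, zero_mul]
  · have e : Q * Aᴴ * A * (Q * Aᴴ) = Q * S * Q * Aᴴ := by
      rw [hS]
      noncomm_ring
    rw [e, hQSQ]
  · rw [Matrix.conjTranspose_mul, Matrix.conjTranspose_mul, Matrix.conjTranspose_conjTranspose,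
      hQh, Matrix.mul_assoc]
  · rw [Matrix.mul_assoc, ← hS, Matrix.conjTranspose_mul, hQh, hSh, hSQ]

/-- The Moore-Penrose pseudoinverse `A†` of a real square matrix. -/
def pinv {n : ℕ} (A : Matrix (Fin n) (Fin n) ℝ) : Matrix (Fin n) (Fin n) ℝ :=
  (exists_isPseudoinverse A).choose

/-- `pinv A` satisfies the Penrose equations. -/
theorem isPseudoinverse_pinv {n : ℕ} (A : Matrix (Fin n) (Fin n) ℝ) :
    IsPseudoinverse A (pinv A) :=
  (exists_isPseudoinverse A).choose_spec

/-- The Penrose equations determine the pseudoinverse. -/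
theorem IsPseudoinverse.eq_pinv {n : ℕ} {A B : Matrix (Fin n) (Fin n) ℝ}
    (h : IsPseudoinverse A B) : B = pinv A := by
  obtain ⟨c1, c2, c3, c4⟩ := isPseudoinverse_pinv A
  obtain ⟨b1, b2, b3, b4⟩ := h
  set C := pinv A
  have hAB : A * B = A * C := by
    calc A * B = (A * B)ᴴ := b3.symm
      _ = (A * C * A * B)ᴴ := by rw [c1]
      _ = ((A * C) * (A * B))ᴴ := by rw [Matrix.mul_assoc (A * C)]
      _ = (A * B) * (A * C) := by rw [Matrix.conjTranspose_mul, b3, c3]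
      _ = A * B * A * C := by rw [Matrix.mul_assoc (A * B)]
      _ = A * C := by rw [b1]
  have hBA : B * A = C * A := by
    calc B * A = (B * A)ᴴ := b4.symm
      _ = (B * (A * C * A))ᴴ := by rw [c1]
      _ = ((B * A) * (C * A))ᴴ := by simp only [Matrix.mul_assoc]
      _ = (C * A) * (B * A) := by rw [Matrix.conjTranspose_mul, b4, c4]
      _ = C * (A * B * A) := by simp only [Matrix.mul_assoc]
      _ = C * A := by rw [b1]
  calc B = B * A * B := b2.symm
    _ = C * (A * B) := by rw [hBA, Matrix.mul_assoc]
    _ = C * A * C := by rw [hAB, Matrix.mul_assoc]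
    _ = C := c2

/-- `λ_min(A)`: the smallest eigenvalue of a (symmetric) real matrix, for `n ≥ 1`. -/
def lambdaMin {n : ℕ} (A : Matrix (Fin n) (Fin n) ℝ) : ℝ := sInf (spectrum ℝ A)

/-- `ρ(W) = max {λ₂(W), -λ_m(W)}`, where `λ₁(W) ≥ ⋯ ≥ λ_m(W)` are the eigenvalues of the symmetric
matrix `W` counted with multiplicity (`eigenvalues₀` lists them in this order, starting from the
index `0`). For `m = 1` there is no `λ₂`, and `ρ(W) = 0`. -/
def rho {m : ℕ} (W : Matrix (Fin m) (Fin m) ℝ) (hW : W.IsHermitian) : ℝ :=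
  if h : 2 ≤ m then
    max (hW.eigenvalues₀ ⟨1, by rw [Fintype.card_fin]; omega⟩)
      (-hW.eigenvalues₀ ⟨m - 1, by rw [Fintype.card_fin]; omega⟩)
  else 0

/-! ### The standing assumptions -/

/-- The weight matrix `W` is adapted to the graph `G`: nonnegative entries that vanish off the
edges and the diagonal, unit row sums, symmetry, and `ρ(W) < 1`. -/
structure IsWeightMatrix {m : ℕ} (G : SimpleGraph (Fin m)) (W : Matrix (Fin m) (Fin m) ℝ) :
    Prop where
  nonneg : ∀ i j, 0 ≤ W i j
  eq_zero : ∀ i j, ¬ G.Adj i j → i ≠ j → W i j = 0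
  mulVec_one : W *ᵥ 1 = 1
  symm : W.IsHermitian
  rho_lt_one : rho W symm < 1

/-- The features `x i t ∼ N(μ i t, σx² Iₙ)` and the noises `η i t ∼ N(0, ση² I_l)`, for agents `i`
and times `t ≥ 1`, are mutually independent, and `μhat` is the supremum of the norms of the means.
(The values at `t = 0` are unconstrained and never used. The pairs `(x i t, η i t)` are independent
over `(i, t)` and the two members of each pair are independent, that is, all the vectors are
mutually independent.) -/
structure IsGaussianData {Ω : Type*} [MeasurableSpace Ω] (P : Measure Ω) {m n l : ℕ}
    (x : Fin m → ℕ → Ω → EuclideanSpace ℝ (Fin n)) (η : Fin m → ℕ → Ω → EuclideanSpace ℝ (Fin l))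
    (μ : Fin m → ℕ → EuclideanSpace ℝ (Fin n)) (σx ση μhat : ℝ) : Prop where
  law_x : ∀ (i : Fin m) (t : ℕ), 1 ≤ t →
    HasLaw (x i t) (multivariateGaussian (μ i t) (σx ^ 2 • (1 : Matrix (Fin n) (Fin n) ℝ))) P
  law_noise : ∀ (i : Fin m) (t : ℕ), 1 ≤ t →
    HasLaw (η i t) (multivariateGaussian 0 (ση ^ 2 • (1 : Matrix (Fin l) (Fin l) ℝ))) P
  indep : iIndepFun (fun (p : Fin m × ℕ+) (ω : Ω) => (x p.1 p.2 ω, η p.1 p.2 ω)) P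
  indep_pair : ∀ (i : Fin m) (t : ℕ), 1 ≤ t → IndepFun (x i t) (η i t) P
  isLUB_mean : IsLUB {r : ℝ | ∃ (i : Fin m) (t : ℕ), 1 ≤ t ∧ r = ‖μ i t‖} μhat

/-! ### The algorithm

The algorithm is run on deterministic data sequences `x`, `y`, that is, on one realization. -/

/-- The outer product `a bᵀ` of two column vectors. -/
def outer {p q : ℕ} (a : EuclideanSpace ℝ (Fin p)) (b : EuclideanSpace ℝ (Fin q)) :
    Matrix (Fin p) (Fin q) ℝ :=
  Matrix.vecMulVec a.ofLp b.ofLp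

/-- The label `y = Θ x + η`. -/
def label {n l : ℕ} (Θ : Matrix (Fin l) (Fin n) ℝ) (x : EuclideanSpace ℝ (Fin n))
    (η : EuclideanSpace ℝ (Fin l)) : EuclideanSpace ℝ (Fin l) :=
  WithLp.toLp 2 (Θ *ᵥ x.ofLp) + η

/-- One agent's recursion `M_{t+1} = M_t + a_t b_tᵀ`, `M_1 = 0`. The value at `t` is `M_{t+1}`, the
statistic after the samples `1, …, t`. With `a = y`, `b = x` it is `α_{i,t+1}`, with `a = b = x` it
is `β_{i,t+1}`. -/
def stat {p q : ℕ} (a : ℕ → EuclideanSpace ℝ (Fin p)) (b : ℕ → EuclideanSpace ℝ (Fin q)) :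
    ℕ → Matrix (Fin p) (Fin q) ℝ
  | 0 => 0
  | t + 1 => stat a b t + outer (a (t + 1)) (b (t + 1))

/-- The matrices held by the agents after `k` communication steps, from the initial matrices `M`:
`M_i^{k+1} = W(i,i) M_i^k + ∑_{j ∈ N_i} W(i,j) M_j^k`. -/
def consensus {m p q : ℕ} (G : SimpleGraph (Fin m)) [DecidableRel G.Adj]
    (W : Matrix (Fin m) (Fin m) ℝ) (M : Fin m → Matrix (Fin p) (Fin q) ℝ) :
    ℕ → Fin m → Matrix (Fin p) (Fin q) ℝ
  | 0, i => M i
  | k + 1, i => W i i • consensus G W M k i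
      + ∑ j ∈ G.neighborFinset i, W i j • consensus G W M k j

/-- The estimate `Θ̄_{i,t+1}` (the value at `t`) of agent `i`, with communication period `ζ`,
stopping time `S` and `T` communication steps in each communication phase. -/
def thetaBar {m n l : ℕ} (G : SimpleGraph (Fin m)) [DecidableRel G.Adj]
    (W : Matrix (Fin m) (Fin m) ℝ) (ζ S T : ℕ)
    (x : Fin m → ℕ → EuclideanSpace ℝ (Fin n)) (y : Fin m → ℕ → EuclideanSpace ℝ (Fin l))
    (i : Fin m) : ℕ → Matrix (Fin l) (Fin n) ℝ
  | 0 => 0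
  | t + 1 =>
    if (t + 1) % ζ = 0 ∧ t + 1 ≤ S then
      consensus G W (fun j => stat (y j) (x j) (t + 1)) T i
        * pinv (consensus G W (fun j => stat (x j) (x j) (t + 1)) T i)
    else thetaBar G W ζ S T x y i t

/-! ### The quantities in the bound -/

/-- `μ̄_t = 4 / (m t σx²) ∑_{i=1}^m ∑_{j=1}^t μ_{i,j} μ_{i,j}ᵀ`. -/
def muBar {m n : ℕ} (μ : Fin m → ℕ → EuclideanSpace ℝ (Fin n)) (σx : ℝ) (t : ℕ) :
    Matrix (Fin n) (Fin n) ℝ :=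
  (4 / ((m : ℝ) * t * σx ^ 2)) • ∑ i : Fin m, ∑ j ∈ Finset.Icc 1 t, outer (μ i j) (μ i j)

/-- `t₁ = 8 n + 16 log (2/δ)`. -/
def t₁ (n : ℕ) (δ : ℝ) : ℝ := 8 * n + 16 * Real.log (2 / δ)

/-- `t₂ = (16 μhat (√(4n) + √(2 log (2/δ))) / σx)²`. -/
def t₂ (n : ℕ) (σx μhat δ : ℝ) : ℝ :=
  (16 * μhat * (√(4 * n) + √(2 * Real.log (2 / δ))) / σx) ^ 2

/-- `t₃ = 2 (n + l) log (1/δ)`. -/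
def t₃ (n l : ℕ) (δ : ℝ) : ℝ := 2 * (n + l) * Real.log (1 / δ)

/-- `C₁ = 8 ση (4 σx √((n+l) log (9/δ)) + μhat (√(2(l+n)) + 2 √(log (2/δ))))`. -/
def C₁ (n l : ℕ) (σx ση μhat δ : ℝ) : ℝ :=
  8 * ση * (4 * σx * √((n + l) * Real.log (9 / δ))
    + μhat * (√(2 * (l + n)) + 2 * √(Real.log (2 / δ))))

/-- `c₁ = ‖Θ‖ (19/8 σx² + μhat²)`. -/
def c₁ {n l : ℕ} (Θ : Matrix (Fin l) (Fin n) ℝ) (σx μhat : ℝ) : ℝ :=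
  ‖Θ‖ * (19 / 8 * σx ^ 2 + μhat ^ 2)

/-- `c₂ = ση (4 σx √((n+l) log (9/δ)) + μhat (√(2(l+n)) + √(2 log (2/δ))))`. -/
def c₂ (n l : ℕ) (σx ση μhat δ : ℝ) : ℝ :=
  ση * (4 * σx * √((n + l) * Real.log (9 / δ))
    + μhat * (√(2 * (l + n)) + √(2 * Real.log (2 / δ))))

/-- `c₃ = 152 m^{3/2} √(5n) / σx² + 64 m^{3/2} √(5n) / σx⁴ μhat²`. -/
def c₃ (m n : ℕ) (σx μhat : ℝ) : ℝ :=
  152 * (m : ℝ) ^ (3 / 2 : ℝ) * √(5 * n) / σx ^ 2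
    + 64 * (m : ℝ) ^ (3 / 2 : ℝ) * √(5 * n) / σx ^ 4 * μhat ^ 2

/-- `C₀ = c₃ (c₁ + t^{-1/2} c₂) + 8 m^{3/2} √l (c₁ + t^{-1/2} c₂) / σx²
  + r^T m^{3/2} √l c₃ (c₁ + t^{-1/2} c₂)`, where `r` stands for `ρ(W)` and the `δ` in `c₂` is the
confidence parameter of the network term. -/
def C₀ (m : ℕ) {n l : ℕ} (Θ : Matrix (Fin l) (Fin n) ℝ) (σx ση μhat δ r : ℝ) (t T : ℕ) : ℝ :=
  c₃ m n σx μhat * (c₁ Θ σx μhat + (t : ℝ) ^ (-(1 / 2) : ℝ) * c₂ n l σx ση μhat δ)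
    + 8 * (m : ℝ) ^ (3 / 2 : ℝ) * √l
        * (c₁ Θ σx μhat + (t : ℝ) ^ (-(1 / 2) : ℝ) * c₂ n l σx ση μhat δ) / σx ^ 2
    + r ^ T * (m : ℝ) ^ (3 / 2 : ℝ) * √l * c₃ m n σx μhat
        * (c₁ Θ σx μhat + (t : ℝ) ^ (-(1 / 2) : ℝ) * c₂ n l σx ση μhat δ)

end DistributedEstimation

end

open DistributedEstimation

noncomputable section

namespace DistributedEstimation

open scoped ENNReal RealInnerProductSpace

/-! ### Gaussian integrals -/

-- Write p_j for the entries of row i of W^T, β_j = ∑ x x^* and N_j = ∑ η x^* for the statistics of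
-- agent j. Communication replaces α_i and β_i by ∑ p_j α_j and ∑ p_j β_j, and α_j = Θ β_j + N_j. If
-- every β_j is at least a positive multiple of the identity, then ∑ p_j β_j is invertible and the
-- signal cancels exactly: the error is (∑ p_j N_j)(∑ p_j β_j)⁻¹, pure noise. No term proportional
-- to ‖Θ‖ arises, so the corresponding summands of C₀ are slack.
--
-- This noise term is compared with its uniform average, p_j = 1/m. The average gives the
-- statistical term C₁. The difference is controlled by ∑ |p_j - 1/m| ≤ √m ρ(W)^T, the spectral gap
-- estimate for W, and gives the network term. The comparison is deterministic
-- (`sum_mul_crossForm_le`) and needs four facts: a lower bound β_j ≥ tσ_x²/8 + ½ ∑ μμ^* as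
-- quadratic forms, an upper bound for β_j of order t, a bound on each N_j, and a bound on ∑ N_j.
-- The noise bounds are self-normalised, that is, relative to the square root of the quadratic form
-- of β_j (or ∑ β_j). The lower bound keeps the means, and that is how λ_min(I + μ̄_t) enters.
--
-- The probabilistic facts hold uniformly over directions without nets, by a variational (PAC-Bayes)
-- argument. For each fixed direction there is an exponential of mean one. Averaging it over a
-- Gaussian random direction and applying Markov's inequality bounds the average by 1/δ outside
-- probability δ (`measure_mixture_ge_le`). On that event, Jensen's inequality under a shifted
-- Gaussian, whose relative entropy is ‖h‖²/2, gives a bound at every direction simultaneously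
-- (`integral_shift_sub_lt`). `measure_bilinear_le` applies this to Gaussian bilinear forms, and
-- `measure_lower_tail` to the smallest eigenvalue. Three events for each agent and one for the
-- network are lost, with probability at most 3mδ̂ + δ.

theorem lintegral_pi_prod {ι : Type*} [Fintype ι] {X : ι → Type*} [∀ i, MeasurableSpace (X i)]
    (μ : ∀ i, Measure (X i)) [∀ i, IsProbabilityMeasure (μ i)] (f : ∀ i, X i → ℝ≥0∞)
    (hf : ∀ i, Measurable (f i)) :
    ∫⁻ x, ∏ i, f i (x i) ∂Measure.pi μ = ∏ i, ∫⁻ y, f i y ∂μ i := by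
  have hind : iIndepFun (fun i (x : ∀ i, X i) => f i (x i)) (Measure.pi μ) :=
    iIndepFun_pi (fun i => (hf i).aemeasurable)
  have h := lintegral_prod_eq_prod_lintegral_of_indepFun (μ := Measure.pi μ) Finset.univ
    (fun i (x : ∀ i, X i) => f i (x i)) hind
    (fun i => (hf i).comp (measurable_pi_apply i))
  rw [h]
  refine Finset.prod_congr rfl fun i _ => ?_
  rw [(measurePreserving_eval μ i).lintegral_comp (hf i)]

theorem gaussianReal_eq_withDensity (h : ℝ) :
    gaussianReal h 1 =
      (gaussianReal 0 1).withDensity (fun z => ENNReal.ofReal (Real.exp (h * z - h ^ 2 / 2))) := by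
  rw [gaussianReal_of_var_ne_zero _ one_ne_zero, gaussianReal_of_var_ne_zero _ one_ne_zero,
    ← withDensity_mul _ (measurable_gaussianPDF _ _) (by fun_prop)]
  congr 1
  funext z
  rw [Pi.mul_apply, gaussianPDF, gaussianPDF, ← ENNReal.ofReal_mul (gaussianPDFReal_nonneg _ _ _),
    gaussianPDFReal, gaussianPDFReal, mul_assoc _ (Real.exp _) (Real.exp _), ← Real.exp_add]
  congr 3
  simp
  ring

theorem pi_gaussianReal_eq_withDensity {ι : Type*} [Fintype ι] (h : ι → ℝ) :
    Measure.pi (fun i => gaussianReal (h i) 1) =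
      (Measure.pi fun _ : ι => gaussianReal 0 1).withDensity
        (fun z => ∏ i, ENNReal.ofReal (Real.exp (h i * z i - h i ^ 2 / 2))) := by
  refine Measure.pi_eq fun s hs => ?_
  rw [withDensity_apply _ (MeasurableSet.univ_pi hs),
    ← lintegral_indicator (MeasurableSet.univ_pi hs)]
  have : ∀ z : ι → ℝ, (Set.univ.pi s).indicator
      (fun z => ∏ i, ENNReal.ofReal (Real.exp (h i * z i - h i ^ 2 / 2))) z =
      ∏ i, (s i).indicator (fun y => ENNReal.ofReal (Real.exp (h i * y - h i ^ 2 / 2))) (z i) := by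
    intro z
    by_cases hz : z ∈ Set.univ.pi s
    · rw [Set.indicator_of_mem hz]
      exact Finset.prod_congr rfl fun i _ => by rw [Set.indicator_of_mem (hz i trivial)]
    · rw [Set.indicator_of_notMem hz]
      simp only [Set.mem_univ_pi, not_forall] at hz
      obtain ⟨i, hi⟩ := hz
      exact (Finset.prod_eq_zero (Finset.mem_univ i) (Set.indicator_of_notMem hi _)).symm
  simp_rw [this]
  rw [lintegral_pi_prod (fun _ => gaussianReal 0 1)
    (fun i => (s i).indicator (fun y => ENNReal.ofReal (Real.exp (h i * y - h i ^ 2 / 2))))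
    (fun i => Measurable.indicator (by fun_prop) (hs i))]
  refine Finset.prod_congr rfl fun i _ => ?_
  rw [lintegral_indicator (hs i), gaussianReal_eq_withDensity (h i), withDensity_apply _ (hs i)]

section Shift

variable {E : Type*} [NormedAddCommGroup E] [InnerProductSpace ℝ E] [FiniteDimensional ℝ E]
  [MeasurableSpace E] [BorelSpace E]

/-- The Cameron-Martin formula for the standard Gaussian measure. -/
theorem lintegral_stdGaussian_shift (h : E) (f : E → ℝ≥0∞) (hf : Measurable f) :
    ∫⁻ w, f w ∂stdGaussian E =
      ∫⁻ w, f (w + h) * ENNReal.ofReal (Real.exp (-⟪h, w⟫ - ‖h‖ ^ 2 / 2)) ∂stdGaussian E := by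
  set b := stdOrthonormalBasis ℝ E
  set T : (Fin (Module.finrank ℝ E) → ℝ) → E := fun x => ∑ i, x i • b i with hT
  have hTm : Measurable T := Finset.measurable_sum _ (by fun_prop)
  set a : Fin (Module.finrank ℝ E) → ℝ := fun i => ⟪b i, h⟫ with ha
  have hTa : T a = h := b.sum_repr' h
  have hTadd : ∀ x, T (x + a) = T x + h := by
    intro x
    rw [← hTa]
    simp [hT, add_smul, Finset.sum_add_distrib]
  have hinner : ∀ x, ⟪h, T x⟫ = ∑ i, a i * x i := by
    intro x
    simp only [hT, inner_sum, real_inner_smul_right, ha]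
    exact Finset.sum_congr rfl fun i _ => by rw [real_inner_comm, mul_comm]
  have hnorm : ‖h‖ ^ 2 = ∑ i, a i ^ 2 := (b.sum_sq_inner_right h).symm
  have hmap : Measure.pi (fun i => gaussianReal (a i) 1) =
      (Measure.pi fun _ : Fin (Module.finrank ℝ E) => gaussianReal 0 1).map (· + a) := by
    have := Measure.pi_map_pi (μ := fun _ : Fin (Module.finrank ℝ E) => gaussianReal 0 1)
      (f := fun i y => y + a i) (fun i => by fun_prop)
    rw [show (fun x : Fin (Module.finrank ℝ E) → ℝ => x + a) = fun x i => x i + a i from rfl, this]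
    congr 1
    funext i
    rw [gaussianReal_map_add_const, zero_add]
  unfold stdGaussian
  rw [lintegral_map hf hTm, lintegral_map (by fun_prop) hTm]
  -- The right-hand integrand rewritten as a function of the shifted point. Its exponential is the
  -- reciprocal of the density of the shifted law, so the two cancel after the substitution.
  set g : (Fin (Module.finrank ℝ E) → ℝ) → ℝ≥0∞ := fun x =>
    f (T x) * ENNReal.ofReal (Real.exp (-⟪h, T x⟫ + ‖h‖ ^ 2 / 2)) with hg
  have hgm : Measurable g := by
    have : Measurable fun x => f (T x) := hf.comp hTm
    fun_prop
  have e1 : ∀ x, f (T x + h) * ENNReal.ofReal (Real.exp (-⟪h, T x⟫ - ‖h‖ ^ 2 / 2)) = g (x + a) := by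
    intro x
    simp only [hg]
    rw [hTadd, inner_add_right, real_inner_self_eq_norm_sq]
    congr 3
    ring
  change _ = ∫⁻ x, f (T x + h) * ENNReal.ofReal (Real.exp (-⟪h, T x⟫ - ‖h‖ ^ 2 / 2)) ∂_
  simp_rw [e1]
  rw [← lintegral_map (f := g) (g := (· + a)) hgm (by fun_prop), ← hmap,
    pi_gaussianReal_eq_withDensity a,
    lintegral_withDensity_eq_lintegral_mul _ (Finset.measurable_prod _ (by fun_prop)) hgm]
  refine lintegral_congr fun x => ?_
  rw [Pi.mul_apply, ← ENNReal.ofReal_prod_of_nonneg (fun _ _ => (Real.exp_pos _).le), ← Real.exp_sum,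
    Finset.sum_sub_distrib, ← Finset.sum_div, ← hnorm, ← hinner]
  simp only [hg]
  rw [mul_comm (f (T x)), ← mul_assoc, ← ENNReal.ofReal_mul (Real.exp_pos _).le, ← Real.exp_add]
  simp

end Shift

/-- The Laplace transform of the square of a Gaussian variable. -/
theorem lintegral_exp_neg_sq_gaussianReal (a m : ℝ) (ha : 0 < 1 + 2 * a) :
    ∫⁻ z, ENNReal.ofReal (Real.exp (-a * (m + z) ^ 2)) ∂gaussianReal 0 1 =
      ENNReal.ofReal (Real.exp (-(1 / 2) * Real.log (1 + 2 * a) - a * m ^ 2 / (1 + 2 * a))) := by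
  set s : ℝ := 1 + 2 * a with hs
  have hv : (⟨s⁻¹, (inv_pos.2 ha).le⟩ : NNReal) ≠ 0 :=
    fun h => (inv_pos.2 ha).ne' (congrArg NNReal.toReal h)
  set v : NNReal := ⟨s⁻¹, (inv_pos.2 ha).le⟩ with hvdef
  have hvs : (v : ℝ) = s⁻¹ := rfl
  rw [gaussianReal_of_var_ne_zero _ one_ne_zero,
    lintegral_withDensity_eq_lintegral_mul _ (measurable_gaussianPDF _ _) (by fun_prop)]
  -- Completing the square: the integrand is a constant times a Gaussian density of mean -2am/(1+2a)
  -- and variance 1/(1+2a).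
  have key : ∀ z, (gaussianPDF 0 1 * fun z => ENNReal.ofReal (Real.exp (-a * (m + z) ^ 2))) z =
      ENNReal.ofReal (Real.exp (-(1 / 2) * Real.log s - a * m ^ 2 / s)) *
        gaussianPDF (-(2 * a * m / s)) v z := by
    intro z
    rw [Pi.mul_apply, gaussianPDF, gaussianPDF,
      ← ENNReal.ofReal_mul (gaussianPDFReal_nonneg _ _ _), ← ENNReal.ofReal_mul (Real.exp_pos _).le]
    congr 1
    rw [gaussianPDFReal, gaussianPDFReal, hvs]
    have h1 : Real.exp (-(1 / 2) * Real.log s - a * m ^ 2 / s) =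
        (√s)⁻¹ * Real.exp (- (a * m ^ 2 / s)) := by
      rw [sub_eq_add_neg, Real.exp_add, Real.sqrt_eq_rpow, ← Real.rpow_neg ha.le,
        Real.rpow_def_of_pos ha]
      congr 2
      ring
    rw [h1]
    have h2 : √(2 * Real.pi * s⁻¹) = √(2 * Real.pi) * (√s)⁻¹ := by
      rw [Real.sqrt_mul (by positivity), Real.sqrt_inv]
    rw [h2]
    have hss : √s ≠ 0 := (Real.sqrt_pos.2 ha).ne'
    have h3 : ∀ A B : ℝ, (√s)⁻¹ * A * ((√(2 * Real.pi) * (√s)⁻¹)⁻¹ * B) =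
        (√(2 * Real.pi))⁻¹ * (A * B) := by
      intro A B
      field_simp
    rw [h3, ← Real.exp_add, mul_assoc, ← Real.exp_add]
    simp only [NNReal.coe_one, mul_one]
    congr 2
    field_simp
    rw [hs]
    ring
  simp_rw [key]
  rw [lintegral_const_mul _ (measurable_gaussianPDF _ _), lintegral_gaussianPDF_eq_one _ hv, mul_one]

/-! ### Moments of the standard Gaussian measure -/

/-- The fourth derivative at 0 of the moment generating function exp(t²/2). Each differentiation
turns p(t) exp(t²/2) into (p' + t p) exp(t²/2). -/
theorem integral_pow_four_gaussianReal : ∫ z, z ^ 4 ∂gaussianReal 0 1 = 3 := by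
  have hmem : ∀ t : ℝ, t ∈ interior (integrableExpSet id (gaussianReal 0 1)) := by
    intro t
    rw [integrableExpSet_id_gaussianReal, interior_univ]
    trivial
  have hd : ∀ (n : ℕ) (t : ℝ),
      HasDerivAt (fun t : ℝ => ∫ z, z ^ n * Real.exp (t * z) ∂gaussianReal 0 1)
        (∫ z, z ^ (n + 1) * Real.exp (t * z) ∂gaussianReal 0 1) t :=
    fun n t => hasDerivAt_integral_pow_mul_exp_real (hmem t) n
  have h0 : (fun t : ℝ => ∫ z, z ^ 0 * Real.exp (t * z) ∂gaussianReal 0 1) =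
      fun t => Real.exp (t ^ 2 / 2) := by
    have := mgf_id_gaussianReal (μ := 0) (v := 1)
    funext t
    have h := congrFun this t
    simp only [mgf, id] at h
    simpa using h
  have he : ∀ t : ℝ, HasDerivAt (fun t : ℝ => Real.exp (t ^ 2 / 2)) (t * Real.exp (t ^ 2 / 2)) t := by
    intro t
    have := ((hasDerivAt_pow 2 t).div_const 2).exp
    convert this using 1
    simp
    ring
  have step : ∀ (n : ℕ) (p p' : ℝ → ℝ), (∀ t, HasDerivAt p (p' t) t) →
      (fun t : ℝ => ∫ z, z ^ n * Real.exp (t * z) ∂gaussianReal 0 1) =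
        (fun t => p t * Real.exp (t ^ 2 / 2)) →
      (fun t : ℝ => ∫ z, z ^ (n + 1) * Real.exp (t * z) ∂gaussianReal 0 1) =
        (fun t => (p' t + t * p t) * Real.exp (t ^ 2 / 2)) := by
    intro n p p' hp h
    funext t
    have h1 := hd n t
    rw [h] at h1
    rw [h1.unique ((hp t).mul (he t))]
    ring
  have s1 := step 0 (fun _ => 1) (fun _ => 0) (fun t => hasDerivAt_const t _) (by rw [h0]; simp)
  have s2 := step 1 (fun t => t) (fun _ => 1) (fun t => hasDerivAt_id' t) (by rw [s1]; simp)
  have s3 := step 2 (fun t => 1 + t ^ 2) (fun t => 2 * t)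
    (fun t => by simpa using (hasDerivAt_pow 2 t).const_add 1) (by rw [s2]; funext t; ring)
  have s4 := step 3 (fun t => 3 * t + t ^ 3) (fun t => 3 + 3 * t ^ 2)
    (fun t => by simpa using ((hasDerivAt_id' t).const_mul 3).fun_add (hasDerivAt_pow 3 t))
    (by rw [s3]; funext t; ring)
  simpa using congrFun s4 0

section Moments

variable {E : Type*} [NormedAddCommGroup E] [InnerProductSpace ℝ E] [FiniteDimensional ℝ E]
  [MeasurableSpace E] [BorelSpace E]

theorem integrable_norm_pow_stdGaussian (k : ℕ) :
    Integrable (fun w : E => ‖w‖ ^ k) (stdGaussian E) := by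
  have h := IsGaussian.memLp_id (stdGaussian E) k (by simp)
  exact h.integrable_norm_pow'

theorem integrable_of_polynomial_growth {f : E → ℝ} (hf : Measurable f) (C : ℝ)
    (h : ∀ w, |f w| ≤ C * (1 + ‖w‖ ^ 4)) : Integrable f (stdGaussian E) := by
  refine Integrable.mono' (((integrable_const (1 : ℝ)).add
    (integrable_norm_pow_stdGaussian 4)).const_mul C) hf.aestronglyMeasurable ?_
  exact Filter.Eventually.of_forall h

theorem integrable_inner_stdGaussian (u : E) :
    Integrable (fun w : E => ⟪u, w⟫) (stdGaussian E) :=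
  (innerSL ℝ u).integrable_comp IsGaussian.integrable_id

theorem integral_inner_stdGaussian (u : E) : ∫ w : E, ⟪u, w⟫ ∂stdGaussian E = 0 :=
  integral_strongDual_stdGaussian (innerSL ℝ u)

theorem integrable_neg_inner_sub_stdGaussian (u : E) (c : ℝ) :
    Integrable (fun w : E => -⟪u, w⟫ - c) (stdGaussian E) :=
  (integrable_inner_stdGaussian u).neg.sub (integrable_const _)

theorem integral_neg_inner_sub_stdGaussian (u : E) (c : ℝ) :
    ∫ w : E, (-⟪u, w⟫ - c) ∂stdGaussian E = -c := by
  have h : Integrable (fun w : E => -⟪u, w⟫) (stdGaussian E) :=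
    (integrable_inner_stdGaussian u).neg
  rw [integral_sub h (integrable_const _), integral_neg, integral_inner_stdGaussian]
  simp

theorem integrable_inner_sq_stdGaussian (u : E) :
    Integrable (fun w : E => ⟪u, w⟫ ^ 2) (stdGaussian E) := by
  refine Integrable.mono' ((integrable_norm_pow_stdGaussian 2).const_mul (‖u‖ ^ 2))
    (by fun_prop) (Filter.Eventually.of_forall fun w => ?_)
  rw [Real.norm_eq_abs, abs_pow, ← mul_pow]
  exact pow_le_pow_left₀ (abs_nonneg _) (abs_real_inner_le_norm u w) 2

theorem integral_inner_sq_stdGaussian (u : E) :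
    ∫ w : E, ⟪u, w⟫ ^ 2 ∂stdGaussian E = ‖u‖ ^ 2 := by
  have h := variance_dual_stdGaussian (innerSL ℝ u)
  rw [variance_eq_integral (by fun_prop)] at h
  simpa [integral_inner_stdGaussian] using h

theorem integral_norm_sq_stdGaussian :
    ∫ w : E, ‖w‖ ^ 2 ∂stdGaussian E = Module.finrank ℝ E := by
  set b := stdOrthonormalBasis ℝ E
  have : ∀ w : E, ‖w‖ ^ 2 = ∑ i, ⟪b i, w⟫ ^ 2 := fun w => (b.sum_sq_inner_right w).symm
  simp_rw [this]
  rw [integral_finsetSum _ fun i _ => integrable_inner_sq_stdGaussian _]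
  simp [integral_inner_sq_stdGaussian]

/-- The integrand is odd and the measure is invariant under negation. -/
theorem integral_inner_mul_norm_sq_sub_stdGaussian (u : E) (c : ℝ) :
    ∫ w : E, ⟪u, w⟫ * (‖w‖ ^ 2 - c) ∂stdGaussian E = 0 := by
  have h := stdGaussian_map (LinearIsometryEquiv.neg ℝ (E := E))
  have h2 : ∫ w : E, ⟪u, w⟫ * (‖w‖ ^ 2 - c) ∂stdGaussian E =
      ∫ w : E, -(⟪u, w⟫ * (‖w‖ ^ 2 - c)) ∂stdGaussian E := by
    conv_lhs => rw [← h]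
    rw [integral_map (by fun_prop) (by fun_prop)]
    refine integral_congr_ae (Filter.Eventually.of_forall fun w => ?_)
    simp
  rw [integral_neg] at h2
  linarith

/-- This is the variance of a chi-square variable: a sum of independent squares, each of variance 3
- 1 = 2. -/
theorem integral_norm_sq_sub_sq_stdGaussian :
    ∫ w : E, (‖w‖ ^ 2 - Module.finrank ℝ E) ^ 2 ∂stdGaussian E = 2 * Module.finrank ℝ E := by
  obtain ⟨b, hb⟩ : ∃ b, b = stdOrthonormalBasis ℝ E := ⟨_, rfl⟩
  have h4 : MemLp (fun z : ℝ => z ^ 2) 2 (gaussianReal 0 1) := by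
    rw [memLp_two_iff_integrable_sq (by fun_prop)]
    have := (memLp_id_gaussianReal (μ := 0) (v := 1) 4).integrable_norm_pow'
    refine this.congr (Filter.Eventually.of_forall fun z => ?_)
    change |z| ^ 4 = (z ^ 2) ^ 2
    rw [← sq_abs z]
    ring
  have h2 : ∫ z, z ^ 2 ∂gaussianReal 0 1 = 1 := by
    have := variance_id_gaussianReal (μ := 0) (v := 1)
    rw [variance_eq_integral (by fun_prop)] at this
    simpa using this
  have hv : Var[fun z : ℝ => z ^ 2; gaussianReal 0 1] = 2 := by
    rw [variance_eq_sub h4]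
    simp only [Pi.pow_apply, h2]
    have : ∀ z : ℝ, (z ^ 2) ^ 2 = z ^ 4 := fun z => by ring
    simp_rw [this, integral_pow_four_gaussianReal]
    norm_num
  have hsum := variance_sum_pi (μ := fun _ : Fin (Module.finrank ℝ E) => gaussianReal 0 1)
    (X := fun _ z => z ^ 2) (fun _ => h4)
  rw [show (fun i : Fin (Module.finrank ℝ E) => Var[fun z : ℝ => z ^ 2; gaussianReal 0 1]) =
    fun _ => 2 from funext fun _ => hv] at hsum
  have hT : Measurable fun x : Fin (Module.finrank ℝ E) → ℝ => ∑ i, x i • b i :=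
    Finset.measurable_sum _ (by fun_prop)
  have hn : ∀ x : Fin (Module.finrank ℝ E) → ℝ, ‖∑ i, x i • b i‖ ^ 2 = ∑ i, x i ^ 2 := by
    intro x
    rw [← b.sum_sq_inner_right]
    refine Finset.sum_congr rfl fun i _ => ?_
    rw [b.orthonormal.inner_right_fintype]
  have hm : ∫ x : Fin (Module.finrank ℝ E) → ℝ, ∑ i, x i ^ 2
      ∂Measure.pi (fun _ => gaussianReal 0 1) = Module.finrank ℝ E := by
    rw [← integral_norm_sq_stdGaussian (E := E), stdGaussian, ← hb,
      integral_map hT.aemeasurable (by fun_prop)]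
    simp_rw [hn]
  have hfun : (∑ i : Fin (Module.finrank ℝ E), fun x : Fin (Module.finrank ℝ E) → ℝ => x i ^ 2) =
      fun x => ∑ i, x i ^ 2 := by
    funext x
    simp
  rw [hfun, variance_eq_integral (Finset.measurable_sum _ fun i _ => by fun_prop).aemeasurable,
    hm, Finset.sum_const, Finset.card_univ, Fintype.card_fin, nsmul_eq_mul] at hsum
  rw [stdGaussian, ← hb, integral_map hT.aemeasurable (by fun_prop)]
  simp_rw [hn]
  rw [hsum]
  ring

end Moments

/-! ### Change of measure inequalities -/

/-- Jensen's inequality in extended form: when exp ∘ f is not integrable the right side is infinite,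
so only f has to be integrable. -/
theorem ofReal_exp_integral_le {V : Type*} [MeasurableSpace V] (γ : Measure V)
    [IsProbabilityMeasure γ] (f : V → ℝ) (hf : Integrable f γ) :
    ENNReal.ofReal (Real.exp (∫ w, f w ∂γ)) ≤ ∫⁻ w, ENNReal.ofReal (Real.exp (f w)) ∂γ := by
  by_cases h : Integrable (fun w => Real.exp (f w)) γ
  · rw [← ofReal_integral_eq_lintegral_ofReal h
      (Filter.Eventually.of_forall fun _ => (Real.exp_pos _).le)]
    exact ENNReal.ofReal_le_ofReal (convexOn_exp.map_integral_le Real.continuous_exp.continuousOn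
      isClosed_univ (by simp) hf h)
  · have hm : AEStronglyMeasurable (fun w => Real.exp (f w)) γ :=
      Real.continuous_exp.comp_aestronglyMeasurable hf.1
    have : ∫⁻ w, ENNReal.ofReal (Real.exp (f w)) ∂γ = ⊤ := by
      by_contra hne
      refine h ⟨hm, ?_⟩
      rw [hasFiniteIntegral_iff_ofReal (Filter.Eventually.of_forall fun _ => (Real.exp_pos _).le)]
      exact lt_top_iff_ne_top.2 hne
    rw [this]
    exact le_top

section ChangeOfMeasure

variable {E F : Type*} [NormedAddCommGroup E] [InnerProductSpace ℝ E] [FiniteDimensional ℝ E]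
  [MeasurableSpace E] [BorelSpace E] [NormedAddCommGroup F] [InnerProductSpace ℝ F]
  [FiniteDimensional ℝ F] [MeasurableSpace F] [BorelSpace F]

/-- The Gaussian case of the Donsker–Varadhan inequality: shift by h with Cameron–Martin, then apply
Jensen to the exponent. One bound on an average over w thus yields a bound at every centre h, at the
price ‖h‖²/2. -/
theorem integral_shift_sub_lt (h : E) {f : E → ℝ} (hf : Measurable f) {C : ℝ}
    (hi : Integrable (fun w => f (w + h)) (stdGaussian E))
    (hC : ∫⁻ w, ENNReal.ofReal (Real.exp (f w)) ∂stdGaussian E < ENNReal.ofReal (Real.exp C)) :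
    ∫ w, f (w + h) ∂stdGaussian E - ‖h‖ ^ 2 / 2 < C := by
  rw [lintegral_stdGaussian_shift h _ (by fun_prop)] at hC
  simp_rw [← ENNReal.ofReal_mul (Real.exp_pos _).le, ← Real.exp_add] at hC
  have hI : Integrable (fun w : E => -⟪h, w⟫ - ‖h‖ ^ 2 / 2) (stdGaussian E) :=
    integrable_neg_inner_sub_stdGaussian h _
  have h1 := (ofReal_exp_integral_le (stdGaussian E) _ (hi.add hI)).trans_lt hC
  rw [ENNReal.ofReal_lt_ofReal_iff (Real.exp_pos _), Real.exp_lt_exp] at h1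
  simp only [Pi.add_apply] at h1
  rw [integral_add hi hI, integral_neg_inner_sub_stdGaussian] at h1
  linarith

theorem lintegral_prod_stdGaussian_shift (h : E) (k : F) (f : E → F → ℝ≥0∞)
    (hf : Measurable (Function.uncurry f)) :
    ∫⁻ w, ∫⁻ v, f w v ∂stdGaussian F ∂stdGaussian E =
      ∫⁻ w, ∫⁻ v, f (w + h) (v + k) * ENNReal.ofReal (Real.exp (-⟪h, w⟫ - ‖h‖ ^ 2 / 2
        + (-⟪k, v⟫ - ‖k‖ ^ 2 / 2))) ∂stdGaussian F ∂stdGaussian E := by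
  rw [lintegral_stdGaussian_shift h (fun w => ∫⁻ v, f w v ∂stdGaussian F)
    hf.lintegral_prod_right]
  refine lintegral_congr fun w => ?_
  have hm : Measurable (f (w + h)) := hf.comp measurable_prodMk_left
  rw [lintegral_stdGaussian_shift k (f (w + h)) hm,
    ← lintegral_mul_const _ (by
      have : Measurable fun v => f (w + h) (v + k) := hm.comp (measurable_add_const k)
      fun_prop)]
  refine lintegral_congr fun v => ?_
  rw [Real.exp_add, ENNReal.ofReal_mul (Real.exp_pos _).le, mul_assoc, mul_comm (ENNReal.ofReal _)]

theorem integral_prod_shift_sub_lt (h : E) (k : F) {f : E → F → ℝ}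
    (hf : Measurable (Function.uncurry f)) {C : ℝ}
    (hi : Integrable (fun p : E × F => f (p.1 + h) (p.2 + k))
      ((stdGaussian E).prod (stdGaussian F)))
    (hC : ∫⁻ w, ∫⁻ v, ENNReal.ofReal (Real.exp (f w v)) ∂stdGaussian F ∂stdGaussian E
      < ENNReal.ofReal (Real.exp C)) :
    ∫ p : E × F, f (p.1 + h) (p.2 + k) ∂(stdGaussian E).prod (stdGaussian F)
      - ‖h‖ ^ 2 / 2 - ‖k‖ ^ 2 / 2 < C := by
  have hfm : Measurable fun p : E × F => f (p.1 + h) (p.2 + k) :=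
    hf.comp (f := fun p : E × F => (p.1 + h, p.2 + k)) (by fun_prop)
  rw [lintegral_prod_stdGaussian_shift h k (fun w v => ENNReal.ofReal (Real.exp (f w v)))
    (ENNReal.measurable_ofReal.comp (Real.measurable_exp.comp hf))] at hC
  simp_rw [← ENNReal.ofReal_mul (Real.exp_pos _).le, ← Real.exp_add] at hC
  rw [lintegral_lintegral (f := fun w v => ENNReal.ofReal (Real.exp (f (w + h) (v + k) +
    (-⟪h, w⟫ - ‖h‖ ^ 2 / 2 + (-⟪k, v⟫ - ‖k‖ ^ 2 / 2))))) (by fun_prop)] at hC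
  have hI1 : Integrable (fun p : E × F => -⟪h, p.1⟫ - ‖h‖ ^ 2 / 2)
      ((stdGaussian E).prod (stdGaussian F)) :=
    (integrable_neg_inner_sub_stdGaussian h _).comp_fst _
  have hI2 : Integrable (fun p : E × F => -⟪k, p.2⟫ - ‖k‖ ^ 2 / 2)
      ((stdGaussian E).prod (stdGaussian F)) :=
    (integrable_neg_inner_sub_stdGaussian k _).comp_snd _
  have hI12 : Integrable (fun p : E × F => -⟪h, p.1⟫ - ‖h‖ ^ 2 / 2 + (-⟪k, p.2⟫ - ‖k‖ ^ 2 / 2))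
      ((stdGaussian E).prod (stdGaussian F)) := hI1.add hI2
  have h1 := (ofReal_exp_integral_le _ (fun p : E × F => f (p.1 + h) (p.2 + k) +
    (-⟪h, p.1⟫ - ‖h‖ ^ 2 / 2 + (-⟪k, p.2⟫ - ‖k‖ ^ 2 / 2))) (hi.add hI12)).trans_lt hC
  rw [ENNReal.ofReal_lt_ofReal_iff (Real.exp_pos _), Real.exp_lt_exp] at h1
  have e1 : ∫ p : E × F, (-⟪h, p.1⟫ - ‖h‖ ^ 2 / 2) ∂(stdGaussian E).prod (stdGaussian F) =
      - (‖h‖ ^ 2 / 2) := by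
    rw [integral_fun_fst (fun w : E => -⟪h, w⟫ - ‖h‖ ^ 2 / 2),
      integral_neg_inner_sub_stdGaussian]
    simp
  have e2 : ∫ p : E × F, (-⟪k, p.2⟫ - ‖k‖ ^ 2 / 2) ∂(stdGaussian E).prod (stdGaussian F) =
      - (‖k‖ ^ 2 / 2) := by
    rw [integral_fun_snd (fun w : F => -⟪k, w⟫ - ‖k‖ ^ 2 / 2),
      integral_neg_inner_sub_stdGaussian]
    simp
  rw [integral_add hi hI12, integral_add hI1 hI2, e1, e2] at h1
  linarith

end ChangeOfMeasure

/-- Markov's inequality for a mixture of exponential moments. -/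
theorem measure_mixture_ge_le {Ω V : Type*} [MeasurableSpace Ω] [MeasurableSpace V]
    (P : Measure Ω) [SFinite P] (γ : Measure V) [IsProbabilityMeasure γ]
    {f : Ω → V → ℝ≥0∞} (hf : Measurable (Function.uncurry f))
    (h1 : ∀ v, ∫⁻ ω, f ω v ∂P ≤ 1) {δ : ℝ} (hδ : 0 < δ) :
    P {ω | ENNReal.ofReal (Real.exp (Real.log (1 / δ))) ≤ ∫⁻ v, f ω v ∂γ} ≤ ENNReal.ofReal δ := by
  rw [Real.exp_log (by positivity)]
  refine (meas_ge_le_lintegral_div hf.lintegral_prod_right.aemeasurable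
    (by simpa using hδ) ENNReal.ofReal_ne_top).trans ?_
  rw [lintegral_lintegral_swap hf.aemeasurable]
  refine (ENNReal.div_le_div_right (b := 1) ?_ _).trans ?_
  · calc ∫⁻ v, ∫⁻ ω, f ω v ∂P ∂γ ≤ ∫⁻ _, 1 ∂γ := lintegral_mono h1
      _ = 1 := by simp
  · rw [one_div, one_div, ENNReal.ofReal_inv_of_pos hδ, inv_inv]

/-! ### Norms of Gaussian matrices -/

section Bilinear

variable {E : Type*} [NormedAddCommGroup E] [InnerProductSpace ℝ E] [FiniteDimensional ℝ E]
  [MeasurableSpace E] [BorelSpace E]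

theorem norm_add_sq_eq {E : Type*} [NormedAddCommGroup E] [InnerProductSpace ℝ E] (h w : E) :
    ‖w + h‖ ^ 2 = ‖w‖ ^ 2 + 2 * ⟪h, w⟫ + ‖h‖ ^ 2 := by
  rw [norm_add_sq_real, real_inner_comm]

theorem integrable_norm_add_sq_stdGaussian (h : E) :
    Integrable (fun w : E => ‖w + h‖ ^ 2) (stdGaussian E) := by
  simp_rw [norm_add_sq_eq]
  exact ((integrable_norm_pow_stdGaussian 2).add ((integrable_inner_stdGaussian h).const_mul 2)).add
    (integrable_const _)

theorem integral_norm_add_sq_stdGaussian (h : E) :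
    ∫ w : E, ‖w + h‖ ^ 2 ∂stdGaussian E = Module.finrank ℝ E + ‖h‖ ^ 2 := by
  simp_rw [norm_add_sq_eq]
  have h12 : Integrable (fun w : E => ‖w‖ ^ 2 + 2 * ⟪h, w⟫) (stdGaussian E) :=
    (integrable_norm_pow_stdGaussian 2).add ((integrable_inner_stdGaussian h).const_mul 2)
  rw [integral_add h12 (integrable_const _),
    integral_add (integrable_norm_pow_stdGaussian 2) ((integrable_inner_stdGaussian h).const_mul 2),
    integral_const_mul, integral_inner_stdGaussian, integral_norm_sq_stdGaussian]
  simp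

theorem lintegral_exp_inner_stdGaussian (u : E) :
    ∫⁻ w : E, ENNReal.ofReal (Real.exp (⟪u, w⟫ - ‖u‖ ^ 2 / 2)) ∂stdGaussian E = 1 := by
  have h := lintegral_stdGaussian_shift (-u) (fun _ => 1) measurable_const
  simp only [inner_neg_left, neg_neg, norm_neg, one_mul, lintegral_const, measure_univ] at h
  exact h.symm

variable {ι : Type*} [Fintype ι]

/-- For fixed v and y the bilinear form is a centred Gaussian of variance ‖v‖²‖y‖², so its
normalised exponential has mean one. -/
theorem lintegral_exp_bilinear (v : E) (y : EuclideanSpace ℝ ι) (lam : ℝ) :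
    ∫⁻ g, ENNReal.ofReal (Real.exp (lam * ∑ p, ⟪g p, v⟫ * y p - lam ^ 2 / 2 * (‖v‖ ^ 2 * ‖y‖ ^ 2)))
      ∂Measure.pi (fun _ : ι => stdGaussian E) = 1 := by
  have h : ∀ g : ι → E,
      ENNReal.ofReal (Real.exp (lam * ∑ p, ⟪g p, v⟫ * y p - lam ^ 2 / 2 * (‖v‖ ^ 2 * ‖y‖ ^ 2))) =
      ∏ p, ENNReal.ofReal (Real.exp (⟪(lam * y p) • v, g p⟫ - ‖(lam * y p) • v‖ ^ 2 / 2)) := by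
    intro g
    rw [← ENNReal.ofReal_prod_of_nonneg (fun _ _ => (Real.exp_pos _).le), ← Real.exp_sum,
      EuclideanSpace.real_norm_sq_eq y, Finset.mul_sum, Finset.mul_sum, Finset.mul_sum,
      ← Finset.sum_sub_distrib]
    congr 2
    refine Finset.sum_congr rfl fun p _ => ?_
    rw [real_inner_smul_left, norm_smul, mul_pow, Real.norm_eq_abs, sq_abs, real_inner_comm]
    ring
  simp_rw [h]
  rw [lintegral_pi_prod (fun _ : ι => stdGaussian E)
    (fun p w => ENNReal.ofReal (Real.exp (⟪(lam * y p) • v, w⟫ - ‖(lam * y p) • v‖ ^ 2 / 2)))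
    (fun p => by fun_prop)]
  simp [lintegral_exp_inner_stdGaussian]

/-- Averaging over the two independent Gaussian directions leaves the bilinear form at its value in
the centre; each squared norm gains the dimension of its space. -/
theorem integral_bilinear_shift {V : Submodule ℝ (EuclideanSpace ℝ ι)} (g : ι → E) (lam a b : ℝ)
    (h : E) (k : V) :
    Integrable (fun p : E × V => lam * ∑ i, ⟪g i, a • (p.1 + h)⟫ * (b • (p.2 + k) : V).1 i
        - lam ^ 2 / 2 * (‖a • (p.1 + h)‖ ^ 2 * ‖b • (p.2 + k)‖ ^ 2))
      ((stdGaussian E).prod (stdGaussian V)) ∧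
    ∫ p : E × V, (lam * ∑ i, ⟪g i, a • (p.1 + h)⟫ * (b • (p.2 + k) : V).1 i
        - lam ^ 2 / 2 * (‖a • (p.1 + h)‖ ^ 2 * ‖b • (p.2 + k)‖ ^ 2))
        ∂(stdGaussian E).prod (stdGaussian V) =
      lam * ∑ i, ⟪g i, a • h⟫ * (b • k : V).1 i
        - lam ^ 2 / 2 * ((a ^ 2 * (Module.finrank ℝ E + ‖h‖ ^ 2)) *
          (b ^ 2 * (Module.finrank ℝ V + ‖k‖ ^ 2))) := by
  have i1 : ∀ i, Integrable (fun w : E => ⟪g i, a • (w + h)⟫) (stdGaussian E) := by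
    intro i
    simp_rw [smul_add, inner_add_right, real_inner_smul_right]
    exact ((integrable_inner_stdGaussian _).const_mul _).add (integrable_const _)
  have e1 : ∀ i, ∫ w : E, ⟪g i, a • (w + h)⟫ ∂stdGaussian E = ⟪g i, a • h⟫ := by
    intro i
    simp_rw [smul_add, inner_add_right, real_inner_smul_right]
    rw [integral_add ((integrable_inner_stdGaussian _).const_mul _) (integrable_const _),
      integral_const_mul, integral_inner_stdGaussian]
    simp
  let c : ι → V →L[ℝ] ℝ := fun i => (EuclideanSpace.proj i).comp V.subtypeL
  have i2' : ∀ i, Integrable (fun w : V => c i w) (stdGaussian V) := fun i =>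
    (c i).integrable_comp IsGaussian.integrable_id
  have e2' : ∀ i, ∫ w : V, c i w ∂stdGaussian V = 0 := fun i => integral_strongDual_stdGaussian _
  have hc : ∀ i (w : V), (b • (w + k) : V).1 i = b * c i w + (b • k : V).1 i := by
    intro i w
    simp [c]
  have i2 : ∀ i, Integrable (fun w : V => (b • (w + k) : V).1 i) (stdGaussian V) := by
    intro i
    simp_rw [hc]
    exact ((i2' i).const_mul b).add (integrable_const _)
  have e2 : ∀ i, ∫ w : V, (b • (w + k) : V).1 i ∂stdGaussian V = (b • k : V).1 i := by
    intro i
    simp_rw [hc]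
    rw [integral_add ((i2' i).const_mul b) (integrable_const _), integral_const_mul, e2']
    simp
  have i3 : Integrable (fun w : E => ‖a • (w + h)‖ ^ 2) (stdGaussian E) := by
    simp_rw [norm_smul, mul_pow]
    exact (integrable_norm_add_sq_stdGaussian h).const_mul _
  have e3 : ∫ w : E, ‖a • (w + h)‖ ^ 2 ∂stdGaussian E =
      a ^ 2 * (Module.finrank ℝ E + ‖h‖ ^ 2) := by
    simp_rw [norm_smul, mul_pow, Real.norm_eq_abs, sq_abs]
    rw [integral_const_mul, integral_norm_add_sq_stdGaussian]
  have i4 : Integrable (fun w : V => ‖b • (w + k)‖ ^ 2) (stdGaussian V) := by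
    simp_rw [norm_smul, mul_pow]
    exact (integrable_norm_add_sq_stdGaussian k).const_mul _
  have e4 : ∫ w : V, ‖b • (w + k)‖ ^ 2 ∂stdGaussian V =
      b ^ 2 * (Module.finrank ℝ V + ‖k‖ ^ 2) := by
    simp_rw [norm_smul, mul_pow, Real.norm_eq_abs, sq_abs]
    rw [integral_const_mul, integral_norm_add_sq_stdGaussian]
  have I1 : ∀ i ∈ Finset.univ, Integrable (fun p : E × V => ⟪g i, a • (p.1 + h)⟫ *
      (b • (p.2 + k) : V).1 i) ((stdGaussian E).prod (stdGaussian V)) :=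
    fun i _ => (i1 i).mul_prod (i2 i)
  have I2 : Integrable (fun p : E × V => ‖a • (p.1 + h)‖ ^ 2 * ‖b • (p.2 + k)‖ ^ 2)
      ((stdGaussian E).prod (stdGaussian V)) := i3.mul_prod i4
  have I3 : Integrable (fun p : E × V => lam * ∑ i, ⟪g i, a • (p.1 + h)⟫ *
      (b • (p.2 + k) : V).1 i) ((stdGaussian E).prod (stdGaussian V)) :=
    (integrable_finsetSum _ I1).const_mul lam
  refine ⟨I3.sub (I2.const_mul _), ?_⟩
  rw [integral_sub I3 (I2.const_mul _), integral_const_mul, integral_const_mul,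
    integral_finsetSum _ I1, integral_prod_mul (fun w : E => ‖a • (w + h)‖ ^ 2)
      (fun w : V => ‖b • (w + k)‖ ^ 2), e3, e4]
  congr 2
  refine Finset.sum_congr rfl fun i _ => ?_
  rw [integral_prod_mul (fun w : E => ⟪g i, a • (w + h)⟫)
      (fun w : V => (b • (w + k) : V).1 i), e1, e2]

/-- The coefficient in the bound for the norm of a Gaussian matrix. -/
def gaussianNormBound (D δ : ℝ) : ℝ := √(4 * D + 8 * Real.log (1 / δ))

theorem bilinear_le_of_unit {E : Type*} [NormedAddCommGroup E] [InnerProductSpace ℝ E]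
    {V : Submodule ℝ (EuclideanSpace ℝ ι)} (g : ι → E) {z : ℝ}
    (h : ∀ (v : E) (y : V), ‖v‖ = 1 → ‖y‖ = 1 → ∑ p, ⟪g p, v⟫ * y.1 p ≤ z) (v : E)
    (y : EuclideanSpace ℝ ι) (hy : y ∈ V) : ∑ p, ⟪g p, v⟫ * y p ≤ z * (‖v‖ * ‖y‖) := by
  by_cases hv0 : v = 0
  · simp [hv0]
  by_cases hy0 : y = 0
  · simp [hy0]
  have hv : 0 < ‖v‖ := norm_pos_iff.2 hv0
  have hy' : 0 < ‖y‖ := norm_pos_iff.2 hy0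
  have := h (‖v‖⁻¹ • v) (‖y‖⁻¹ • ⟨y, hy⟩) (norm_smul_inv_norm hv0)
    (by rw [norm_smul, norm_inv, norm_norm]; exact inv_mul_cancel₀ hy'.ne')
  have e : ∑ p, ⟪g p, ‖v‖⁻¹ • v⟫ * (‖y‖⁻¹ • (⟨y, hy⟩ : V) : V).1 p =
      (‖v‖ * ‖y‖)⁻¹ * ∑ p, ⟪g p, v⟫ * y p := by
    rw [Finset.mul_sum]
    refine Finset.sum_congr rfl fun p _ => ?_
    simp only [real_inner_smul_right, Submodule.coe_smul, PiLp.smul_apply, smul_eq_mul, mul_inv]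
    ring
  rw [e, inv_mul_le_iff₀ (by positivity)] at this
  linarith

/-- The mixture argument in both directions at once. Restricting y to a subspace V makes the bound
depend on dim V and not on the number of rows, which is what the noise estimate needs. -/
theorem measure_bilinear_le (V : Submodule ℝ (EuclideanSpace ℝ ι)) {D₁ D₂ δ : ℝ}
    (hD₁ : (Module.finrank ℝ E : ℝ) ≤ D₁) (hD₁' : 1 ≤ D₁)
    (hD₂ : (Module.finrank ℝ V : ℝ) ≤ D₂) (hD₂' : 1 ≤ D₂) (hδ : 0 < δ) (hδ1 : δ ≤ 1) :
    Measure.pi (fun _ : ι => stdGaussian E) {g | ¬ ∀ (v : E), ∀ y ∈ V,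
      ∑ p, ⟪g p, v⟫ * y p ≤ gaussianNormBound (D₁ + D₂) δ * (‖v‖ * ‖y‖)} ≤ ENNReal.ofReal δ := by
  set K : ℝ := (D₁ + D₂) / 2 + Real.log (1 / δ) with hK
  have hlog : 0 ≤ Real.log (1 / δ) := Real.log_nonneg (by rw [le_div_iff₀ hδ]; linarith)
  have hKpos : 0 < K := by positivity
  -- For unit v and y the argument gives lam · (form) ≤ K + 2 lam²; this lam minimises K / lam + 2
  -- lam.
  set lam : ℝ := √(K / 2) with hlam
  have hlampos : 0 < lam := Real.sqrt_pos.2 (by positivity)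
  have hlamsq : lam ^ 2 = K / 2 := Real.sq_sqrt (by positivity)
  -- The random directions have mean square norm at most 1, so centring them at unit vectors costs
  -- D₁/2 + D₂/2 in entropy and only doubles the mean square norms.
  set a : ℝ := (√D₁)⁻¹ with ha
  set b : ℝ := (√D₂)⁻¹ with hb
  have hs1 : 0 < √D₁ := Real.sqrt_pos.2 (by linarith)
  have hs2 : 0 < √D₂ := Real.sqrt_pos.2 (by linarith)
  have ha2 : a ^ 2 = D₁⁻¹ := by rw [ha, inv_pow, Real.sq_sqrt (by linarith)]
  have hb2 : b ^ 2 = D₂⁻¹ := by rw [hb, inv_pow, Real.sq_sqrt (by linarith)]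
  set f : (ι → E) → E → V → ℝ := fun g x y => lam * ∑ p, ⟪g p, a • x⟫ * (b • y : V).1 p
    - lam ^ 2 / 2 * (‖a • x‖ ^ 2 * ‖b • y‖ ^ 2) with hf
  have hcont : Continuous fun q : (ι → E) × (E × V) => f q.1 q.2.1 q.2.2 := by
    simp only [hf]
    fun_prop
  have hmix := measure_mixture_ge_le (Measure.pi (fun _ : ι => stdGaussian E))
    ((stdGaussian E).prod (stdGaussian V))
    (f := fun g q => ENNReal.ofReal (Real.exp (f g q.1 q.2)))
    (ENNReal.measurable_ofReal.comp (Real.measurable_exp.comp hcont.measurable))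
    (fun q => (lintegral_exp_bilinear (a • q.1) (b • q.2 : V).1 lam).le) hδ
  refine (measure_mono ?_).trans hmix
  intro g hg
  simp only [Set.mem_ofPred_eq] at hg ⊢
  by_contra hlt
  rw [not_le] at hlt
  refine hg (bilinear_le_of_unit g fun v y hv hy => ?_)
  have hgm : Continuous fun q : E × V => f g q.1 q.2 :=
    hcont.comp (f := fun q : E × V => (g, q)) (by fun_prop)
  rw [lintegral_prod _ (by fun_prop)] at hlt
  obtain ⟨hi, he⟩ := integral_bilinear_shift g lam a b (√D₁ • v) (√D₂ • y)
  have := integral_prod_shift_sub_lt (√D₁ • v) (√D₂ • y) (f := f g) hgm.measurable hi hlt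
  simp only [hf] at this
  rw [he] at this
  have e1 : a • √D₁ • v = v := by rw [smul_smul, ha, inv_mul_cancel₀ hs1.ne', one_smul]
  have e2 : b • √D₂ • y = y := by rw [smul_smul, hb, inv_mul_cancel₀ hs2.ne', one_smul]
  rw [e1, e2, norm_smul, norm_smul, hv, hy, ha2, hb2, Real.norm_of_nonneg hs1.le,
    Real.norm_of_nonneg hs2.le, mul_one, mul_one, Real.sq_sqrt (show 0 ≤ D₁ by linarith),
    Real.sq_sqrt (show 0 ≤ D₂ by linarith), hlamsq] at this
  have b1 : D₁⁻¹ * (Module.finrank ℝ E + D₁) ≤ 2 := by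
    rw [inv_mul_le_iff₀ (by linarith)]
    linarith
  have b2 : D₂⁻¹ * (Module.finrank ℝ V + D₂) ≤ 2 := by
    rw [inv_mul_le_iff₀ (by linarith)]
    linarith
  have b3 : (D₁⁻¹ * (Module.finrank ℝ E + D₁)) * (D₂⁻¹ * (Module.finrank ℝ V + D₂)) ≤ 2 * 2 :=
    mul_le_mul b1 b2 (by positivity) (by norm_num)
  have b4 := mul_le_mul_of_nonneg_left b3 (show 0 ≤ K / 2 / 2 by positivity)
  have h2K : lam * ∑ p, ⟪g p, v⟫ * y.1 p ≤ lam * (2 * (2 * lam)) := by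
    have : lam * (2 * (2 * lam)) = 2 * K := by
      rw [show lam * (2 * (2 * lam)) = 4 * lam ^ 2 by ring, hlamsq]
      ring
    linarith
  have := le_of_mul_le_mul_left h2K hlampos
  refine this.trans (le_of_eq ?_)
  rw [gaussianNormBound, show 4 * (D₁ + D₂) + 8 * Real.log (1 / δ) = 4 ^ 2 * (K / 2) by
    rw [hK]; ring, Real.sqrt_mul (by norm_num), Real.sqrt_sq (by norm_num)]
  ring

end Bilinear

/-! ### The smallest singular value of a Gaussian matrix with nonzero mean -/

/-- The difference G has derivative (1-x)(1-2x)/x: it increases up to 1/2, decreases to G(1) = 0,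
then increases again. So only G(1/3) = 10/9 - log 3 > 0 has to be checked numerically. -/
theorem sub_one_sub_sq_le_log {z : ℝ} (hz : 1 / 3 ≤ z) : (z - 1) - (z - 1) ^ 2 ≤ Real.log z := by
  have hpos : 0 < z := by linarith
  have hlog3 : Real.log 3 < 1.0987 := by
    have h := Real.abs_log_sub_add_sum_range_le (x := 1 / 4) (by norm_num [abs_of_pos]) 8
    have h2 := Real.log_two_lt_d9
    have e : Real.log (1 - 1 / 4) = Real.log 3 - 2 * Real.log 2 := by
      rw [show (1 - 1 / 4 : ℝ) = 3 / 2 ^ 2 by norm_num, Real.log_div (by norm_num) (by norm_num),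
        Real.log_pow]
      norm_num
    rw [e] at h
    have h3 := (abs_le.1 h).2
    norm_num [Finset.sum_range_succ] at h3
    linarith
  set G : ℝ → ℝ := fun z => Real.log z - ((z - 1) - (z - 1) ^ 2) with hG
  have hd : ∀ x : ℝ, 0 < x → HasDerivAt G ((1 - x) * (1 - 2 * x) / x) x := by
    intro x hx
    have h1 := (Real.hasDerivAt_log hx.ne').sub
      (((hasDerivAt_id' x).sub_const 1).sub (((hasDerivAt_id' x).sub_const 1).pow 2))
    refine h1.congr_deriv ?_
    field_simp
    norm_num
    ring
  suffices h : 0 ≤ G z by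
    simp only [hG] at h
    linarith
  have hcont : ∀ s : Set ℝ, (∀ x ∈ s, 0 < x) → ContinuousOn G s := fun s hs x hx =>
    (hd x (hs x hx)).continuousAt.continuousWithinAt
  rcases le_total z (1 / 2) with h1 | h1
  · have hmono : MonotoneOn G (Set.Icc (1 / 3) (1 / 2)) := by
      refine monotoneOn_of_deriv_nonneg (convex_Icc _ _)
        (hcont _ fun x hx => by linarith [hx.1]) ?_ ?_
      · intro x hx
        rw [interior_Icc] at hx
        exact (hd x (by linarith [hx.1])).differentiableAt.differentiableWithinAt
      · intro x hx
        rw [interior_Icc] at hx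
        rw [(hd x (by linarith [hx.1])).deriv]
        refine div_nonneg (mul_nonneg ?_ ?_) ?_ <;> linarith [hx.1, hx.2]
    have h3 : 0 ≤ G (1 / 3) := by
      simp only [hG]
      rw [one_div, Real.log_inv]
      norm_num at hlog3 ⊢
      linarith
    exact h3.trans (hmono ⟨le_rfl, by norm_num⟩ ⟨hz, h1⟩ hz)
  have hG1 : G 1 = 0 := by simp [hG]
  rcases le_total z 1 with h2 | h2
  · have hanti : AntitoneOn G (Set.Icc (1 / 2) 1) := by
      refine antitoneOn_of_deriv_nonpos (convex_Icc _ _)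
        (hcont _ fun x hx => by linarith [hx.1]) ?_ ?_
      · intro x hx
        rw [interior_Icc] at hx
        exact (hd x (by linarith [hx.1])).differentiableAt.differentiableWithinAt
      · intro x hx
        rw [interior_Icc] at hx
        rw [(hd x (by linarith [hx.1])).deriv]
        refine div_nonpos_of_nonpos_of_nonneg (mul_nonpos_of_nonneg_of_nonpos ?_ ?_) ?_ <;>
          linarith [hx.1, hx.2]
    rw [← hG1]
    exact hanti ⟨h1, h2⟩ ⟨by norm_num, le_rfl⟩ h2
  · have hmono : MonotoneOn G (Set.Ici 1) := by
      refine monotoneOn_of_deriv_nonneg (convex_Ici _)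
        (hcont _ fun x hx => lt_of_lt_of_le one_pos hx) ?_ ?_
      · intro x hx
        rw [interior_Ici] at hx
        exact (hd x (one_pos.trans hx)).differentiableAt.differentiableWithinAt
      · intro x hx
        rw [interior_Ici] at hx
        have hx' : (1 : ℝ) < x := hx
        rw [(hd x (by linarith)).deriv]
        refine div_nonneg (mul_nonneg_of_nonpos_of_nonpos ?_ ?_) ?_ <;> linarith
    rw [← hG1]
    exact hmono (Set.mem_Ici.2 le_rfl) h2 h2

section LowerTail

variable {E : Type*} [NormedAddCommGroup E] [InnerProductSpace ℝ E] [FiniteDimensional ℝ E]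
  [MeasurableSpace E] [BorelSpace E]

theorem exists_orthonormalBasis_adapted {E : Type*} [NormedAddCommGroup E]
    [InnerProductSpace ℝ E] [FiniteDimensional ℝ E] (hn : 1 ≤ Module.finrank ℝ E) (u : E) :
    ∃ (i₀ : Fin (Module.finrank ℝ E)) (b : OrthonormalBasis (Fin (Module.finrank ℝ E)) ℝ E),
      u = ‖u‖ • b i₀ := by
  let i₀ : Fin (Module.finrank ℝ E) := ⟨0, hn⟩
  by_cases hu : u = 0
  · exact ⟨i₀, stdOrthonormalBasis ℝ E, by simp [hu]⟩
  have horth : Orthonormal ℝ (({i₀} : Set (Fin (Module.finrank ℝ E))).domRestrict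
      fun _ => (‖u‖⁻¹ • u : E)) := by
    refine ⟨fun _ => norm_smul_inv_norm hu, fun i j hij => ?_⟩
    exact absurd (Subsingleton.elim i j) hij
  obtain ⟨b, hb⟩ := horth.exists_orthonormalBasis_extension_of_card_eq (by simp)
  refine ⟨i₀, b, ?_⟩
  rw [hb i₀ rfl, smul_smul, mul_inv_cancel₀ (norm_ne_zero_iff.2 hu), one_smul]

/-- In an orthonormal basis whose vector `b i₀` points along u the quadratic form is diagonal, and
the integral factors into one-dimensional Laplace transforms. -/
theorem lintegral_exp_quadratic_stdGaussian (hn : 1 ≤ Module.finrank ℝ E) (m u : E)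
    {lam κ D : ℝ} (hlam : 0 ≤ lam) (hD : D = 1 - 2 * κ) (hDpos : 0 < D) :
    ∫⁻ g, ENNReal.ofReal (Real.exp (-lam * ⟪u, m + g⟫ ^ 2 + κ * ‖m + g‖ ^ 2)) ∂stdGaussian E =
      ENNReal.ofReal (Real.exp (-(1 / 2 * Real.log (D + 2 * lam * ‖u‖ ^ 2)
        + (Module.finrank ℝ E - 1 : ℝ) / 2 * Real.log D - κ * ‖m‖ ^ 2 / D
        + lam * ⟪u, m⟫ ^ 2 / (D * (D + 2 * lam * ‖u‖ ^ 2))))) := by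
  obtain ⟨i₀, b, hb⟩ := exists_orthonormalBasis_adapted hn u
  set A : ℝ := lam * ‖u‖ ^ 2 with hA
  have hA0 : 0 ≤ A := by positivity
  set a : Fin (Module.finrank ℝ E) → ℝ := fun i => (if i = i₀ then A else 0) - κ with ha
  set c : Fin (Module.finrank ℝ E) → ℝ := fun i => ⟪b i, m⟫ with hc
  have hcsum : ∑ i, c i ^ 2 = ‖m‖ ^ 2 := b.sum_sq_inner_right m
  have hapos : ∀ i, 0 < 1 + 2 * a i := by
    intro i
    simp only [ha]
    split_ifs <;> linarith
  have hTm : Measurable fun x : Fin (Module.finrank ℝ E) → ℝ => ∑ i, x i • b i :=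
    Finset.measurable_sum _ (by fun_prop)
  have hcoord : ∀ (x : Fin (Module.finrank ℝ E) → ℝ) i, ⟪b i, m + ∑ j, x j • b j⟫ = c i + x i := by
    intro x i
    rw [inner_add_right, b.orthonormal.inner_right_fintype]
  have hu : ∀ w : E, ⟪u, w⟫ = ‖u‖ * ⟪b i₀, w⟫ := by
    intro w
    conv_lhs => rw [hb]
    rw [real_inner_smul_left]
  have hexp : ∀ x : Fin (Module.finrank ℝ E) → ℝ,
      ENNReal.ofReal (Real.exp (-lam * ⟪u, m + ∑ j, x j • b j⟫ ^ 2
        + κ * ‖m + ∑ j, x j • b j‖ ^ 2)) =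
      ∏ i, ENNReal.ofReal (Real.exp (-a i * (c i + x i) ^ 2)) := by
    intro x
    rw [← ENNReal.ofReal_prod_of_nonneg (fun _ _ => (Real.exp_pos _).le), ← Real.exp_sum,
      hu, hcoord, ← b.sum_sq_inner_right]
    simp_rw [hcoord]
    have e : ∀ i, -a i * (c i + x i) ^ 2 =
        (if i = i₀ then -A * (c i + x i) ^ 2 else 0) + κ * (c i + x i) ^ 2 := by
      intro i
      simp only [ha]
      split_ifs <;> ring
    simp_rw [e]
    rw [Finset.sum_add_distrib, Finset.sum_ite_eq' Finset.univ i₀, ← Finset.mul_sum]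
    simp only [Finset.mem_univ, if_true, hA]
    congr 2
    ring
  rw [stdGaussian_eq_map_pi_orthonormalBasis b, lintegral_map (by fun_prop) hTm]
  simp_rw [hexp]
  rw [lintegral_pi_prod (fun _ => gaussianReal 0 1)
    (fun i y => ENNReal.ofReal (Real.exp (-a i * (c i + y) ^ 2))) (fun i => by fun_prop)]
  simp_rw [fun i => lintegral_exp_neg_sq_gaussianReal (a i) (c i) (hapos i)]
  rw [← ENNReal.ofReal_prod_of_nonneg (fun _ _ => (Real.exp_pos _).le), ← Real.exp_sum]
  congr 2
  have e : ∀ i, -(1 / 2) * Real.log (1 + 2 * a i) - a i * c i ^ 2 / (1 + 2 * a i) =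
      (if i = i₀ then -(1 / 2) * Real.log (D + 2 * A) + 1 / 2 * Real.log D
        - A * c i ^ 2 / (D * (D + 2 * A)) else 0)
      + (-(1 / 2) * Real.log D + κ / D * c i ^ 2) := by
    intro i
    have h2 : 0 < D + 2 * A := by linarith
    simp only [ha]
    split_ifs with h
    · rw [show 1 + 2 * (A - κ) = D + 2 * A by rw [hD]; ring]
      have : -((A - κ) * c i ^ 2 / (D + 2 * A)) =
          -(A * c i ^ 2 / (D * (D + 2 * A))) + κ / D * c i ^ 2 := by
        field_simp
        rw [hD]
        ring
      linarith
    · rw [show 1 + 2 * (0 - κ) = D by rw [hD]; ring]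
      ring
  simp_rw [e]
  rw [Finset.sum_add_distrib, Finset.sum_ite_eq' Finset.univ i₀, Finset.sum_add_distrib,
    Finset.sum_const, ← Finset.mul_sum, hcsum, hu]
  simp only [Finset.mem_univ, if_true, Finset.card_univ, Fintype.card_fin,
    nsmul_eq_mul, mul_pow, hA, hc]
  ring_nf

/-- The constant c is the mean of ‖τw + u‖², so the linear term in ‖·‖² - c averages to zero and the
quadratic one to the variance. The form ∑ ⟪·, x s⟫² picks up the extra trace term τ² ∑ ‖x s‖². -/
theorem integral_shifted_quartic {κ' : Type*} [Fintype κ'] (u q : E) (hu : ‖u‖ = 1)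
    (x : κ' → E) (τ c₀ c₁' c₂' lam : ℝ) {c : ℝ} (hc : c = 1 + Module.finrank ℝ E * τ ^ 2) :
    Integrable (fun w : E => c₀ + ⟪τ • w + u, q⟫ - lam * ∑ s, ⟪τ • w + u, x s⟫ ^ 2
        + c₁' * (‖τ • w + u‖ ^ 2 - c) - c₂' * (‖τ • w + u‖ ^ 2 - c) ^ 2) (stdGaussian E) ∧
    ∫ w : E, (c₀ + ⟪τ • w + u, q⟫ - lam * ∑ s, ⟪τ • w + u, x s⟫ ^ 2
        + c₁' * (‖τ • w + u‖ ^ 2 - c) - c₂' * (‖τ • w + u‖ ^ 2 - c) ^ 2) ∂stdGaussian E =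
      c₀ + ⟪u, q⟫ - lam * (∑ s, ⟪u, x s⟫ ^ 2 + τ ^ 2 * ∑ s, ‖x s‖ ^ 2)
        - c₂' * (4 * τ ^ 2 + 2 * Module.finrank ℝ E * τ ^ 4) := by
  set n : ℝ := (Module.finrank ℝ E : ℝ) with hn
  have iI := fun v : E => integrable_inner_stdGaussian v
  have iS := fun v : E => integrable_inner_sq_stdGaussian v
  have iN := integrable_norm_pow_stdGaussian (E := E) 2
  have iN4 : Integrable (fun w : E => (‖w‖ ^ 2 - n) ^ 2) (stdGaussian E) := by
    refine integrable_of_polynomial_growth (by fun_prop) (2 + 2 * n ^ 2) fun w => ?_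
    rw [abs_of_nonneg (sq_nonneg _)]
    have : (‖w‖ ^ 2 - n) ^ 2 ≤ 2 * ‖w‖ ^ 4 + 2 * n ^ 2 := by nlinarith [sq_nonneg (‖w‖ ^ 2 + n)]
    have h4 : 0 ≤ ‖w‖ ^ 4 := by positivity
    nlinarith [mul_nonneg h4 (sq_nonneg n)]
  have iX : Integrable (fun w : E => ⟪u, w⟫ * (‖w‖ ^ 2 - n)) (stdGaussian E) := by
    refine Integrable.mono' ((iS u).add iN4) (by fun_prop) (Filter.Eventually.of_forall fun w => ?_)
    rw [Real.norm_eq_abs, abs_le]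
    simp only [Pi.add_apply]
    constructor <;> nlinarith [sq_nonneg (⟪u, w⟫ + (‖w‖ ^ 2 - n)), sq_nonneg (⟪u, w⟫ - (‖w‖ ^ 2 - n)),
      sq_nonneg ⟪u, w⟫, sq_nonneg (‖w‖ ^ 2 - n)]
  have e1 : ∀ w : E, ⟪τ • w + u, q⟫ = τ * ⟪q, w⟫ + ⟪u, q⟫ := by
    intro w
    rw [inner_add_left, real_inner_smul_left, real_inner_comm]
  have e2 : ∀ (w : E) s, ⟪τ • w + u, x s⟫ ^ 2 =
      τ ^ 2 * ⟪x s, w⟫ ^ 2 + 2 * τ * ⟪u, x s⟫ * ⟪x s, w⟫ + ⟪u, x s⟫ ^ 2 := by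
    intro w s
    rw [inner_add_left, real_inner_smul_left, real_inner_comm]
    ring
  have e3 : ∀ w : E, ‖τ • w + u‖ ^ 2 - c = τ ^ 2 * (‖w‖ ^ 2 - n) + 2 * τ * ⟪u, w⟫ := by
    intro w
    rw [norm_add_sq_real, norm_smul, mul_pow, Real.norm_eq_abs, sq_abs, real_inner_smul_left, hu,
      hc, real_inner_comm]
    ring
  have j1 : Integrable (fun w : E => ⟪τ • w + u, q⟫) (stdGaussian E) := by
    simp_rw [e1]
    exact ((iI q).const_mul τ).add (integrable_const _)
  have k1 : ∫ w : E, ⟪τ • w + u, q⟫ ∂stdGaussian E = ⟪u, q⟫ := by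
    simp_rw [e1]
    rw [integral_add ((iI q).const_mul τ) (integrable_const _), integral_const_mul,
      integral_inner_stdGaussian]
    simp
  have j2 : ∀ s, Integrable (fun w : E => ⟪τ • w + u, x s⟫ ^ 2) (stdGaussian E) := by
    intro s
    simp_rw [e2]
    exact (((iS _).const_mul _).add ((iI _).const_mul _)).add (integrable_const _)
  have k2 : ∀ s, ∫ w : E, ⟪τ • w + u, x s⟫ ^ 2 ∂stdGaussian E =
      ⟪u, x s⟫ ^ 2 + τ ^ 2 * ‖x s‖ ^ 2 := by
    intro s
    simp_rw [e2]
    have i12 : Integrable (fun w : E => τ ^ 2 * ⟪x s, w⟫ ^ 2 + 2 * τ * ⟪u, x s⟫ * ⟪x s, w⟫)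
        (stdGaussian E) := ((iS _).const_mul _).add ((iI _).const_mul _)
    rw [integral_add i12 (integrable_const _),
      integral_add ((iS _).const_mul _) ((iI _).const_mul _), integral_const_mul,
      integral_const_mul, integral_inner_stdGaussian, integral_inner_sq_stdGaussian]
    simp
    ring
  have iNn : Integrable (fun w : E => ‖w‖ ^ 2 - n) (stdGaussian E) := iN.sub (integrable_const _)
  have kNn : ∫ w : E, (‖w‖ ^ 2 - n) ∂stdGaussian E = 0 := by
    rw [integral_sub iN (integrable_const _), integral_norm_sq_stdGaussian]
    simp [hn]
  have j3 : Integrable (fun w : E => ‖τ • w + u‖ ^ 2 - c) (stdGaussian E) := by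
    simp_rw [e3]
    exact (iNn.const_mul _).add ((iI u).const_mul _)
  have k3 : ∫ w : E, (‖τ • w + u‖ ^ 2 - c) ∂stdGaussian E = 0 := by
    simp_rw [e3]
    rw [integral_add (iNn.const_mul _) ((iI u).const_mul _), integral_const_mul, integral_const_mul,
      kNn, integral_inner_stdGaussian]
    simp
  have e4 : ∀ w : E, (‖τ • w + u‖ ^ 2 - c) ^ 2 = τ ^ 4 * (‖w‖ ^ 2 - n) ^ 2
      + 4 * τ ^ 3 * (⟪u, w⟫ * (‖w‖ ^ 2 - n)) + 4 * τ ^ 2 * ⟪u, w⟫ ^ 2 := by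
    intro w
    rw [e3]
    ring
  have j4' : Integrable (fun w : E => τ ^ 4 * (‖w‖ ^ 2 - n) ^ 2
      + 4 * τ ^ 3 * (⟪u, w⟫ * (‖w‖ ^ 2 - n))) (stdGaussian E) :=
    (iN4.const_mul _).add (iX.const_mul _)
  have j4 : Integrable (fun w : E => (‖τ • w + u‖ ^ 2 - c) ^ 2) (stdGaussian E) := by
    simp_rw [e4]
    exact j4'.add ((iS u).const_mul _)
  have k4 : ∫ w : E, (‖τ • w + u‖ ^ 2 - c) ^ 2 ∂stdGaussian E = 4 * τ ^ 2 + 2 * n * τ ^ 4 := by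
    simp_rw [e4]
    rw [integral_add j4' ((iS u).const_mul _), integral_add (iN4.const_mul _) (iX.const_mul _),
      integral_const_mul, integral_const_mul, integral_const_mul,
      integral_norm_sq_sub_sq_stdGaussian, integral_inner_mul_norm_sq_sub_stdGaussian,
      integral_inner_sq_stdGaussian, hu, hn]
    ring
  have t1 : Integrable (fun w : E => c₀ + ⟪τ • w + u, q⟫) (stdGaussian E) :=
    (integrable_const _).add j1
  have t2' : Integrable (fun w : E => lam * ∑ s, ⟪τ • w + u, x s⟫ ^ 2) (stdGaussian E) :=
    (integrable_finsetSum _ fun s _ => j2 s).const_mul _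
  have t2 : Integrable (fun w : E => c₀ + ⟪τ • w + u, q⟫ - lam * ∑ s, ⟪τ • w + u, x s⟫ ^ 2)
      (stdGaussian E) := t1.sub t2'
  have t3 : Integrable (fun w : E => c₀ + ⟪τ • w + u, q⟫ - lam * ∑ s, ⟪τ • w + u, x s⟫ ^ 2
      + c₁' * (‖τ • w + u‖ ^ 2 - c)) (stdGaussian E) := t2.add (j3.const_mul _)
  refine ⟨t3.sub (j4.const_mul _), ?_⟩
  rw [integral_sub t3 (j4.const_mul _), integral_add t2 (j3.const_mul _), integral_sub t1 t2',
    integral_add (integrable_const _) j1, integral_const_mul, integral_const_mul,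
    integral_const_mul, integral_finsetSum _ fun s _ => j2 s, k1, k3, k4]
  simp_rw [k2]
  rw [Finset.sum_add_distrib, Finset.mul_sum]
  simp

end LowerTail

-- Numerical inequalities for the lower tail

/-- By concavity the logarithm lies above its chord between 5/3 and 2. -/
theorem log_five_thirds_add_ge {s : ℝ} (h0 : 0 ≤ s) (h1 : s ≤ 1 / 3) :
    0.5105 + 0.546 * s ≤ Real.log (5 / 3 + s) := by
  have h53 : (0.5105 : ℝ) ≤ Real.log (5 / 3) := by
    have h := Real.abs_log_sub_add_sum_range_le (x := 2 / 5) (by norm_num [abs_of_pos]) 9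
    rw [show (1 - 2 / 5 : ℝ) = (5 / 3)⁻¹ by norm_num, Real.log_inv] at h
    have h3 := (abs_le.1 h).2
    norm_num [Finset.sum_range_succ] at h3
    norm_num
    linarith
  have h2 := Real.log_two_gt_d9
  have hc := strictConcaveOn_log_Ioi.concaveOn.2
    (Set.mem_Ioi.2 (show (0 : ℝ) < 5 / 3 by norm_num)) (Set.mem_Ioi.2 (show (0 : ℝ) < 2 by norm_num))
    (show 0 ≤ 1 - 3 * s by linarith) (show 0 ≤ 3 * s by linarith) (by ring)
  simp only [smul_eq_mul] at hc
  rw [show (1 - 3 * s) * (5 / 3) + 3 * s * 2 = 5 / 3 + s by ring] at hc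
  have := mul_le_mul_of_nonneg_left h53 (show 0 ≤ 1 - 3 * s by linarith)
  have := mul_le_mul_of_nonneg_left h2.le (show 0 ≤ 3 * s by linarith)
  linarith

theorem lower_tail_rational {y : ℝ} (hy0 : 0 ≤ y) (hy1 : y ≤ 1 / 2) :
    max ((1 - 0.38 * y) / (16 + 50 * y)) 0.0245 ≤
      0.143 - 0.2 * y - (1 - 2 * y) / 3 * (0.227 + 0.2 * y) := by
  refine max_le ?_ ?_
  · rw [div_le_iff₀ (by positivity)]
    nlinarith [mul_nonneg hy0 (sub_nonneg.2 hy1), pow_nonneg hy0 3]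
  · nlinarith [sq_nonneg (y - 0.43)]

-- The budget of the lower tail argument with λ = 1/3. Per sample, ½ log S supplies at least 0.255 +
-- 0.273 s, where s = (N-1)p. This pays for log(1-p), for the means (0.008), for the quartic
-- correction (0.2 y with y = 1/(N+1)), for entropy and confidence, and for the remaining 1/24.
set_option maxHeartbeats 1000000 in
theorem lower_tail_numeric {N t r L Q p R : ℝ} (hN : 1 ≤ N)
    (ht₁ : 8 * N + 16 * (Real.log 2 + L) ≤ t) (ht₂ : 8 * N + 33 ≤ t) (ht₃ : 1024 * r ^ 2 * N ≤ t)
    (hQ : Q = max (2 * (N + 1)) (50 * r ^ 2)) (hp : p = 2 / (3 * Q)) (hR : R ≤ t * r ^ 2) :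
    t / 24 ≤ t / 2 * Real.log (5 / 3 + (N - 1) * p) + t * ((N - 1) / 2 * Real.log (1 - p))
      - p / 2 * R / (1 - p)
      - t / 2 * (2 / 3 / (5 / 3 + (N - 1) * p)) ^ 2 * (4 * Q⁻¹ + 2 * N * Q⁻¹ ^ 2) - Q / 2 - L := by
  have htpos : 0 < t := by linarith
  have hQ1 : 2 * (N + 1) ≤ Q := hQ ▸ le_max_left _ _
  have hQ2 : 50 * r ^ 2 ≤ Q := hQ ▸ le_max_right _ _
  have hQpos : 0 < Q := by linarith
  obtain ⟨y, hy⟩ : ∃ y, y = (N + 1)⁻¹ := ⟨_, rfl⟩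
  have hy0 : 0 < y := hy ▸ inv_pos.2 (by linarith)
  have hyN : y * (N + 1) = 1 := by rw [hy]; exact inv_mul_cancel₀ (by linarith)
  have hy1 : y ≤ 1 / 2 := by nlinarith
  have hQy : Q⁻¹ ≤ y / 2 := by
    rw [inv_le_iff_one_le_mul₀ hQpos]
    nlinarith
  have hQi : 0 < Q⁻¹ := inv_pos.2 hQpos
  have hpQ : p = 2 / 3 * Q⁻¹ := by rw [hp]; field_simp
  have hp0 : 0 < p := by rw [hpQ]; positivity
  have hpy : p ≤ y / 3 := by rw [hpQ]; linarith
  obtain ⟨s, hs⟩ : ∃ s, s = (N - 1) * p := ⟨_, rfl⟩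
  rw [← hs]
  have hs0 : 0 ≤ s := hs ▸ mul_nonneg (by linarith) hp0.le
  have hsy : s ≤ (1 - 2 * y) / 3 := by
    have := mul_le_mul_of_nonneg_left hpy (show 0 ≤ N - 1 by linarith)
    nlinarith
  have hD : 5 / 6 ≤ 1 - p := by linarith
  have hDinv : (1 - p)⁻¹ ≤ 1 + 0.4 * y := by
    rw [inv_le_iff_one_le_mul₀ (by linarith)]
    nlinarith
  have hDinv0 : 0 < (1 - p)⁻¹ := inv_pos.2 (by linarith)
  have b1 := log_five_thirds_add_ge hs0 (by linarith)
  have b2 : -(s / 2) * (1 + 0.4 * y) ≤ (N - 1) / 2 * Real.log (1 - p) := by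
    have h := Real.one_sub_inv_le_log_of_pos (show 0 < 1 - p by linarith)
    have h2 : 1 - (1 - p)⁻¹ = -p * (1 - p)⁻¹ := by
      field_simp
      ring
    rw [h2] at h
    have h3 := mul_le_mul_of_nonneg_left h (show 0 ≤ (N - 1) / 2 by linarith)
    have h4 := mul_le_mul_of_nonneg_left hDinv (show 0 ≤ s / 2 by linarith)
    nlinarith
  have b3 : p / 2 * R / (1 - p) ≤ t * 0.008 := by
    rw [div_le_iff₀ (by linarith)]
    have h1 := mul_le_mul_of_nonneg_left hR (show 0 ≤ p / 2 by linarith)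
    have h2 : p * r ^ 2 ≤ 2 / 150 := by
      rw [hpQ]
      have : Q⁻¹ * (50 * r ^ 2) ≤ 1 := by
        rw [inv_mul_le_iff₀ hQpos]
        linarith
      linarith
    have h3 := mul_le_mul_of_nonneg_left h2 htpos.le
    have h4 := mul_le_mul_of_nonneg_left hD (show 0 ≤ t * 0.008 by positivity)
    linarith
  have b4 : (2 / 3 / (5 / 3 + s)) ^ 2 * (4 * Q⁻¹ + 2 * N * Q⁻¹ ^ 2) ≤ 0.4 * y := by
    have h1 : (2 / 3 / (5 / 3 + s)) ^ 2 ≤ 0.16 := by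
      have : 2 / 3 / (5 / 3 + s) ≤ 2 / 5 := by
        rw [div_le_iff₀ (by linarith)]
        linarith
      have h0 : 0 ≤ 2 / 3 / (5 / 3 + s) := by positivity
      nlinarith
    have h2 : 4 * Q⁻¹ + 2 * N * Q⁻¹ ^ 2 ≤ 2.5 * y := by
      have h3 : Q⁻¹ ^ 2 ≤ (y / 2) ^ 2 := pow_le_pow_left₀ hQi.le hQy 2
      have h4 := mul_le_mul_of_nonneg_left h3 (show 0 ≤ 2 * N by linarith)
      have h5 : N * y ≤ 1 := by linarith
      nlinarith
    calc _ ≤ 0.16 * (2.5 * y) := mul_le_mul h1 h2 (by positivity) (by norm_num)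
      _ = 0.4 * y := by ring
  have hlog2 := Real.log_two_gt_d9
  -- One case for each branch of the maximum in Q. If Q = 2(N+1), the fraction is (N/2 + 0.31)/(8N +
  -- 33) in terms of y, where 0.31 exceeds 1 - log 2. If Q = 50r², then Q/2 = 25r² ≤ 25t/1024 <
  -- 0.0245 t.
  have b5 : Q / 2 + L ≤ t * (1 / 16 + max ((1 - 0.38 * y) / (16 + 50 * y)) 0.0245) := by
    rw [mul_add, mul_max_of_nonneg _ _ htpos.le]
    rcases le_total (50 * r ^ 2) (2 * (N + 1)) with h | h
    · have hQe : Q = 2 * (N + 1) := by rw [hQ, max_eq_left h]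
      have h1 : N / 2 + 0.31 ≤ t * ((1 - 0.38 * y) / (16 + 50 * y)) := by
        rw [mul_div_assoc', le_div_iff₀ (by positivity)]
        have h2 : (N / 2 + 0.31) * (16 + 50 * y) = (1 - 0.38 * y) * (8 * N + 33) := by
          linear_combination (28.04 : ℝ) * hyN
        rw [h2, mul_comm]
        exact mul_le_mul_of_nonneg_right ht₂ (by linarith)
      have := le_max_left (t * ((1 - 0.38 * y) / (16 + 50 * y))) (t * 0.0245)
      linarith
    · have hQe : Q = 50 * r ^ 2 := by rw [hQ, max_eq_right h]
      have h1 : 1024 * r ^ 2 ≤ t :=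
        (le_mul_of_one_le_right (by positivity) hN).trans ht₃
      have := le_max_right (t * ((1 - 0.38 * y) / (16 + 50 * y))) (t * 0.0245)
      linarith
  have b6 : max ((1 - 0.38 * y) / (16 + 50 * y)) 0.0245 ≤
      0.143 - 0.2 * y - (1 - 2 * y) / 3 * (0.227 + 0.2 * y) := lower_tail_rational hy0.le hy1
  have b7 : s * (0.227 + 0.2 * y) ≤ (1 - 2 * y) / 3 * (0.227 + 0.2 * y) :=
    mul_le_mul_of_nonneg_right hsy (by positivity)
  have c1 := mul_le_mul_of_nonneg_left b1 (show 0 ≤ t / 2 by linarith)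
  have c2 := mul_le_mul_of_nonneg_left b2 htpos.le
  have c4 := mul_le_mul_of_nonneg_left b4 (show 0 ≤ t / 2 by linarith)
  have c6 := mul_le_mul_of_nonneg_left b6 htpos.le
  have c7 := mul_le_mul_of_nonneg_left b7 htpos.le
  rw [← mul_assoc] at c4
  linarith

section LowerTail

variable {E : Type*} [NormedAddCommGroup E] [InnerProductSpace ℝ E]

/-- Minus the logarithm of `𝔼 exp (-lam ⟪u, m + g⟫² + κ ‖m + g‖²)` for a standard Gaussian `g` in
dimension `n`, where `D = 1 - 2 κ`. -/
def negLogLaplace (n lam κ D : ℝ) (m u : E) : ℝ :=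
  1 / 2 * Real.log (D + 2 * lam * ‖u‖ ^ 2) + (n - 1) / 2 * Real.log D - κ * ‖m‖ ^ 2 / D
    + lam * ⟪u, m⟫ ^ 2 / (D * (D + 2 * lam * ‖u‖ ^ 2))

/-- Replaces the logarithm and the quotient by polynomials in u, whose Gaussian averages are
explicit. With G = D + 2 lam ‖u‖², the logarithm is expanded around S, which is legitimate since G ≥
D ≥ S/3. The quotient is bounded by z²/G ≥ 2θz - θ²G for an arbitrary θ. -/
theorem le_negLogLaplace {n lam κ D S c : ℝ} (θ : ℝ) (m u : E) (hlam : 0 ≤ lam) (hD : 0 < D)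
    (hS : S = D + 2 * lam * c) (hS3 : S ≤ 3 * D) (hSpos : 0 < S) :
    1 / 2 * (Real.log S + 2 * lam / S * (‖u‖ ^ 2 - c) - (2 * lam / S * (‖u‖ ^ 2 - c)) ^ 2)
      + (n - 1) / 2 * Real.log D - κ * ‖m‖ ^ 2 / D
      + lam / D * (2 * θ * ⟪u, m⟫ - θ ^ 2 * (S + 2 * lam * (‖u‖ ^ 2 - c)))
      ≤ negLogLaplace n lam κ D m u := by
  set G : ℝ := D + 2 * lam * ‖u‖ ^ 2 with hG
  have hGD : D ≤ G := by
    have : 0 ≤ 2 * lam * ‖u‖ ^ 2 := by positivity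
    linarith
  have hGpos : 0 < G := hD.trans_le hGD
  have hGS : G = S + 2 * lam * (‖u‖ ^ 2 - c) := by rw [hG, hS]; ring
  have h1 : Real.log S + 2 * lam / S * (‖u‖ ^ 2 - c) - (2 * lam / S * (‖u‖ ^ 2 - c)) ^ 2 ≤
      Real.log G := by
    have hz := sub_one_sub_sq_le_log (z := G / S) (by rw [le_div_iff₀ hSpos]; linarith)
    rw [Real.log_div hGpos.ne' hSpos.ne'] at hz
    have : G / S - 1 = 2 * lam / S * (‖u‖ ^ 2 - c) := by
      rw [hGS]
      field_simp
      ring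
    rw [this] at hz
    linarith
  have h2 : lam / D * (2 * θ * ⟪u, m⟫ - θ ^ 2 * G) ≤ lam * ⟪u, m⟫ ^ 2 / (D * G) := by
    rw [mul_div_mul_comm]
    refine mul_le_mul_of_nonneg_left ?_ (by positivity)
    rw [le_div_iff₀ hGpos]
    nlinarith [sq_nonneg (⟪u, m⟫ - θ * G)]
  rw [← hGS]
  unfold negLogLaplace
  rw [← hG]
  linarith

variable [FiniteDimensional ℝ E] [MeasurableSpace E] [BorelSpace E]

theorem lintegral_exp_add_negLogLaplace (hn : 1 ≤ Module.finrank ℝ E) (m u : E)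
    {lam κ D : ℝ} (hlam : 0 ≤ lam) (hD : D = 1 - 2 * κ) (hDpos : 0 < D) :
    ∫⁻ g, ENNReal.ofReal (Real.exp (-lam * ⟪u, m + g⟫ ^ 2 + κ * ‖m + g‖ ^ 2
      + negLogLaplace (Module.finrank ℝ E) lam κ D m u)) ∂stdGaussian E = 1 := by
  simp_rw [Real.exp_add _ (negLogLaplace _ _ _ _ _ _), ENNReal.ofReal_mul (Real.exp_pos _).le]
  rw [lintegral_mul_const _ (by fun_prop),
    lintegral_exp_quadratic_stdGaussian hn m u hlam hD hDpos,
    ← ENNReal.ofReal_mul (Real.exp_pos _).le, ← Real.exp_add, negLogLaplace]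
  rw [← ENNReal.ofReal_one, ← Real.exp_zero]
  congr 2
  ring

-- The mixture argument for exp(-⅓ ∑ ⟪u, m + g⟫²), normalised by its Laplace transform. Randomising
-- the direction adds a multiple of ∑ ‖m + g‖² to the averaged form, a quantity with no direct bound
-- here; the term κ ‖m + g‖² built into the exponential cancels it exactly.
set_option maxHeartbeats 4000000 in
theorem measure_lower_tail {ι : Type*} [Fintype ι] (hn : 1 ≤ Module.finrank ℝ E) (m : ι → E)
    {r δ : ℝ} (hm : ∀ s, ‖m s‖ ≤ r) (hδ : 0 < δ)
    (ht₁ : 8 * (Module.finrank ℝ E : ℝ) + 16 * Real.log (2 / δ) ≤ Fintype.card ι)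
    (ht₂ : 8 * (Module.finrank ℝ E : ℝ) + 33 ≤ Fintype.card ι)
    (ht₃ : 1024 * r ^ 2 * Module.finrank ℝ E ≤ Fintype.card ι) :
    Measure.pi (fun _ : ι => stdGaussian E) {g | ¬ ∀ u : E,
      (Fintype.card ι : ℝ) / 8 * ‖u‖ ^ 2 + 1 / 2 * ∑ s, ⟪u, m s⟫ ^ 2 ≤ ∑ s, ⟪u, m s + g s⟫ ^ 2}
      ≤ ENNReal.ofReal δ := by
  obtain ⟨N, hN⟩ : ∃ N : ℝ, N = Module.finrank ℝ E := ⟨_, rfl⟩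
  obtain ⟨t, ht⟩ : ∃ t : ℝ, t = Fintype.card ι := ⟨_, rfl⟩
  obtain ⟨L, hL⟩ : ∃ L : ℝ, L = Real.log (1 / δ) := ⟨_, rfl⟩
  have hN1 : 1 ≤ N := by rw [hN]; exact_mod_cast hn
  -- Q is the inverse variance of the random direction, and Q/2 is the entropy paid. The first
  -- branch keeps the direction concentrated, the second makes the loss p r² from the means small.
  obtain ⟨Q, hQ⟩ : ∃ Q : ℝ, Q = max (2 * (N + 1)) (50 * r ^ 2) := ⟨_, rfl⟩
  have hQ1 : 2 * (N + 1) ≤ Q := hQ ▸ le_max_left _ _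
  have hQpos : 0 < Q := by linarith
  -- Chosen so that κ = p/2 equals τ²/3, the coefficient of the trace term to be cancelled.
  obtain ⟨p, hp⟩ : ∃ p : ℝ, p = 2 / (3 * Q) := ⟨_, rfl⟩
  have hpQ : p = 2 / 3 * Q⁻¹ := by rw [hp]; field_simp
  have hp0 : 0 < p := by rw [hp]; positivity
  have hpN : p * (3 * (N + 1)) ≤ 1 := by
    rw [hp, div_mul_eq_mul_div, div_le_one (by positivity)]
    linarith
  have hp6 : p ≤ 1 / 6 := by nlinarith
  obtain ⟨τ, hτ⟩ : ∃ τ : ℝ, τ = (√Q)⁻¹ := ⟨_, rfl⟩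
  have hsQ : 0 < √Q := Real.sqrt_pos.2 hQpos
  have hτ2 : τ ^ 2 = Q⁻¹ := by rw [hτ, inv_pow, Real.sq_sqrt hQpos.le]
  -- The mean square norm of the random direction centred at a unit vector; S below is the
  -- corresponding value of D + 2 lam ‖·‖².
  obtain ⟨c, hc⟩ : ∃ c : ℝ, c = 1 + N * τ ^ 2 := ⟨_, rfl⟩
  obtain ⟨S, hS⟩ : ∃ S : ℝ, S = 5 / 3 + (N - 1) * p := ⟨_, rfl⟩
  have hSD : S = (1 - p) + 2 * (1 / 3) * c := by
    rw [hS, hc, hτ2, hpQ]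
    ring
  have hS2 : S ≤ 2 := by rw [hS]; nlinarith
  have hS1 : 5 / 3 ≤ S := by rw [hS]; nlinarith
  set f : (ι → E) → E → ℝ := fun g w => ∑ s, (-(1 / 3) * ⟪τ • w, m s + g s⟫ ^ 2
    + p / 2 * ‖m s + g s‖ ^ 2 + negLogLaplace N (1 / 3) (p / 2) (1 - p) (m s) (τ • w)) with hf
  have hfm : Measurable fun q : (ι → E) × E => f q.1 q.2 := by
    simp only [hf, negLogLaplace]
    refine Finset.measurable_sum _ fun s _ => ?_
    fun_prop
  have hone : ∀ w, ∫⁻ g, ENNReal.ofReal (Real.exp (f g w)) ∂Measure.pi (fun _ : ι => stdGaussian E)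
      ≤ 1 := by
    intro w
    simp only [hf]
    simp_rw [Real.exp_sum, ENNReal.ofReal_prod_of_nonneg (fun _ _ => (Real.exp_pos _).le)]
    rw [lintegral_pi_prod (fun _ : ι => stdGaussian E) (fun s g => ENNReal.ofReal (Real.exp
      (-(1 / 3) * ⟪τ • w, m s + g⟫ ^ 2 + p / 2 * ‖m s + g‖ ^ 2
        + negLogLaplace N (1 / 3) (p / 2) (1 - p) (m s) (τ • w)))) (fun s => by fun_prop)]
    simp_rw [hN, lintegral_exp_add_negLogLaplace hn _ _ (show (0 : ℝ) ≤ 1 / 3 by norm_num)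
      (show 1 - p = 1 - 2 * (p / 2) by ring) (show 0 < 1 - p by linarith)]
    simp
  have hmix := measure_mixture_ge_le (Measure.pi (fun _ : ι => stdGaussian E)) (stdGaussian E)
    (f := fun g w => ENNReal.ofReal (Real.exp (f g w)))
    (ENNReal.measurable_ofReal.comp (Real.measurable_exp.comp hfm)) hone hδ
  refine (measure_mono ?_).trans hmix
  intro g hg
  simp only [Set.mem_ofPred_eq] at hg ⊢
  by_contra hlt
  rw [not_le] at hlt
  refine hg fun u => ?_
  suffices hunit : ∀ u : E, ‖u‖ = 1 →
      t / 8 + 1 / 2 * ∑ s, ⟪u, m s⟫ ^ 2 ≤ ∑ s, ⟪u, m s + g s⟫ ^ 2 by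
    by_cases hu : u = 0
    · simp [hu]
    have hu' : 0 < ‖u‖ := norm_pos_iff.2 hu
    have h := hunit (‖u‖⁻¹ • u) (norm_smul_inv_norm hu)
    simp only [real_inner_smul_left, mul_pow, ← Finset.mul_sum] at h
    have h2 := mul_le_mul_of_nonneg_left h (sq_nonneg ‖u‖)
    have hk : ‖u‖ ^ 2 * (‖u‖⁻¹) ^ 2 = 1 := by rw [← mul_pow, mul_inv_cancel₀ hu'.ne', one_pow]
    rw [← ht]
    calc t / 8 * ‖u‖ ^ 2 + 1 / 2 * ∑ s, ⟪u, m s⟫ ^ 2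
        = ‖u‖ ^ 2 * (t / 8 + 1 / 2 * ((‖u‖⁻¹) ^ 2 * ∑ s, ⟪u, m s⟫ ^ 2)) := by
          linear_combination (- (1 / 2) * ∑ s, ⟪u, m s⟫ ^ 2) * hk
      _ ≤ ‖u‖ ^ 2 * ((‖u‖⁻¹) ^ 2 * ∑ s, ⟪u, m s + g s⟫ ^ 2) := h2
      _ = ∑ s, ⟪u, m s + g s⟫ ^ 2 := by rw [← mul_assoc, hk, one_mul]
  clear u
  intro u hu
  -- The maximiser of 2θ⟪u, m s⟫ - θ²S, so that at the centre u nothing is lost in linearising the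
  -- quotient.
  set θ : ι → ℝ := fun s => ⟪u, m s⟫ / S with hθ
  set q : E := ∑ s, (2 * (1 / 3) * θ s / (1 - p)) • m s with hq
  set c₀ : ℝ := p / 2 * ∑ s, ‖m s + g s‖ ^ 2 + t * (1 / 2 * Real.log S)
    + t * ((N - 1) / 2 * Real.log (1 - p)) - p / 2 * (∑ s, ‖m s‖ ^ 2) / (1 - p)
    - 1 / 3 / (1 - p) * S * ∑ s, θ s ^ 2 with hc₀
  set c₁' : ℝ := t * (1 / 2 * (2 * (1 / 3) / S)) - 1 / 3 / (1 - p) * (2 * (1 / 3)) * ∑ s, θ s ^ 2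
    with hc₁
  set c₂' : ℝ := t / 2 * (2 / 3 / S) ^ 2 with hc₂
  set F : E → ℝ := fun v => c₀ + ⟪v, q⟫ - 1 / 3 * ∑ s, ⟪v, m s + g s⟫ ^ 2
        + c₁' * (‖v‖ ^ 2 - c) - c₂' * (‖v‖ ^ 2 - c) ^ 2 with hF
  have hFf : ∀ w, F (τ • w) ≤ f g w := by
    intro w
    have h1 : ∀ s, _ := fun s => le_negLogLaplace (n := N) (κ := p / 2) (θ s) (m s) (τ • w)
      (show (0 : ℝ) ≤ 1 / 3 by norm_num) (show 0 < 1 - p by linarith) hSD (by linarith)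
      (by linarith)
    have h2 := Finset.sum_le_sum fun s (_ : s ∈ Finset.univ) => h1 s
    have h3 : f g w = -(1 / 3) * ∑ s, ⟪τ • w, m s + g s⟫ ^ 2 + p / 2 * ∑ s, ‖m s + g s‖ ^ 2
        + ∑ s, negLogLaplace N (1 / 3) (p / 2) (1 - p) (m s) (τ • w) := by
      simp only [hf, Finset.sum_add_distrib, Finset.mul_sum]
    rw [h3]
    refine le_trans (le_of_eq ?_) (add_le_add_right h2 _)
    have h4 : ⟪τ • w, q⟫ = 1 / 3 / (1 - p) * ∑ s, 2 * θ s * ⟪τ • w, m s⟫ := by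
      rw [hq, inner_sum, Finset.mul_sum]
      refine Finset.sum_congr rfl fun s _ => ?_
      rw [real_inner_smul_right]
      ring
    simp only [hF, h4, Finset.sum_add_distrib, Finset.sum_sub_distrib, Finset.sum_const,
      Finset.card_univ, nsmul_eq_mul, ← Finset.mul_sum, ← Finset.sum_mul, ← Finset.sum_div, ← ht,
      hc₀, hc₁, hc₂]
    ring
  have hFlt : ∫⁻ w, ENNReal.ofReal (Real.exp (F (τ • w))) ∂stdGaussian E <
      ENNReal.ofReal (Real.exp L) := by
    rw [hL]
    exact (lintegral_mono fun w => ENNReal.ofReal_le_ofReal (Real.exp_le_exp.2 (hFf w))).trans_lt hlt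
  have hshift : ∀ w : E, F (τ • (w + √Q • u)) = F (τ • w + u) := by
    intro w
    rw [smul_add, smul_smul, hτ, inv_mul_cancel₀ hsQ.ne', one_smul]
  obtain ⟨hi, he⟩ := integral_shifted_quartic u q hu (fun s => m s + g s) τ c₀ c₁' c₂' (1 / 3)
    (hc.trans (by rw [hN]))
  have hFm : Measurable fun w : E => F (τ • w) := by
    simp only [hF]
    fun_prop
  have hmain := integral_shift_sub_lt (√Q • u) hFm (C := L) (by simp_rw [hshift]; exact hi) hFlt
  simp_rw [hshift] at hmain
  simp only [hF] at hmain
  rw [he, norm_smul, hu, mul_one, Real.norm_of_nonneg hsQ.le, Real.sq_sqrt hQpos.le] at hmain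
  have hlog2 : Real.log (2 / δ) = Real.log 2 + L := by
    rw [hL, div_eq_mul_one_div, Real.log_mul (by norm_num) (by positivity)]
  have hR : ∑ s, ‖m s‖ ^ 2 ≤ t * r ^ 2 := by
    calc ∑ s, ‖m s‖ ^ 2 ≤ ∑ _s : ι, r ^ 2 :=
          Finset.sum_le_sum fun s _ => pow_le_pow_left₀ (norm_nonneg _) (hm s) 2
      _ = t * r ^ 2 := by rw [Finset.sum_const, Finset.card_univ, nsmul_eq_mul, ht]
  rw [hlog2, ← hN, ← ht] at ht₁
  rw [← hN, ← ht] at ht₂ ht₃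
  have hnum := lower_tail_numeric hN1 ht₁ ht₂ ht₃ hQ hp hR
  rw [← hS] at hnum
  have hA0 : 0 ≤ ∑ s, ⟪u, m s⟫ ^ 2 := Finset.sum_nonneg fun _ _ => sq_nonneg _
  have hqθ : ⟪u, q⟫ - 1 / 3 / (1 - p) * S * ∑ s, θ s ^ 2 =
      1 / 3 * (((1 - p) * S)⁻¹ * ∑ s, ⟪u, m s⟫ ^ 2) := by
    have h1p : (1 - p) ≠ 0 := by linarith
    have hS0 : S ≠ 0 := by linarith
    rw [hq, inner_sum, Finset.mul_sum, Finset.mul_sum, Finset.mul_sum, ← Finset.sum_sub_distrib]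
    refine Finset.sum_congr rfl fun s _ => ?_
    rw [real_inner_smul_right, hθ]
    field_simp
    ring
  -- Since (1-p)S ≤ 2, half of the energy of the means survives.
  have hAge : 1 / 2 * ∑ s, ⟪u, m s⟫ ^ 2 ≤ ((1 - p) * S)⁻¹ * ∑ s, ⟪u, m s⟫ ^ 2 := by
    refine mul_le_mul_of_nonneg_right ?_ hA0
    rw [one_div]
    exact inv_anti₀ (by nlinarith) (by nlinarith)
  have hτ4 : τ ^ 4 = Q⁻¹ ^ 2 := by rw [← hτ2]; ring
  rw [← hN, hτ4, hτ2] at hmain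
  simp only [hc₀, hc₂] at hmain
  have hpq3 : p / 2 = 1 / 3 * Q⁻¹ := by rw [hpQ]; ring
  -- The trace terms cancel here. What is left is one third of the claim, with t/24 = (1/3)(t/8).
  have e1 : 1 / 3 * (Q⁻¹ * ∑ s, ‖m s + g s‖ ^ 2) = p / 2 * ∑ s, ‖m s + g s‖ ^ 2 := by
    rw [hpq3]
    ring
  linarith

end LowerTail

-- Joint law of finitely many samples

section JointLaw

open scoped MatrixOrder in
theorem multivariateGaussian_sq_smul_one {k : ℕ} (μ : EuclideanSpace ℝ (Fin k)) {σ : ℝ}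
    (hσ : 0 ≤ σ) :
    multivariateGaussian μ (σ ^ 2 • (1 : Matrix (Fin k) (Fin k) ℝ)) =
      (stdGaussian (EuclideanSpace ℝ (Fin k))).map fun g => μ + σ • g := by
  have h : CFC.sqrt (σ ^ 2 • (1 : Matrix (Fin k) (Fin k) ℝ)) = σ • 1 := by
    refine CFC.sqrt_unique ?_ ?_
    · rw [smul_mul_smul_comm, mul_one, sq]
    · exact smul_nonneg hσ zero_le_one
  rw [multivariateGaussian, h]
  simp

variable {Ω : Type*} [MeasurableSpace Ω] {P : Measure Ω} [IsProbabilityMeasure P] {m n l : ℕ}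
  {x : Fin m → ℕ → Ω → EuclideanSpace ℝ (Fin n)} {η : Fin m → ℕ → Ω → EuclideanSpace ℝ (Fin l)}
  {μ : Fin m → ℕ → EuclideanSpace ℝ (Fin n)} {σx ση μhat : ℝ}

/-- Finitely many of the data are jointly distributed as affine images of independent standard
Gaussian vectors. -/
theorem IsGaussianData.hasLaw (h : IsGaussianData P x η μ σx ση μhat) (hσx : 0 ≤ σx)
    (hση : 0 ≤ ση) {ι : Type*} [Fintype ι] (e : ι → Fin m × ℕ+) (he : Function.Injective e) :
    HasLaw (fun ω => ((fun p => x (e p).1 (e p).2 ω, fun p => η (e p).1 (e p).2 ω) :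
        (ι → EuclideanSpace ℝ (Fin n)) × (ι → EuclideanSpace ℝ (Fin l))))
      (((Measure.pi fun _ : ι => stdGaussian (EuclideanSpace ℝ (Fin n))).map
          fun g p => μ (e p).1 (e p).2 + σx • g p).prod
        ((Measure.pi fun _ : ι => stdGaussian (EuclideanSpace ℝ (Fin l))).map
          fun g p => ση • g p)) P := by
  have hx : ∀ p, AEMeasurable (x (e p).1 (e p).2) P := fun p =>
    (h.law_x _ _ (e p).2.pos).aemeasurable
  have hη : ∀ p, AEMeasurable (η (e p).1 (e p).2) P := fun p =>
    (h.law_noise _ _ (e p).2.pos).aemeasurable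
  have hlaw : HasLaw (fun ω p => (x (e p).1 (e p).2 ω, η (e p).1 (e p).2 ω))
      (Measure.pi fun p => (P.map (x (e p).1 (e p).2)).prod (P.map (η (e p).1 (e p).2))) P := by
    refine ⟨by fun_prop, ?_⟩
    rw [(h.indep.precomp he).map_fun_eq_pi_map (fun p => (hx p).prodMk (hη p))]
    congr 1
    funext p
    exact (h.indep_pair _ _ (e p).2.pos).map_prod_eq_prod_map_map (hx p) (hη p)
  have : ∀ p, IsProbabilityMeasure (P.map (x (e p).1 (e p).2)) := fun p =>
    Measure.isProbabilityMeasure_map (hx p)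
  have : ∀ p, IsProbabilityMeasure (P.map (η (e p).1 (e p).2)) := fun p =>
    Measure.isProbabilityMeasure_map (hη p)
  have h2 := (measurePreserving_arrowProdEquivProdArrow _ _ ι
    (fun p => P.map (x (e p).1 (e p).2)) (fun p => P.map (η (e p).1 (e p).2))).comp_hasLaw hlaw
  convert h2 using 2
  · rfl
  · rw [Measure.pi_map_pi (f := fun p g => μ (e p).1 (e p).2 + σx • g) (fun p => by fun_prop)]
    congr 1
    funext p
    rw [(h.law_x (e p).1 _ (e p).2.pos).map_eq, multivariateGaussian_sq_smul_one _ hσx]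
  · rw [Measure.pi_map_pi (f := fun _ g => ση • g) (fun p => by fun_prop)]
    congr 1
    funext p
    rw [(h.law_noise (e p).1 _ (e p).2.pos).map_eq, multivariateGaussian_sq_smul_one _ hση]
    simp

end JointLaw

-- Tail events for independent Gaussian families

section Events

variable {ι : Type*} [Fintype ι] {E F : Type*} [NormedAddCommGroup E] [InnerProductSpace ℝ E]
  [NormedAddCommGroup F] [InnerProductSpace ℝ F]

/-- Closedness supplies measurability of an event quantified over uncountably many directions, which
is needed to pass to the image measure. -/
theorem isClosed_lower_tail (m : ι → E) (a : ℝ) :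
    IsClosed {X : ι → E | ∀ u : E, a * ‖u‖ ^ 2 + 1 / 2 * ∑ s, ⟪u, m s⟫ ^ 2 ≤ ∑ s, ⟪u, X s⟫ ^ 2} := by
  simp only [Set.ofPred_forall]
  exact isClosed_iInter fun u => isClosed_le (by fun_prop) (by fun_prop)

theorem isClosed_upper_tail (a : ℝ) :
    IsClosed {X : ι → E | ∀ u : E, ∑ s, ⟪u, X s⟫ ^ 2 ≤ a ^ 2 * ‖u‖ ^ 2} := by
  simp only [Set.ofPred_forall]
  exact isClosed_iInter fun u => isClosed_le (by fun_prop) (by fun_prop)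

theorem isClosed_cross (a : ℝ) :
    IsClosed {q : (ι → E) × (ι → F) | ∀ (v : F) (u : E),
      ∑ s, ⟪q.2 s, v⟫ * ⟪q.1 s, u⟫ ≤ a * (‖v‖ * √(∑ s, ⟪q.1 s, u⟫ ^ 2))} := by
  simp only [Set.ofPred_forall]
  exact isClosed_iInter fun v => isClosed_iInter fun u => isClosed_le (by fun_prop) (by fun_prop)

variable [FiniteDimensional ℝ E] [MeasurableSpace E] [BorelSpace E]

theorem measure_map_lower_tail (hn : 1 ≤ Module.finrank ℝ E) (m : ι → E) {r σ δ : ℝ} (hσ : 0 < σ)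
    (hm : ∀ s, ‖m s‖ ≤ r) (hδ : 0 < δ)
    (ht₁ : 8 * (Module.finrank ℝ E : ℝ) + 16 * Real.log (2 / δ) ≤ Fintype.card ι)
    (ht₂ : 8 * (Module.finrank ℝ E : ℝ) + 33 ≤ Fintype.card ι)
    (ht₃ : 1024 * (r / σ) ^ 2 * Module.finrank ℝ E ≤ Fintype.card ι) :
    (Measure.pi (fun _ : ι => stdGaussian E)).map (fun g s => m s + σ • g s) {X | ¬ ∀ u : E,
      (Fintype.card ι : ℝ) * σ ^ 2 / 8 * ‖u‖ ^ 2 + 1 / 2 * ∑ s, ⟪u, m s⟫ ^ 2 ≤ ∑ s, ⟪u, X s⟫ ^ 2}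
      ≤ ENNReal.ofReal δ := by
  have hm' : ∀ s, ‖σ⁻¹ • m s‖ ≤ r / σ := fun s => by
    rw [norm_smul, Real.norm_of_nonneg (by positivity), inv_mul_eq_div]
    exact div_le_div_of_nonneg_right (hm s) hσ.le
  refine (Measure.map_apply (by fun_prop)
    (isClosed_lower_tail m ((Fintype.card ι : ℝ) * σ ^ 2 / 8)).measurableSet.compl).trans_le ?_
  refine le_trans (measure_mono ?_) (measure_lower_tail hn (fun s => σ⁻¹ • m s) hm' hδ ht₁ ht₂ ht₃)
  intro g hg h
  refine hg fun u => ?_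
  have h1 := mul_le_mul_of_nonneg_left (h u) (sq_nonneg σ)
  have e1 : ∑ s, ⟪u, m s⟫ ^ 2 = σ ^ 2 * ∑ s, ⟪u, σ⁻¹ • m s⟫ ^ 2 := by
    rw [Finset.mul_sum]
    refine Finset.sum_congr rfl fun s _ => ?_
    rw [real_inner_smul_right]
    field_simp
  have e2 : ∑ s, ⟪u, m s + σ • g s⟫ ^ 2 = σ ^ 2 * ∑ s, ⟪u, σ⁻¹ • m s + g s⟫ ^ 2 := by
    rw [Finset.mul_sum]
    refine Finset.sum_congr rfl fun s _ => ?_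
    rw [inner_add_right, inner_add_right, real_inner_smul_right, real_inner_smul_right]
    field_simp
  rw [e1, e2]
  linarith

/-- The triangle inequality in the space of samples: the means contribute √t r, the noise its
operator norm, obtained from the bilinear bound with V the whole space. -/
theorem measure_map_upper_tail (hn : 1 ≤ Module.finrank ℝ E) (hι : 1 ≤ Fintype.card ι)
    (m : ι → E) {r σ δ : ℝ} (hσ : 0 ≤ σ)
    (hm : ∀ s, ‖m s‖ ≤ r) (hδ : 0 < δ) (hδ1 : δ ≤ 1) :
    (Measure.pi (fun _ : ι => stdGaussian E)).map (fun g s => m s + σ • g s) {X | ¬ ∀ u : E,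
      ∑ s, ⟪u, X s⟫ ^ 2 ≤ (√(Fintype.card ι) * r
        + σ * gaussianNormBound (Module.finrank ℝ E + Fintype.card ι) δ) ^ 2 * ‖u‖ ^ 2}
      ≤ ENNReal.ofReal δ := by
  refine (Measure.map_apply (by fun_prop) (isClosed_upper_tail _).measurableSet.compl).trans_le ?_
  refine le_trans (measure_mono ?_) (measure_bilinear_le (E := E) (ι := ι) ⊤ le_rfl
    (by exact_mod_cast hn) (D₂ := Fintype.card ι) (by simp) (by exact_mod_cast hι) hδ hδ1)
  intro g hg h
  refine hg fun u => ?_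
  set z := gaussianNormBound (Module.finrank ℝ E + Fintype.card ι) δ
  have hz : 0 ≤ z := Real.sqrt_nonneg _
  obtain ⟨Y, hY⟩ : ∃ Y : EuclideanSpace ℝ ι, Y = WithLp.toLp 2 fun s => ⟪u, m s⟫ := ⟨_, rfl⟩
  obtain ⟨Z, hZ⟩ : ∃ Z : EuclideanSpace ℝ ι, Z = WithLp.toLp 2 fun s => ⟪g s, u⟫ := ⟨_, rfl⟩
  have hYn : ‖Y‖ ≤ √(Fintype.card ι) * r * ‖u‖ := by
    have hr : 0 ≤ r := by
      obtain ⟨s⟩ := Fintype.card_pos_iff.1 hι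
      exact (norm_nonneg _).trans (hm s)
    refine le_of_sq_le_sq ?_ (by positivity)
    rw [EuclideanSpace.real_norm_sq_eq, mul_pow, mul_pow, Real.sq_sqrt (by positivity)]
    calc ∑ s, Y s ^ 2 ≤ ∑ _s : ι, r ^ 2 * ‖u‖ ^ 2 := Finset.sum_le_sum fun s _ => by
          rw [hY, ← mul_pow]
          refine sq_le_sq.2 ?_
          rw [abs_of_nonneg (show 0 ≤ r * ‖u‖ by positivity), mul_comm]
          exact (abs_real_inner_le_norm _ _).trans
            (mul_le_mul_of_nonneg_left (hm s) (norm_nonneg _))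
      _ = _ := by rw [Finset.sum_const, Finset.card_univ, nsmul_eq_mul]; ring
  have hZn : ‖Z‖ ≤ z * ‖u‖ := by
    rcases (norm_nonneg Z).eq_or_lt with h0 | h0
    · rw [← h0]; positivity
    refine le_of_mul_le_mul_right ?_ h0
    have := h u Z trivial
    -- The bilinear bound is tested on Z itself.
    calc ‖Z‖ * ‖Z‖ = ∑ p, ⟪g p, u⟫ * Z p := by
          rw [← sq, EuclideanSpace.real_norm_sq_eq]
          refine Finset.sum_congr rfl fun s _ => ?_
          rw [hZ, sq]
      _ ≤ _ := by rw [mul_assoc]; exact this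
  have e : ∑ s, ⟪u, m s + σ • g s⟫ ^ 2 = ‖Y + σ • Z‖ ^ 2 := by
    rw [EuclideanSpace.real_norm_sq_eq]
    refine Finset.sum_congr rfl fun s _ => ?_
    rw [inner_add_right, real_inner_smul_right, hY, hZ, ← real_inner_comm u (g s)]
    simp
  rw [e, ← mul_pow]
  refine pow_le_pow_left₀ (norm_nonneg _) ((norm_add_le _ _).trans ?_) 2
  rw [norm_smul, Real.norm_of_nonneg hσ, add_mul, mul_assoc σ]
  exact add_le_add hYn (mul_le_mul_of_nonneg_left hZn hσ)

variable [FiniteDimensional ℝ F] [MeasurableSpace F] [BorelSpace F]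

/-- Sums of products of the features with independent centred Gaussian noise, uniformly over the
directions and relative to the second moment of the features. -/
theorem measure_cross_le (ν : Measure (ι → E)) [IsProbabilityMeasure ν]
    (hE : 1 ≤ Module.finrank ℝ E) (hF : 1 ≤ Module.finrank ℝ F) {σ δ : ℝ} (hσ : 0 ≤ σ)
    (hδ : 0 < δ) (hδ1 : δ ≤ 1) :
    ν.prod ((Measure.pi fun _ : ι => stdGaussian F).map fun g s => σ • g s)
      {q | ¬ ∀ (v : F) (u : E), ∑ s, ⟪q.2 s, v⟫ * ⟪q.1 s, u⟫ ≤
        σ * gaussianNormBound (Module.finrank ℝ F + Module.finrank ℝ E) δ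
          * (‖v‖ * √(∑ s, ⟪q.1 s, u⟫ ^ 2))} ≤ ENNReal.ofReal δ := by
  have hsm : Measurable fun (g : ι → F) s => σ • g s :=
    measurable_pi_lambda _ fun s => (measurable_pi_apply s).const_smul σ
  have : IsProbabilityMeasure
      ((Measure.pi fun _ : ι => stdGaussian F).map fun g s => σ • g s) :=
    Measure.isProbabilityMeasure_map hsm.aemeasurable
  set a := σ * gaussianNormBound (Module.finrank ℝ F + Module.finrank ℝ E) δ with ha
  have hmeas := (isClosed_cross (ι := ι) (E := E) (F := F) a).measurableSet.compl
  refine (Measure.prod_apply hmeas).trans_le ?_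
  refine (lintegral_mono (g := fun _ => ENNReal.ofReal δ) fun X => ?_).trans (by simp)
  refine (Measure.map_apply hsm (measurable_prodMk_left hmeas)).trans_le ?_
  -- With the features X frozen, the noise is only tested against the range of this map, of
  -- dimension at most dim E. The norm ‖A u‖ is the self-normalising factor.
  let A : E →ₗ[ℝ] EuclideanSpace ℝ ι :=
    { toFun := fun u => WithLp.toLp 2 fun s => ⟪X s, u⟫
      map_add' := fun u v => by ext s; simp [inner_add_right]
      map_smul' := fun c u => by ext s; simp [real_inner_smul_right] }
  refine le_trans (measure_mono ?_) (measure_bilinear_le (E := F) (LinearMap.range A) le_rfl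
    (by exact_mod_cast hF) (D₂ := Module.finrank ℝ E)
    (by exact_mod_cast LinearMap.finrank_range_le A) (by exact_mod_cast hE) hδ hδ1)
  intro g hg h
  refine hg fun v u => ?_
  have h1 := mul_le_mul_of_nonneg_left (h v (A u) ⟨u, rfl⟩) hσ
  have h2 : ‖A u‖ = √(∑ s, ⟪X s, u⟫ ^ 2) := by
    rw [EuclideanSpace.norm_eq]
    simp [A]
  rw [h2, ← mul_assoc, ← ha] at h1
  refine le_trans (le_of_eq ?_) h1
  rw [Finset.mul_sum]
  refine Finset.sum_congr rfl fun s _ => ?_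
  simp only [real_inner_smul_left, mul_assoc]
  rfl

end Events

-- The good event for the data

section DataEvents

variable {Ω : Type*} [MeasurableSpace Ω] {P : Measure Ω} [IsProbabilityMeasure P] {m n l : ℕ}
  {x : Fin m → ℕ → Ω → EuclideanSpace ℝ (Fin n)} {η : Fin m → ℕ → Ω → EuclideanSpace ℝ (Fin l)}
  {μ : Fin m → ℕ → EuclideanSpace ℝ (Fin n)} {σx ση μhat : ℝ}

/-- The samples `1, …, t` of agent `j` as an index family. -/
def agentIndex (j : Fin m) (t : ℕ) (s : Finset.Icc 1 t) : Fin m × ℕ+ :=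
  (j, ⟨s, (Finset.mem_Icc.1 s.2).1⟩)

theorem agentIndex_injective (j : Fin m) (t : ℕ) : Function.Injective (agentIndex j t) := by
  intro a b hab
  have h : (a : ℕ) = b := congrArg (fun p : Fin m × ℕ+ => (p.2 : ℕ)) hab
  exact Subtype.ext h

/-- The samples `1, …, t` of all the agents as an index family. -/
def networkIndex (m t : ℕ) (p : Fin m × Finset.Icc 1 t) : Fin m × ℕ+ := agentIndex p.1 t p.2

theorem networkIndex_injective (m t : ℕ) : Function.Injective (networkIndex m t) := by
  rintro ⟨i, a⟩ ⟨j, b⟩ hab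
  have h1 : i = j := congrArg Prod.fst hab
  subst h1
  exact congrArg (Prod.mk i) (agentIndex_injective i t hab)

theorem IsGaussianData.hasLaw_features (h : IsGaussianData P x η μ σx ση μhat) (hσx : 0 ≤ σx)
    (hση : 0 ≤ ση) (j : Fin m) (t : ℕ) :
    HasLaw (fun ω (s : Finset.Icc 1 t) => x j s ω)
      ((Measure.pi fun _ : Finset.Icc 1 t => stdGaussian (EuclideanSpace ℝ (Fin n))).map
          fun g s => μ j s + σx • g s) P := by
  have : IsProbabilityMeasure
      ((Measure.pi fun _ : Finset.Icc 1 t => stdGaussian (EuclideanSpace ℝ (Fin l))).map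
          fun g s => ση • g s) := by
    refine Measure.isProbabilityMeasure_map (Measurable.aemeasurable ?_)
    exact measurable_pi_lambda _ fun s => (measurable_pi_apply s).const_smul ση
  exact measurePreserving_fst.fun_comp_hasLaw (h.hasLaw hσx hση _ (agentIndex_injective j t))

theorem IsGaussianData.measure_lower (h : IsGaussianData P x η μ σx ση μhat) (hn : 1 ≤ n)
    (hσx : 0 < σx) (hση : 0 ≤ ση) (j : Fin m) {t : ℕ} {δ : ℝ} (hδ : 0 < δ)
    (ht₁ : 8 * (n : ℝ) + 16 * Real.log (2 / δ) ≤ t) (ht₂ : 8 * (n : ℝ) + 33 ≤ t)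
    (ht₃ : 1024 * (μhat / σx) ^ 2 * n ≤ t) :
    P {ω | ¬ ∀ u, t * σx ^ 2 / 8 * ‖u‖ ^ 2 + 1 / 2 * ∑ s ∈ Finset.Icc 1 t, ⟪u, μ j s⟫ ^ 2 ≤
      ∑ s ∈ Finset.Icc 1 t, ⟪u, x j s ω⟫ ^ 2} ≤ ENNReal.ofReal δ := by
  have key := measure_map_lower_tail (E := EuclideanSpace ℝ (Fin n)) (ι := Finset.Icc 1 t)
    (by simpa using hn) (fun s => μ j s) hσx
    (fun s => h.isLUB_mean.1 ⟨j, s, (Finset.mem_Icc.1 s.2).1, rfl⟩) hδ (by simpa using ht₁)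
    (by simpa using ht₂) (by simpa using ht₃)
  refine le_trans (le_of_eq ?_) (((h.hasLaw_features hσx.le hση j t).measure_eq
    (isClosed_lower_tail _ _).measurableSet.compl).trans_le key)
  simp only [Fintype.card_coe, Nat.card_Icc, add_tsub_cancel_right,
    ← Finset.sum_coe_sort (Finset.Icc 1 t)]
  rfl

theorem IsGaussianData.measure_upper (h : IsGaussianData P x η μ σx ση μhat) (hn : 1 ≤ n)
    (hσx : 0 ≤ σx) (hση : 0 ≤ ση) (hμ : 0 ≤ μhat) (j : Fin m) {t : ℕ} (ht : 1 ≤ t) {δ : ℝ}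
    (hδ : 0 < δ) (hδ1 : δ ≤ 1) (ht₁ : 8 * (n : ℝ) + 16 * Real.log (2 / δ) ≤ t) :
    P {ω | ¬ ∀ u, ∑ s ∈ Finset.Icc 1 t, ⟪u, x j s ω⟫ ^ 2 ≤
      t * (μhat + 11 / 5 * σx) ^ 2 * ‖u‖ ^ 2} ≤ ENNReal.ofReal δ := by
  have key := measure_map_upper_tail (E := EuclideanSpace ℝ (Fin n)) (ι := Finset.Icc 1 t)
    (by simpa using hn) (by simpa using ht) (fun s => μ j s) hσx
    (fun s => h.isLUB_mean.1 ⟨j, s, (Finset.mem_Icc.1 s.2).1, rfl⟩) hδ hδ1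
  refine le_trans (measure_mono ?_) (((h.hasLaw_features hσx hση j t).measure_eq
    (isClosed_upper_tail _).measurableSet.compl).trans_le key)
  intro ω hω hgood
  refine hω fun u => ?_
  have hu := hgood u
  rw [Finset.sum_coe_sort (Finset.Icc 1 t) (fun s => ⟪u, x j s ω⟫ ^ 2)] at hu
  refine hu.trans (mul_le_mul_of_nonneg_right ?_ (sq_nonneg _))
  simp only [Fintype.card_coe, Nat.card_Icc, add_tsub_cancel_right, finrank_euclideanSpace_fin]
  have hlog : Real.log (1 / δ) ≤ Real.log (2 / δ) :=
    Real.log_le_log (by positivity) (by gcongr; norm_num)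
  -- The first threshold gives 4n + 8 log(1/δ) ≤ t/2, so the square is at most 9t/2 < (11/5)² t.
  have hz : gaussianNormBound ((n : ℝ) + t) δ ≤ √t * (11 / 5) := by
    refine Real.sqrt_le_iff.2 ⟨by positivity, ?_⟩
    rw [mul_pow, Real.sq_sqrt (by positivity)]
    linarith [show (0 : ℝ) ≤ t by positivity]
  calc (√t * μhat + σx * gaussianNormBound ((n : ℝ) + t) δ) ^ 2
      ≤ (√t * μhat + σx * (√t * (11 / 5))) ^ 2 := by
        have : 0 ≤ gaussianNormBound ((n : ℝ) + t) δ := Real.sqrt_nonneg _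
        gcongr
    _ = √t ^ 2 * (μhat + 11 / 5 * σx) ^ 2 := by ring
    _ = _ := by rw [Real.sq_sqrt (by positivity)]

theorem IsGaussianData.measure_cross {ι : Type*} [Fintype ι]
    (h : IsGaussianData P x η μ σx ση μhat) (hn : 1 ≤ n) (hl : 1 ≤ l)
    (hσx : 0 ≤ σx) (hση : 0 ≤ ση) (e : ι → Fin m × ℕ+) (he : Function.Injective e) {δ : ℝ}
    (hδ : 0 < δ) (hδ1 : δ ≤ 1) :
    P {ω | ¬ ∀ v u, ∑ p, ⟪η (e p).1 (e p).2 ω, v⟫ * ⟪x (e p).1 (e p).2 ω, u⟫ ≤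
      ση * gaussianNormBound (l + n) δ * (‖v‖ * √(∑ p, ⟪x (e p).1 (e p).2 ω, u⟫ ^ 2))}
      ≤ ENNReal.ofReal δ := by
  have : IsProbabilityMeasure
      ((Measure.pi fun _ : ι => stdGaussian (EuclideanSpace ℝ (Fin n))).map
          fun g p => μ (e p).1 (e p).2 + σx • g p) :=
    Measure.isProbabilityMeasure_map (Measurable.aemeasurable (measurable_pi_lambda _ fun p =>
      ((measurable_pi_apply p).const_smul σx).const_add _))
  have key := measure_cross_le ((Measure.pi fun _ : ι => stdGaussian (EuclideanSpace ℝ (Fin n))).map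
    fun g p => μ (e p).1 (e p).2 + σx • g p) (F := EuclideanSpace ℝ (Fin l))
    (by simpa using hn) (by simpa using hl) hση hδ hδ1
  simp only [finrank_euclideanSpace_fin] at key
  exact ((h.hasLaw hσx hση e he).measure_eq
    (isClosed_cross (ση * gaussianNormBound (l + n) δ)).measurableSet.compl).trans_le key

/-- The event on which the empirical second moments and the noise terms are controlled. -/
structure IsGoodSample (x : Fin m → ℕ → EuclideanSpace ℝ (Fin n))
    (η : Fin m → ℕ → EuclideanSpace ℝ (Fin l)) (μ : Fin m → ℕ → EuclideanSpace ℝ (Fin n))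
    (σx ση μhat δhat δ : ℝ) (t : ℕ) : Prop where
  lower : ∀ j u, t * σx ^ 2 / 8 * ‖u‖ ^ 2 + 1 / 2 * ∑ s ∈ Finset.Icc 1 t, ⟪u, μ j s⟫ ^ 2 ≤
    ∑ s ∈ Finset.Icc 1 t, ⟪u, x j s⟫ ^ 2
  upper : ∀ j u, ∑ s ∈ Finset.Icc 1 t, ⟪u, x j s⟫ ^ 2 ≤
    t * (μhat + 11 / 5 * σx) ^ 2 * ‖u‖ ^ 2
  cross : ∀ j v u, ∑ s ∈ Finset.Icc 1 t, ⟪v, η j s⟫ * ⟪u, x j s⟫ ≤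
    ση * gaussianNormBound (l + n) δhat * (‖v‖ * √(∑ s ∈ Finset.Icc 1 t, ⟪u, x j s⟫ ^ 2))
  cross_sum : ∀ v u, ∑ j, ∑ s ∈ Finset.Icc 1 t, ⟪v, η j s⟫ * ⟪u, x j s⟫ ≤
    ση * gaussianNormBound (l + n) δ * (‖v‖ * √(∑ j, ∑ s ∈ Finset.Icc 1 t, ⟪u, x j s⟫ ^ 2))

/-- Union bound over three events for each agent and one cross event for the whole network. -/
theorem IsGaussianData.measure_not_isGoodSample (h : IsGaussianData P x η μ σx ση μhat)
    (hn : 1 ≤ n) (hl : 1 ≤ l) (hσx : 0 < σx) (hση : 0 ≤ ση) (hμ : 0 ≤ μhat) {t : ℕ} (ht : 1 ≤ t)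
    {δhat δ : ℝ} (hδhat : 0 < δhat) (hδhat1 : δhat ≤ 1) (hδ : 0 < δ) (hδ1 : δ ≤ 1)
    (ht₁ : 8 * (n : ℝ) + 16 * Real.log (2 / δhat) ≤ t) (ht₂ : 8 * (n : ℝ) + 33 ≤ t)
    (ht₃ : 1024 * (μhat / σx) ^ 2 * n ≤ t) :
    P {ω | ¬ IsGoodSample (fun j s => x j s ω) (fun j s => η j s ω) μ σx ση μhat δhat δ t} ≤
      ENNReal.ofReal (3 * m * δhat + δ) := by
  set A : Fin m → Set Ω := fun j => {ω | ¬ ∀ u, t * σx ^ 2 / 8 * ‖u‖ ^ 2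
    + 1 / 2 * ∑ s ∈ Finset.Icc 1 t, ⟪u, μ j s⟫ ^ 2 ≤ ∑ s ∈ Finset.Icc 1 t, ⟪u, x j s ω⟫ ^ 2}
    with hA
  set B : Fin m → Set Ω := fun j => {ω | ¬ ∀ u, ∑ s ∈ Finset.Icc 1 t, ⟪u, x j s ω⟫ ^ 2 ≤
    t * (μhat + 11 / 5 * σx) ^ 2 * ‖u‖ ^ 2} with hB
  set C : Fin m → Set Ω := fun j => {ω | ¬ ∀ v u, ∑ s ∈ Finset.Icc 1 t, ⟪v, η j s ω⟫ * ⟪u, x j s ω⟫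
    ≤ ση * gaussianNormBound (l + n) δhat
      * (‖v‖ * √(∑ s ∈ Finset.Icc 1 t, ⟪u, x j s ω⟫ ^ 2))} with hC
  set D : Set Ω := {ω | ¬ ∀ v u, ∑ j, ∑ s ∈ Finset.Icc 1 t, ⟪v, η j s ω⟫ * ⟪u, x j s ω⟫ ≤
    ση * gaussianNormBound (l + n) δ
      * (‖v‖ * √(∑ j, ∑ s ∈ Finset.Icc 1 t, ⟪u, x j s ω⟫ ^ 2))} with hD
  have hPA : ∀ j, P (A j) ≤ ENNReal.ofReal δhat := fun j =>
    h.measure_lower hn hσx hση j hδhat ht₁ ht₂ ht₃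
  have hPB : ∀ j, P (B j) ≤ ENNReal.ofReal δhat := fun j =>
    h.measure_upper hn hσx.le hση hμ j ht hδhat hδhat1 ht₁
  have hPC : ∀ j, P (C j) ≤ ENNReal.ofReal δhat := fun j => by
    refine le_trans (measure_mono ?_)
      (h.measure_cross hn hl hσx.le hση _ (agentIndex_injective j t) hδhat hδhat1)
    intro ω hω hgood
    refine hω fun v u => ?_
    have := hgood v u
    simp only [agentIndex, PNat.mk_coe, real_inner_comm v, real_inner_comm u] at this
    rwa [Finset.sum_coe_sort (Finset.Icc 1 t) (fun s => ⟪v, η j s ω⟫ * ⟪u, x j s ω⟫),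
      Finset.sum_coe_sort (Finset.Icc 1 t) (fun s => ⟪u, x j s ω⟫ ^ 2)] at this
  have hPD : P D ≤ ENNReal.ofReal δ := by
    refine le_trans (measure_mono ?_)
      (h.measure_cross hn hl hσx.le hση _ (networkIndex_injective m t) hδ hδ1)
    intro ω hω hgood
    refine hω fun v u => ?_
    have := hgood v u
    simp only [networkIndex, agentIndex, PNat.mk_coe, real_inner_comm v, real_inner_comm u,
      Fintype.sum_prod_type] at this
    simpa only [← Finset.sum_coe_sort (Finset.Icc 1 t)] using this
  have hsub : {ω | ¬ IsGoodSample (fun j s => x j s ω) (fun j s => η j s ω) μ σx ση μhat δhat δ t} ⊆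
      (⋃ j, (A j ∪ (B j ∪ C j))) ∪ D := by
    intro ω hω
    by_contra hcon
    simp only [Set.mem_union, Set.mem_iUnion, not_or, not_exists, hA, hB, hC, hD, Set.mem_ofPred_eq,
      not_not] at hcon
    exact hω ⟨fun j => (hcon.1 j).1, fun j => (hcon.1 j).2.1, fun j => (hcon.1 j).2.2, hcon.2⟩
  have h3 : ∀ j, P (A j ∪ (B j ∪ C j)) ≤ ENNReal.ofReal (3 * δhat) := fun j => by
    calc P (A j ∪ (B j ∪ C j)) ≤ P (A j) + (P (B j) + P (C j)) :=
          (measure_union_le _ _).trans (add_le_add_right (measure_union_le _ _) _)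
      _ ≤ ENNReal.ofReal δhat + (ENNReal.ofReal δhat + ENNReal.ofReal δhat) :=
          add_le_add (hPA j) (add_le_add (hPB j) (hPC j))
      _ = ENNReal.ofReal (3 * δhat) := by
          rw [← ENNReal.ofReal_add hδhat.le hδhat.le, ← ENNReal.ofReal_add hδhat.le (by positivity)]
          congr 1
          ring
  calc P {ω | ¬ IsGoodSample (fun j s => x j s ω) (fun j s => η j s ω) μ σx ση μhat δhat δ t}
      ≤ P (⋃ j, (A j ∪ (B j ∪ C j))) + P D := (measure_mono hsub).trans (measure_union_le _ _)
    _ ≤ ∑ j : Fin m, ENNReal.ofReal (3 * δhat) + ENNReal.ofReal δ :=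
        add_le_add ((measure_iUnion_fintype_le _ _).trans (Finset.sum_le_sum fun j _ => h3 j)) hPD
    _ = ENNReal.ofReal (3 * m * δhat + δ) := by
        rw [Finset.sum_const, Finset.card_univ, Fintype.card_fin, nsmul_eq_mul,
          ← ENNReal.ofReal_natCast, ← ENNReal.ofReal_mul (by positivity),
          ← ENNReal.ofReal_add (by positivity) hδ.le]
        congr 1
        ring

end DataEvents

-- Deterministic comparison of weighted and uniform averages

section Deterministic

variable {E F κ : Type*} [NormedAddCommGroup E] [InnerProductSpace ℝ E]
  [NormedAddCommGroup F] [InnerProductSpace ℝ F]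

/-- The bilinear form `∑ ⟪v, η s⟫ ⟪u, x s⟫` of two families of vectors. -/
def crossForm (S : Finset κ) (η : κ → F) (x : κ → E) (v : F) (u : E) : ℝ :=
  ∑ s ∈ S, ⟪v, η s⟫ * ⟪u, x s⟫

theorem crossForm_self (S : Finset κ) (x : κ → E) (u : E) :
    crossForm S x x u u = ∑ s ∈ S, ⟪u, x s⟫ ^ 2 :=
  Finset.sum_congr rfl fun _ _ => (sq _).symm

theorem crossForm_self_nonneg (S : Finset κ) (x : κ → E) (u : E) : 0 ≤ crossForm S x x u u := by
  rw [crossForm_self]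
  exact Finset.sum_nonneg fun _ _ => sq_nonneg _

theorem crossForm_sub_left (S : Finset κ) (η : κ → F) (x : κ → E) (v w : F) (u : E) :
    crossForm S η x (v - w) u = crossForm S η x v u - crossForm S η x w u := by
  simp only [crossForm, inner_sub_left, sub_mul, Finset.sum_sub_distrib]

theorem crossForm_sub_right (S : Finset κ) (η : κ → F) (x : κ → E) (v : F) (u w : E) :
    crossForm S η x v (u - w) = crossForm S η x v u - crossForm S η x v w := by
  simp only [crossForm, inner_sub_left, mul_sub, Finset.sum_sub_distrib]

theorem crossForm_neg_left (S : Finset κ) (η : κ → F) (x : κ → E) (v : F) (u : E) :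
    crossForm S η x (-v) u = -crossForm S η x v u := by
  simp only [crossForm, inner_neg_left, neg_mul, Finset.sum_neg_distrib]

theorem abs_crossForm_le {S : Finset κ} {x : κ → E} {K : ℝ}
    (h : ∀ u, crossForm S x x u u ≤ K ^ 2 * ‖u‖ ^ 2) (v u : E) :
    |crossForm S x x v u| ≤ K ^ 2 * (‖v‖ * ‖u‖) := by
  refine abs_le_of_sq_le_sq ?_ (by positivity)
  have h1 := Finset.sum_mul_sq_le_sq_mul_sq S (fun s => ⟪v, x s⟫) (fun s => ⟪u, x s⟫)
  rw [← crossForm_self, ← crossForm_self] at h1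
  refine h1.trans ((mul_le_mul (h v) (h u) (crossForm_self_nonneg _ _ _) (by positivity)).trans
    (le_of_eq (by ring)))

theorem norm_le_of_sq_le_inner {a : ℝ} (ha : 0 < a) {u w : E} (h : a * ‖u‖ ^ 2 ≤ ⟪w, u⟫) :
    ‖u‖ ≤ ‖w‖ / a := by
  rw [le_div_iff₀ ha]
  rcases (norm_nonneg u).eq_or_lt with h0 | h0
  · rw [← h0, zero_mul]
    exact norm_nonneg _
  · refine le_of_mul_le_mul_right ?_ h0
    linarith [real_inner_le_norm w u]

/-- A convex combination of the local cross forms at a solution `u` of the corresponding normal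
equations, compared with the uniform average at the solution `u₀` of the averaged equations. -/
theorem sum_mul_crossForm_le {m : ℕ} (hm : 1 ≤ m) {S : Finset κ} {x : Fin m → κ → E}
    {η : Fin m → κ → F} {a K c c' L ε : ℝ} (ha : 0 < a) (hK : 0 ≤ K) (hL : 0 < L) (hc : 0 ≤ c)
    (hc' : 0 ≤ c')
    (hlower : ∀ j u, a * ‖u‖ ^ 2 ≤ crossForm S (x j) (x j) u u)
    (havg : ∀ u, a * L * ‖u‖ ^ 2 ≤ (m : ℝ)⁻¹ * ∑ j, crossForm S (x j) (x j) u u)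
    (hupper : ∀ j u, crossForm S (x j) (x j) u u ≤ K ^ 2 * ‖u‖ ^ 2)
    (hcross : ∀ j v u, crossForm S (η j) (x j) v u ≤
      c * (‖v‖ * √(crossForm S (x j) (x j) u u)))
    (hsum : ∀ v u, ∑ j, crossForm S (η j) (x j) v u ≤
      c' * (‖v‖ * √(∑ j, crossForm S (x j) (x j) u u)))
    {p : Fin m → ℝ} (hp : ∀ j, 0 ≤ p j) (hp1 : ∑ j, p j = 1) (hε : ∑ j, |p j - (m : ℝ)⁻¹| ≤ ε)
    {u u₀ w : E} (hu : ∀ y, ∑ j, p j * crossForm S (x j) (x j) u y = ⟪w, y⟫)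
    (hu₀ : ∀ y, (m : ℝ)⁻¹ * ∑ j, crossForm S (x j) (x j) u₀ y = ⟪w, y⟫) (v : F) :
    ∑ j, p j * crossForm S (η j) (x j) v u ≤
      (c' / √(m * a * L) + ε * (c * K ^ 2 / (a * √a) + c * K / a)) * (‖v‖ * ‖w‖) := by
  have hm0 : (0 : ℝ) < m := by exact_mod_cast hm
  have hε0 : 0 ≤ ε := (Finset.sum_nonneg fun _ _ => abs_nonneg _).trans hε
  have hsa : 0 < √a := Real.sqrt_pos.2 ha
  have hu_norm : ‖u‖ ≤ ‖w‖ / a := by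
    refine norm_le_of_sq_le_inner ha ?_
    rw [← hu u]
    calc a * ‖u‖ ^ 2 = ∑ j, p j * (a * ‖u‖ ^ 2) := by rw [← Finset.sum_mul, hp1, one_mul]
      _ ≤ _ := Finset.sum_le_sum fun j _ => mul_le_mul_of_nonneg_left (hlower j u) (hp j)
  have hu₀_norm : ‖u₀‖ ≤ ‖w‖ / (a * L) :=
    norm_le_of_sq_le_inner (by positivity) (by rw [← hu₀ u₀]; exact havg u₀)
  have hq₀ : ∑ j, crossForm S (x j) (x j) u₀ u₀ ≤ m * (‖w‖ ^ 2 / (a * L)) := by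
    rw [← inv_mul_le_iff₀ hm0, hu₀]
    calc ⟪w, u₀⟫ ≤ ‖w‖ * ‖u₀‖ := real_inner_le_norm _ _
      _ ≤ ‖w‖ * (‖w‖ / (a * L)) := mul_le_mul_of_nonneg_left hu₀_norm (norm_nonneg _)
      _ = _ := by ring
  have hT1 : (m : ℝ)⁻¹ * ∑ j, crossForm S (η j) (x j) v u₀ ≤
      c' / √(m * a * L) * (‖v‖ * ‖w‖) := by
    have hs : √(m * (‖w‖ ^ 2 / (a * L))) = m * (‖w‖ / √(m * a * L)) := by
      rw [show (m : ℝ) * (‖w‖ ^ 2 / (a * L)) = (m * ‖w‖) ^ 2 / (m * a * L) by field_simp,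
        Real.sqrt_div (sq_nonneg _), Real.sqrt_sq (by positivity)]
      ring
    rw [inv_mul_le_iff₀ hm0]
    calc _ ≤ c' * (‖v‖ * √(∑ j, crossForm S (x j) (x j) u₀ u₀)) := hsum v u₀
      _ ≤ c' * (‖v‖ * √(m * (‖w‖ ^ 2 / (a * L)))) := by gcongr
      _ = _ := by rw [hs]; ring
  -- The remaining error consists of moving from u₀ to u under uniform weights, and of changing the
  -- weights at u. The first is measured in the energy Q of the averaged form.
  obtain ⟨d, hd⟩ : ∃ d, d = u - u₀ := ⟨_, rfl⟩
  obtain ⟨Q, hQ⟩ : ∃ Q, Q = (m : ℝ)⁻¹ * ∑ j, crossForm S (x j) (x j) d d := ⟨_, rfl⟩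
  have hQ0 : 0 ≤ Q := by
    rw [hQ]
    exact mul_nonneg (by positivity) (Finset.sum_nonneg fun _ _ => crossForm_self_nonneg _ _ _)
  have hQd : a * ‖d‖ ^ 2 ≤ Q := by
    rw [hQ, le_inv_mul_iff₀ hm0]
    calc (m : ℝ) * (a * ‖d‖ ^ 2) = ∑ _j : Fin m, a * ‖d‖ ^ 2 := by simp
      _ ≤ _ := Finset.sum_le_sum fun j _ => hlower j d
  have hweights : ∀ f : Fin m → ℝ, ∀ M, 0 ≤ M → (∀ j, |f j| ≤ M) →
      ∑ j, (p j - (m : ℝ)⁻¹) * f j ≤ ε * M := by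
    intro f M hM hf
    calc ∑ j, (p j - (m : ℝ)⁻¹) * f j ≤ ∑ j, |p j - (m : ℝ)⁻¹| * M :=
          Finset.sum_le_sum fun j _ => (le_abs_self _).trans (by
            rw [abs_mul]
            exact mul_le_mul_of_nonneg_left (hf j) (abs_nonneg _))
      _ ≤ ε * M := by rw [← Finset.sum_mul]; exact mul_le_mul_of_nonneg_right hε hM
  -- Subtracting the two normal equations tested on d leaves only the deviations p_j - 1/m. Combined
  -- with a‖d‖² ≤ Q this bounds √Q linearly in ε.
  have hQle : Q ≤ ε * (K ^ 2 * (‖u‖ * ‖d‖)) := by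
    have h1 : Q = ∑ j, (p j - (m : ℝ)⁻¹) * -crossForm S (x j) (x j) u d := by
      have h2 := (hu d).trans (hu₀ d).symm
      simp only [sub_mul, Finset.sum_sub_distrib, mul_neg, Finset.sum_neg_distrib, h2, hQ,
        ← Finset.mul_sum]
      rw [show ∑ j, crossForm S (x j) (x j) d d = ∑ j, crossForm S (x j) (x j) u d
        - ∑ j, crossForm S (x j) (x j) u₀ d by
          rw [← Finset.sum_sub_distrib]
          refine Finset.sum_congr rfl fun j _ => ?_
          rw [← crossForm_sub_left, ← hd]]
      ring
    rw [h1]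
    refine hweights _ _ (by positivity) fun j => ?_
    rw [abs_neg]
    exact abs_crossForm_le (hupper j) u d
  have hsQ : √Q ≤ ε * (K ^ 2 * ‖u‖) / √a := by
    have h1 : √a * ‖d‖ ≤ √Q := by
      refine Real.le_sqrt_of_sq_le ?_
      rw [mul_pow, Real.sq_sqrt ha.le]
      exact hQd
    rw [le_div_iff₀ hsa]
    rcases (Real.sqrt_nonneg Q).eq_or_lt with h0 | h0
    · rw [← h0, zero_mul]
      positivity
    refine le_of_mul_le_mul_right ?_ h0
    calc √Q * √a * √Q = Q * √a := by
          rw [mul_right_comm, Real.mul_self_sqrt hQ0]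
      _ ≤ ε * (K ^ 2 * (‖u‖ * ‖d‖)) * √a := mul_le_mul_of_nonneg_right hQle hsa.le
      _ = ε * (K ^ 2 * ‖u‖) * (√a * ‖d‖) := by ring
      _ ≤ ε * (K ^ 2 * ‖u‖) * √Q := mul_le_mul_of_nonneg_left h1 (by positivity)
  have hT2 : (m : ℝ)⁻¹ * ∑ j, crossForm S (η j) (x j) v d ≤
      ε * (c * K ^ 2 / (a * √a)) * (‖v‖ * ‖w‖) := by
    -- Cauchy–Schwarz over the agents, so that the local noise bounds sum to the averaged energy.
    have hcs : ∑ j, √(crossForm S (x j) (x j) d d) ≤ m * √Q := by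
      refine le_of_sq_le_sq ?_ (by positivity)
      have h1 := sq_sum_le_card_mul_sum_sq (s := Finset.univ)
        (f := fun j => √(crossForm S (x j) (x j) d d))
      simp only [Real.sq_sqrt (crossForm_self_nonneg _ _ _), Finset.card_univ,
        Fintype.card_fin] at h1
      rw [mul_pow, Real.sq_sqrt hQ0, hQ]
      refine h1.trans (le_of_eq ?_)
      field_simp
    rw [inv_mul_le_iff₀ hm0]
    calc ∑ j, crossForm S (η j) (x j) v d
        ≤ ∑ j, c * (‖v‖ * √(crossForm S (x j) (x j) d d)) :=
          Finset.sum_le_sum fun j _ => hcross j v d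
      _ = c * (‖v‖ * ∑ j, √(crossForm S (x j) (x j) d d)) := by
          rw [Finset.mul_sum, Finset.mul_sum]
      _ ≤ c * (‖v‖ * (m * (ε * (K ^ 2 * (‖w‖ / a)) / √a))) := by
          refine mul_le_mul_of_nonneg_left (mul_le_mul_of_nonneg_left (hcs.trans
            (mul_le_mul_of_nonneg_left (hsQ.trans ?_) hm0.le)) (norm_nonneg _)) hc
          gcongr
      _ = _ := by field_simp
  have hT3 : ∑ j, (p j - (m : ℝ)⁻¹) * crossForm S (η j) (x j) v u ≤
      ε * (c * K / a) * (‖v‖ * ‖w‖) := by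
    have hsq : ∀ j, √(crossForm S (x j) (x j) u u) ≤ K * (‖w‖ / a) := fun j => by
      refine Real.sqrt_le_iff.2 ⟨by positivity, (hupper j u).trans ?_⟩
      rw [mul_pow]
      gcongr
    refine (hweights _ (c * (‖v‖ * (K * (‖w‖ / a)))) (by positivity) fun j => ?_).trans
      (le_of_eq (by ring))
    rw [abs_le']
    refine ⟨(hcross j v u).trans ?_, ?_⟩
    · have := hsq j
      gcongr
    · rw [← crossForm_neg_left]
      refine (hcross j (-v) u).trans ?_
      rw [norm_neg]
      have := hsq j
      gcongr
  have hsplit : ∑ j, p j * crossForm S (η j) (x j) v u =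
      (m : ℝ)⁻¹ * ∑ j, crossForm S (η j) (x j) v u₀
        + (m : ℝ)⁻¹ * ∑ j, crossForm S (η j) (x j) v d
        + ∑ j, (p j - (m : ℝ)⁻¹) * crossForm S (η j) (x j) v u := by
    simp only [sub_mul, Finset.sum_sub_distrib, ← Finset.mul_sum, hd, crossForm_sub_right]
    ring
  rw [hsplit]
  linarith

end Deterministic

-- Matrices as forms: eigenvalues, statistics, consensus

section Matrices

variable {k : ℕ} {A : Matrix (Fin k) (Fin k) ℝ}

theorem inner_eigenvectorBasis_toEuclideanLin (hA : A.IsHermitian) (i : Fin k)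
    (u : EuclideanSpace ℝ (Fin k)) :
    ⟪hA.eigenvectorBasis i, A.toEuclideanLin u⟫ = hA.eigenvalues i * ⟪hA.eigenvectorBasis i, u⟫ := by
  rw [← Matrix.isSymmetric_toEuclideanLin_iff.2 hA]
  have h : A.toEuclideanLin (hA.eigenvectorBasis i) =
      hA.eigenvalues i • hA.eigenvectorBasis i := by
    ext j
    exact congrFun (hA.mulVec_eigenvectorBasis i) j
  rw [h, real_inner_smul_left]

theorem inner_toEuclideanLin_self (hA : A.IsHermitian) (u : EuclideanSpace ℝ (Fin k)) :
    ⟪u, A.toEuclideanLin u⟫ = ∑ i, hA.eigenvalues i * ⟪hA.eigenvectorBasis i, u⟫ ^ 2 := by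
  rw [← hA.eigenvectorBasis.sum_inner_mul_inner]
  refine Finset.sum_congr rfl fun i _ => ?_
  rw [inner_eigenvectorBasis_toEuclideanLin, real_inner_comm]
  ring

theorem lambdaMin_mul_le_inner (hA : A.IsHermitian) (u : EuclideanSpace ℝ (Fin k)) :
    lambdaMin A * ‖u‖ ^ 2 ≤ ⟪u, A.toEuclideanLin u⟫ := by
  rw [inner_toEuclideanLin_self hA, ← hA.eigenvectorBasis.sum_sq_inner_right, Finset.mul_sum]
  refine Finset.sum_le_sum fun i _ => mul_le_mul_of_nonneg_right ?_ (sq_nonneg _)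
  exact csInf_le Matrix.finite_real_spectrum.bddBelow (hA.eigenvalues_mem_spectrum_real i)

theorem exists_inner_eq_lambdaMin (hk : 1 ≤ k) (hA : A.IsHermitian) :
    ∃ u : EuclideanSpace ℝ (Fin k), ‖u‖ = 1 ∧ ⟪u, A.toEuclideanLin u⟫ = lambdaMin A := by
  have hne : (spectrum ℝ A).Nonempty := ⟨_, hA.eigenvalues_mem_spectrum_real ⟨0, hk⟩⟩
  have hmem : lambdaMin A ∈ spectrum ℝ A := hne.csInf_mem Matrix.finite_real_spectrum
  rw [hA.spectrum_real_eq_range_eigenvalues] at hmem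
  obtain ⟨i, hi⟩ := hmem
  refine ⟨hA.eigenvectorBasis i, hA.eigenvectorBasis.norm_eq_one i, ?_⟩
  rw [inner_eigenvectorBasis_toEuclideanLin, real_inner_self_eq_norm_sq,
    hA.eigenvectorBasis.norm_eq_one, hi]
  ring

theorem toEuclideanLin_outer {p q : ℕ} (a : EuclideanSpace ℝ (Fin p))
    (b u : EuclideanSpace ℝ (Fin q)) :
    (outer a b).toEuclideanLin u = ⟪u, b⟫ • a := by
  ext i
  simp only [outer, Matrix.ofLp_toLpLin, Matrix.toLin'_apply, Matrix.mulVec, dotProduct,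
    Matrix.vecMulVec_apply, PiLp.inner_apply, PiLp.smul_apply, smul_eq_mul, Finset.sum_mul]
  exact Finset.sum_congr rfl fun j _ => by simp; ring

theorem stat_eq_sum {p q : ℕ} (a : ℕ → EuclideanSpace ℝ (Fin p)) (b : ℕ → EuclideanSpace ℝ (Fin q))
    (t : ℕ) : stat a b t = ∑ s ∈ Finset.Icc 1 t, outer (a s) (b s) := by
  induction t with
  | zero => rfl
  | succ t ih => rw [stat, ih, Finset.sum_Icc_succ_top (by omega)]

theorem inner_toEuclideanLin_stat {p q : ℕ} (a : ℕ → EuclideanSpace ℝ (Fin p))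
    (b : ℕ → EuclideanSpace ℝ (Fin q)) (t : ℕ) (v : EuclideanSpace ℝ (Fin p))
    (u : EuclideanSpace ℝ (Fin q)) :
    ⟪v, (stat a b t).toEuclideanLin u⟫ = crossForm (Finset.Icc 1 t) a b v u := by
  rw [stat_eq_sum, map_sum, LinearMap.sum_apply, inner_sum]
  refine Finset.sum_congr rfl fun s _ => ?_
  rw [toEuclideanLin_outer, real_inner_smul_right, mul_comm]

theorem outer_label {n l : ℕ} (Θ : Matrix (Fin l) (Fin n) ℝ) (x : EuclideanSpace ℝ (Fin n))
    (η : EuclideanSpace ℝ (Fin l)) : outer (label Θ x η) x = Θ * outer x x + outer η x := by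
  simp only [outer, label, WithLp.ofLp_add, Matrix.add_vecMulVec, Matrix.mul_vecMulVec]

theorem stat_label {n l : ℕ} (Θ : Matrix (Fin l) (Fin n) ℝ) (x : ℕ → EuclideanSpace ℝ (Fin n))
    (η : ℕ → EuclideanSpace ℝ (Fin l)) (t : ℕ) :
    stat (fun s => label Θ (x s) (η s)) x t = Θ * stat x x t + stat η x t := by
  simp only [stat_eq_sum, outer_label, Finset.sum_add_distrib, Matrix.mul_sum]

theorem consensus_eq_sum_pow {m p q : ℕ} {G : SimpleGraph (Fin m)} [DecidableRel G.Adj]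
    {W : Matrix (Fin m) (Fin m) ℝ} (hW : IsWeightMatrix G W) (M : Fin m → Matrix (Fin p) (Fin q) ℝ)
    (T : ℕ) (i : Fin m) : consensus G W M T i = ∑ j, (W ^ T) i j • M j := by
  have hstep : ∀ (f : Fin m → Matrix (Fin p) (Fin q) ℝ) (i : Fin m),
      W i i • f i + ∑ j ∈ G.neighborFinset i, W i j • f j = ∑ j, W i j • f j := by
    intro f i
    have hi : i ∉ G.neighborFinset i := by simp
    rw [← Finset.sum_insert (f := fun j => W i j • f j) hi]
    refine Finset.sum_subset (Finset.subset_univ _) fun j _ hj => ?_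
    rw [Finset.mem_insert, not_or, SimpleGraph.mem_neighborFinset] at hj
    rw [hW.eq_zero i j hj.2 (Ne.symm hj.1), zero_smul]
  induction T generalizing i with
  | zero => simp [consensus, Matrix.one_apply]
  | succ T ih =>
    rw [consensus, hstep, pow_succ']
    simp only [ih, Matrix.mul_apply, Finset.sum_smul, Finset.smul_sum, smul_smul]
    exact Finset.sum_comm

theorem norm_le_of_inner_le {p q : ℕ} {A : Matrix (Fin p) (Fin q) ℝ} {C : ℝ} (hC : 0 ≤ C)
    (h : ∀ v u, ⟪v, A.toEuclideanLin u⟫ ≤ C * (‖v‖ * ‖u‖)) : ‖A‖ ≤ C := by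
  rw [Matrix.l2_opNorm_def]
  refine ContinuousLinearMap.opNorm_le_bound _ hC fun u => ?_
  have h1 := h (A.toEuclideanLin u) u
  rw [real_inner_self_eq_norm_sq] at h1
  change ‖A.toEuclideanLin u‖ ≤ C * ‖u‖
  rcases (norm_nonneg (A.toEuclideanLin u)).eq_or_lt with h0 | h0
  · rw [← h0]
    positivity
  · refine le_of_mul_le_mul_left ?_ h0
    linarith

end Matrices

-- Mixing of the weight matrix

section Weights

variable {m : ℕ} {G : SimpleGraph (Fin m)} {W : Matrix (Fin m) (Fin m) ℝ}

theorem IsWeightMatrix.pow_apply_nonneg (hW : IsWeightMatrix G W) (T : ℕ) (i j : Fin m) :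
    0 ≤ (W ^ T) i j := by
  induction T generalizing i j with
  | zero => rw [pow_zero, Matrix.one_apply]; positivity
  | succ T ih =>
    rw [pow_succ, Matrix.mul_apply]
    exact Finset.sum_nonneg fun s _ => mul_nonneg (ih i s) (hW.nonneg s j)

theorem IsWeightMatrix.pow_mulVec_one (hW : IsWeightMatrix G W) (T : ℕ) : W ^ T *ᵥ 1 = 1 := by
  induction T with
  | zero => simp
  | succ T ih => rw [pow_succ, ← Matrix.mulVec_mulVec, hW.mulVec_one, ih]

theorem IsWeightMatrix.sum_pow (hW : IsWeightMatrix G W) (T : ℕ) (i : Fin m) :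
    ∑ j, (W ^ T) i j = 1 := by
  simpa [Matrix.mulVec, dotProduct] using congrFun (hW.pow_mulVec_one T) i

theorem rho_nonneg (hW : W.IsHermitian) : 0 ≤ rho W hW := by
  rw [rho]
  split_ifs with h
  · have h1 := hW.eigenvalues₀_antitone (show (⟨1, by rw [Fintype.card_fin]; omega⟩ :
      Fin (Fintype.card (Fin m))) ≤ ⟨m - 1, by rw [Fintype.card_fin]; omega⟩ from by
        rw [Fin.mk_le_mk]; omega)
    by_contra! hneg
    rw [max_lt_iff] at hneg
    linarith
  · exact le_rfl

theorem abs_eigenvalues₀_le_rho (hW : W.IsHermitian) (hm : 2 ≤ m)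
    (i : Fin (Fintype.card (Fin m))) (hi : i ≠ ⟨0, by rw [Fintype.card_fin]; omega⟩) :
    |hW.eigenvalues₀ i| ≤ rho W hW := by
  have hi1 : 1 ≤ (i : ℕ) := Nat.one_le_iff_ne_zero.2 fun h => hi (Fin.ext h)
  have hi2 : (i : ℕ) ≤ m - 1 := by
    have := i.2.trans_eq (Fintype.card_fin m)
    omega
  rw [rho, dif_pos hm, abs_le]
  constructor
  · have := hW.eigenvalues₀_antitone (show i ≤ ⟨m - 1, by rw [Fintype.card_fin]; omega⟩ from hi2)
    have h2 := le_max_right (hW.eigenvalues₀ ⟨1, by rw [Fintype.card_fin]; omega⟩)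
      (-hW.eigenvalues₀ ⟨m - 1, by rw [Fintype.card_fin]; omega⟩)
    linarith
  · exact (hW.eigenvalues₀_antitone (show ⟨1, by rw [Fintype.card_fin]; omega⟩ ≤ i from hi1)).trans
      (le_max_left _ _)

/-- All eigenvalues except the largest are at most ρ(W) < 1 in absolute value, so their eigenvectors
are orthogonal to the fixed vector 1. Hence 1 spans the top eigenline, and g has no component there.
-/
theorem IsWeightMatrix.norm_toEuclideanLin_le (hW : IsWeightMatrix G W) (hm : 2 ≤ m)
    {g : EuclideanSpace ℝ (Fin m)} (hg : ⟪WithLp.toLp 2 1, g⟫ = 0) :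
    ‖W.toEuclideanLin g‖ ≤ rho W hW.symm * ‖g‖ := by
  obtain ⟨e, he⟩ : ∃ e : EuclideanSpace ℝ (Fin m), e = WithLp.toLp 2 1 := ⟨_, rfl⟩
  rw [← he] at hg
  have heW : W.toEuclideanLin e = e := by
    ext j
    rw [he]
    exact congrFun hW.mulVec_one j
  set b := hW.symm.eigenvectorBasis with hb
  set σ := (Fintype.equivOfCardEq (Fintype.card_fin (Fintype.card (Fin m))) :
    Fin (Fintype.card (Fin m)) ≃ Fin m) with hσ
  set i₀ : Fin m := σ ⟨0, by rw [Fintype.card_fin]; omega⟩ with hi₀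
  have hev : ∀ i, i ≠ i₀ → |hW.symm.eigenvalues i| ≤ rho W hW.symm := fun i hi =>
    abs_eigenvalues₀_le_rho hW.symm hm _ fun h => hi (by rw [hi₀, ← h, Equiv.apply_symm_apply])
  have hbe : ∀ i, i ≠ i₀ → ⟪b i, e⟫ = 0 := by
    intro i hi
    have h1 := inner_eigenvectorBasis_toEuclideanLin hW.symm i e
    rw [heW, ← hb] at h1
    have h2 : hW.symm.eigenvalues i < 1 :=
      (le_abs_self _).trans_lt ((hev i hi).trans_lt hW.rho_lt_one)
    have h3 : (1 - hW.symm.eigenvalues i) * ⟪b i, e⟫ = 0 := by linarith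
    exact (mul_eq_zero.1 h3).resolve_left (by linarith)
  have hbg : ⟪b i₀, g⟫ = 0 := by
    have h1 := b.sum_inner_mul_inner e g
    rw [hg, Finset.sum_eq_single i₀ (fun i _ hi => by rw [real_inner_comm, hbe i hi, zero_mul])
      (fun h => absurd (Finset.mem_univ _) h)] at h1
    refine (mul_eq_zero.1 h1).resolve_left fun h0 => ?_
    have h2 : ‖e‖ ^ 2 = 0 := by
      rw [← b.sum_sq_inner_right e]
      refine Finset.sum_eq_zero fun i _ => ?_
      by_cases hi : i = i₀
      · rw [hi, real_inner_comm, h0]; ring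
      · rw [hbe i hi]; ring
    rw [EuclideanSpace.real_norm_sq_eq, he] at h2
    simp at h2
    omega
  refine le_of_sq_le_sq ?_ (mul_nonneg (rho_nonneg _) (norm_nonneg _))
  rw [mul_pow, ← b.sum_sq_inner_right, ← b.sum_sq_inner_right g, Finset.mul_sum]
  refine Finset.sum_le_sum fun i _ => ?_
  rw [hb, inner_eigenvectorBasis_toEuclideanLin, ← hb, mul_pow]
  by_cases hi : i = i₀
  · rw [hi, hbg]; simp
  · refine mul_le_mul_of_nonneg_right (sq_le_sq.2 ?_) (sq_nonneg _)
    exact (hev i hi).trans (le_abs_self _)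

/-- The rows of `W ^ T` approach the uniform weights at the rate `ρ(W) ^ T`. -/
theorem IsWeightMatrix.sum_abs_pow_sub_le (hW : IsWeightMatrix G W) (hm : 1 ≤ m) (T : ℕ)
    (i : Fin m) : ∑ j, |(W ^ T) i j - (m : ℝ)⁻¹| ≤ √m * rho W hW.symm ^ T := by
  rcases hm.eq_or_lt with rfl | hm2
  · have h := hW.sum_pow T i
    rw [Fin.sum_univ_one] at h ⊢
    rw [h]
    simpa using pow_nonneg (rho_nonneg hW.symm) T
  have hm0 : (m : ℝ) ≠ 0 := by positivity
  obtain ⟨g, hg⟩ : ∃ g : ℕ → EuclideanSpace ℝ (Fin m),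
    g = fun T => WithLp.toLp 2 fun j => (W ^ T) i j - (m : ℝ)⁻¹ := ⟨_, rfl⟩
  -- Rows of W^T evolve under right multiplication by W; symmetry turns this into the action of W,
  -- which fixes the uniform vector.
  have hstep : ∀ T, g (T + 1) = W.toEuclideanLin (g T) := by
    intro T
    ext j
    have h1 : ∀ s, W j s = W s j := fun s => by simpa using hW.symm.apply s j
    have h2 := hW.sum_pow 1 j
    rw [pow_one] at h2
    simp only [hg, pow_succ, Matrix.mul_apply, Matrix.ofLp_toLpLin, Matrix.toLin'_apply,
      Matrix.mulVec, dotProduct, mul_sub, Finset.sum_sub_distrib, ← Finset.sum_mul, h2, one_mul]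
    congr 1
    exact Finset.sum_congr rfl fun s _ => by rw [h1, mul_comm]
  have horth : ∀ T, ⟪WithLp.toLp 2 1, g T⟫ = 0 := by
    intro T
    simp [hg, PiLp.inner_apply, hW.sum_pow, hm0]
  have hnorm : ‖g T‖ ≤ rho W hW.symm ^ T := by
    induction T with
    | zero =>
      rw [pow_zero]
      have h1 : ‖g 0‖ ^ 2 = 1 - (m : ℝ)⁻¹ := by
        rw [EuclideanSpace.real_norm_sq_eq, hg]
        simp only [pow_zero, sub_sq, Finset.sum_add_distrib, Finset.sum_sub_distrib,
          ← Finset.sum_mul, ← Finset.mul_sum, Matrix.one_apply, ite_pow, Finset.sum_ite_eq,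
          Finset.mem_univ]
        simp
        field_simp
        ring
      have h2 : 0 ≤ (m : ℝ)⁻¹ := by positivity
      nlinarith [norm_nonneg (g 0)]
    | succ T ih =>
      rw [hstep, pow_succ']
      exact (hW.norm_toEuclideanLin_le hm2 (horth T)).trans
        (mul_le_mul_of_nonneg_left ih (rho_nonneg _))
  refine le_trans (le_of_sq_le_sq ?_ (by positivity))
    (mul_le_mul_of_nonneg_left hnorm (by positivity))
  have h1 := sq_sum_le_card_mul_sum_sq (s := Finset.univ) (f := fun j => |(W ^ T) i j - (m : ℝ)⁻¹|)
  refine h1.trans (le_of_eq ?_)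
  rw [mul_pow, Real.sq_sqrt (by positivity), EuclideanSpace.real_norm_sq_eq, hg]
  simp

end Weights

-- Comparison with the stated constants

section Constants

theorem one_add_log_le_log_nine_div {δ : ℝ} (hδ : 0 < δ) :
    1 + Real.log (1 / δ) ≤ Real.log (9 / δ) := by
  rw [div_eq_mul_one_div 9 δ, Real.log_mul (by norm_num) (by positivity)]
  have : 1 ≤ Real.log 9 := by
    rw [Real.le_log_iff_exp_le (by norm_num)]
    linarith [Real.exp_one_lt_d9]
  linarith

theorem gaussianNormBound_le_sqrt_log {D δ : ℝ} (hD : 1 ≤ D) (hδ : 0 < δ) (hδ1 : δ ≤ 1) :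
    gaussianNormBound D δ ≤ 4 * √(D * Real.log (9 / δ)) := by
  have hlam : 0 ≤ Real.log (1 / δ) := Real.log_nonneg (by rw [le_div_iff₀ hδ]; linarith)
  have h9 := one_add_log_le_log_nine_div hδ
  refine Real.sqrt_le_iff.2 ⟨by positivity, ?_⟩
  rw [mul_pow, Real.sq_sqrt (mul_nonneg (by linarith) (by linarith))]
  nlinarith [mul_le_mul_of_nonneg_left h9 (show 0 ≤ D by linarith),
    mul_le_mul_of_nonneg_right hD hlam]

theorem sqrt_eight_mul_gaussianNormBound_le {D δ : ℝ} (hD : 0 ≤ D) (hδ : 0 < δ) (hδ1 : δ ≤ 1) :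
    √8 * gaussianNormBound D δ ≤ 4 * (√(2 * D) + 2 * √(Real.log (2 / δ))) := by
  have hlam : 0 ≤ Real.log (1 / δ) := Real.log_nonneg (by rw [le_div_iff₀ hδ]; linarith)
  have hlog : Real.log (1 / δ) ≤ Real.log (2 / δ) :=
    Real.log_le_log (by positivity) (by gcongr; norm_num)
  rw [gaussianNormBound, ← Real.sqrt_mul (by norm_num)]
  refine Real.sqrt_le_iff.2 ⟨by positivity, ?_⟩
  have h1 := Real.sq_sqrt (show 0 ≤ 2 * D by positivity)
  have h2 := Real.sq_sqrt (hlam.trans hlog)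
  have h3 : 0 ≤ √(2 * D) * √(Real.log (2 / δ)) := by positivity
  nlinarith

variable {n l : ℕ} {σx ση μhat : ℝ}

/-- Multiplying above and below by σ_x √L produces the factor L of the denominator. Then σ_x √L ≤
σ_x + 2μ̂, and the two summands use different estimates of `gaussianNormBound`, matching the two
summands of C₁. -/
theorem statistical_term_le (hn : 1 ≤ n) (hσx : 0 < σx) (hση : 0 ≤ ση) (hμ : 0 ≤ μhat)
    {m t : ℕ} {L δ : ℝ} (hL : 0 < L) (hL1 : L ≤ 1 + 4 * (μhat / σx) ^ 2) (hδ : 0 < δ)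
    (hδ1 : δ ≤ 1) :
    ση * gaussianNormBound (l + n) δ / √(m * (t * σx ^ 2 / 8) * L) ≤
      C₁ n l σx ση μhat δ / (√(m * t) * σx ^ 2 * L) := by
  obtain ⟨z, hz⟩ : ∃ z, z = gaussianNormBound (l + n) δ := ⟨_, rfl⟩
  have hn' : (1 : ℝ) ≤ n := by exact_mod_cast hn
  have hz0 : 0 ≤ z := hz ▸ Real.sqrt_nonneg _
  have h8 : (0 : ℝ) < √8 := by positivity
  have h1 : √8 * z ≤ 32 * √((n + l) * Real.log (9 / δ)) := by
    have h2 := gaussianNormBound_le_sqrt_log (D := (l : ℝ) + n)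
      (by linarith [(l.cast_nonneg : (0 : ℝ) ≤ l)]) hδ hδ1
    rw [← hz, add_comm (l : ℝ)] at h2
    have h3 : √8 ≤ 8 := Real.sqrt_le_iff.2 ⟨by norm_num, by norm_num⟩
    calc √8 * z ≤ 8 * (4 * √((n + l) * Real.log (9 / δ))) := mul_le_mul h3 h2 hz0 (by norm_num)
      _ = _ := by ring
  have h2 : √8 * z ≤ 4 * (√(2 * (l + n)) + 2 * √(Real.log (2 / δ))) :=
    hz ▸ sqrt_eight_mul_gaussianNormBound_le (by positivity) hδ hδ1
  have hs : σx * √L ≤ σx + 2 * μhat := by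
    refine le_of_sq_le_sq ?_ (by positivity)
    rw [mul_pow, Real.sq_sqrt hL.le]
    have h3 := mul_le_mul_of_nonneg_left hL1 (sq_nonneg σx)
    have h4 : σx ^ 2 * (1 + 4 * (μhat / σx) ^ 2) = σx ^ 2 + 4 * μhat ^ 2 := by field_simp
    nlinarith [mul_nonneg hσx.le hμ]
  have hC : ση * (√8 * z) * (σx * √L) ≤ C₁ n l σx ση μhat δ := by
    calc ση * (√8 * z) * (σx * √L) ≤ ση * (√8 * z) * (σx + 2 * μhat) :=
          mul_le_mul_of_nonneg_left hs (by positivity)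
      _ = ση * (σx * (√8 * z) + 2 * μhat * (√8 * z)) := by ring
      _ ≤ ση * (σx * (32 * √((n + l) * Real.log (9 / δ)))
          + 2 * μhat * (4 * (√(2 * (l + n)) + 2 * √(Real.log (2 / δ))))) := by gcongr
      _ = _ := by rw [C₁]; ring
  have hsL : 0 < √L := Real.sqrt_pos.2 hL
  have hden : √((m : ℝ) * (t * σx ^ 2 / 8) * L) = √(m * t) * σx * √L / √8 := by
    rw [show (m : ℝ) * (t * σx ^ 2 / 8) * L = (m * t) * σx ^ 2 * L / 8 by ring,
      Real.sqrt_div' _ (by norm_num), Real.sqrt_mul (by positivity), Real.sqrt_mul (by positivity),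
      Real.sqrt_sq hσx.le]
  rw [hden, ← hz]
  calc ση * z / (√(m * t) * σx * √L / √8)
      = ση * (√8 * z) * (σx * √L) / (√(m * t) * σx ^ 2 * (√L) ^ 2) := by
        field_simp
    _ = ση * (√8 * z) * (σx * √L) / (√(m * t) * σx ^ 2 * L) := by rw [Real.sq_sqrt hL.le]
    _ ≤ _ := div_le_div_of_nonneg_right hC (by positivity)

/-- Here 114/5 = 8 · 57/20 with 57/20 ≥ √8, and √(5n) ≥ 11/5 supplies the numerical room. -/
theorem le_c₃ (hn : 1 ≤ n) (hσx : 0 < σx) (hμ : 0 ≤ μhat) {m : ℕ} (hm : 1 ≤ m) :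
    √m * (114 / 5 * (μhat + 11 / 5 * σx) ^ 2 / σx ^ 4 + 8 * (μhat + 11 / 5 * σx) / σx ^ 3) ≤
      c₃ m n σx μhat := by
  have hm' : (1 : ℝ) ≤ m := by exact_mod_cast hm
  have hn' : (1 : ℝ) ≤ n := by exact_mod_cast hn
  have h1 : √(m : ℝ) ≤ (m : ℝ) ^ (3 / 2 : ℝ) := by
    rw [Real.sqrt_eq_rpow]
    exact Real.rpow_le_rpow_of_exponent_le hm' (by norm_num)
  have h2 : 11 / 5 ≤ √(5 * (n : ℝ)) := Real.le_sqrt_of_sq_le (by linarith)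
  have h3 : 114 / 5 * (μhat + 11 / 5 * σx) ^ 2 / σx ^ 4 + 8 * (μhat + 11 / 5 * σx) / σx ^ 3 ≤
      11 / 5 * (152 / σx ^ 2 + 64 / σx ^ 4 * μhat ^ 2) := by
    rw [show 114 / 5 * (μhat + 11 / 5 * σx) ^ 2 / σx ^ 4 + 8 * (μhat + 11 / 5 * σx) / σx ^ 3 =
      (114 / 5 * (μhat + 11 / 5 * σx) ^ 2 + 8 * (μhat + 11 / 5 * σx) * σx) / σx ^ 4 by field_simp,
      show 11 / 5 * (152 / σx ^ 2 + 64 / σx ^ 4 * μhat ^ 2) =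
        11 / 5 * (152 * σx ^ 2 + 64 * μhat ^ 2) / σx ^ 4 by field_simp]
    refine div_le_div_of_nonneg_right ?_ (by positivity)
    nlinarith [sq_nonneg (μhat - σx), sq_nonneg μhat, sq_nonneg σx]
  calc √m * (114 / 5 * (μhat + 11 / 5 * σx) ^ 2 / σx ^ 4 + 8 * (μhat + 11 / 5 * σx) / σx ^ 3)
      ≤ (m : ℝ) ^ (3 / 2 : ℝ) * (√(5 * n) * (152 / σx ^ 2 + 64 / σx ^ 4 * μhat ^ 2)) :=
        mul_le_mul h1 (h3.trans (mul_le_mul_of_nonneg_right h2 (by positivity))) (by positivity)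
          (by positivity)
    _ = _ := by rw [c₃]; ring

/-- Only the summand c₃ t^{-1/2} c₂ of C₀ is needed; all others are nonnegative and are dropped. -/
theorem network_term_le (hn : 1 ≤ n) (hσx : 0 < σx) (hση : 0 ≤ ση) (hμ : 0 ≤ μhat)
    (Θ : Matrix (Fin l) (Fin n) ℝ) {m t T : ℕ} (hm : 1 ≤ m) (ht : 1 ≤ t) {r δ : ℝ} (hr : 0 ≤ r)
    (hδ : 0 < δ) (hδ1 : δ ≤ 1) {a K c : ℝ} (ha : a = t * σx ^ 2 / 8)
    (hK : K = √t * (μhat + 11 / 5 * σx)) (hc : c = ση * gaussianNormBound (l + n) δ) :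
    √m * r ^ T * (c * K ^ 2 / (a * √a) + c * K / a) ≤
      r ^ T * C₀ m Θ σx ση μhat δ r t T := by
  have hn' : (1 : ℝ) ≤ n := by exact_mod_cast hn
  have ht0 : (0 : ℝ) < t := by exact_mod_cast ht
  have hst : 0 < √(t : ℝ) := Real.sqrt_pos.2 ht0
  have hc0 : 0 ≤ c := hc ▸ mul_nonneg hση (Real.sqrt_nonneg _)
  obtain ⟨κ, hκ⟩ : ∃ κ, κ = μhat + 11 / 5 * σx := ⟨_, rfl⟩
  have hκ0 : 0 ≤ κ := by rw [hκ]; positivity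
  have hsa : √a = √t * σx / √8 := by
    rw [ha, Real.sqrt_div' _ (by norm_num), Real.sqrt_mul ht0.le, Real.sqrt_sq hσx.le]
  have h8 : √8 ≤ 57 / 20 := Real.sqrt_le_iff.2 ⟨by norm_num, by norm_num⟩
  have hsq : √(t : ℝ) ^ 2 = t := Real.sq_sqrt ht0.le
  have e1 : c * K ^ 2 / (a * √a) ≤ c * σx * (114 / 5 * κ ^ 2 / σx ^ 4) / √t := by
    rw [hsa, ha, hK, ← hκ]
    rw [show c * (√t * κ) ^ 2 / (t * σx ^ 2 / 8 * (√t * σx / √8)) =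
      (√t ^ 2 / t) * (8 * √8) * (c * κ ^ 2 / (√t * σx ^ 3)) by field_simp,
      show c * σx * (114 / 5 * κ ^ 2 / σx ^ 4) / √t = 1 * (114 / 5) * (c * κ ^ 2 / (√t * σx ^ 3)) by
        field_simp, hsq, div_self ht0.ne']
    refine mul_le_mul_of_nonneg_right ?_ (by positivity)
    linarith
  have e2 : c * K / a = c * σx * (8 * κ / σx ^ 3) / √t := by
    rw [ha, hK, ← hκ]
    nth_rewrite 2 [← hsq]
    field_simp
  have hcc : c * σx ≤ c₂ n l σx ση μhat δ := by
    have h2 := gaussianNormBound_le_sqrt_log (D := (l : ℝ) + n)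
      (by linarith [(l.cast_nonneg : (0 : ℝ) ≤ l)]) hδ hδ1
    rw [add_comm (l : ℝ)] at h2
    rw [hc, c₂, add_comm (l : ℝ) n]
    calc ση * gaussianNormBound (n + l) δ * σx ≤ ση * (4 * √((n + l) * Real.log (9 / δ))) * σx := by
          gcongr
      _ = ση * (4 * σx * √((n + l) * Real.log (9 / δ)) + 0) := by ring
      _ ≤ _ := by gcongr; positivity
  have hc₃ := le_c₃ hn hσx hμ hm
  rw [← hκ] at hc₃
  have hc₃0 : 0 ≤ c₃ m n σx μhat := by rw [c₃]; positivity
  have hc₁0 : 0 ≤ c₁ Θ σx μhat := by rw [c₁]; positivity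
  have hc₂0 : 0 ≤ c₂ n l σx ση μhat δ := by rw [c₂]; positivity
  have hrp : (t : ℝ) ^ (-(1 / 2) : ℝ) = (√t)⁻¹ := by
    rw [Real.rpow_neg ht0.le, Real.sqrt_eq_rpow]
  have hmain : √m * (c * K ^ 2 / (a * √a) + c * K / a) ≤
      c₃ m n σx μhat * ((√t)⁻¹ * c₂ n l σx ση μhat δ) := by
    calc √m * (c * K ^ 2 / (a * √a) + c * K / a)
        ≤ √m * (c * σx * (114 / 5 * κ ^ 2 / σx ^ 4) / √t + c * σx * (8 * κ / σx ^ 3) / √t) := by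
          rw [e2]
          gcongr
      _ = (√m * (114 / 5 * κ ^ 2 / σx ^ 4 + 8 * κ / σx ^ 3)) * ((√t)⁻¹ * (c * σx)) := by ring
      _ ≤ _ := by gcongr
  rw [mul_right_comm, mul_comm]
  refine mul_le_mul_of_nonneg_left (hmain.trans ?_) (by positivity)
  rw [C₀, hrp]
  have h1 : 0 ≤ c₃ m n σx μhat * c₁ Θ σx μhat := by positivity
  have h2 : 0 ≤ 8 * (m : ℝ) ^ (3 / 2 : ℝ) * √l * (c₁ Θ σx μhat
    + (√t)⁻¹ * c₂ n l σx ση μhat δ) / σx ^ 2 := by positivity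
  have h3 : 0 ≤ r ^ T * (m : ℝ) ^ (3 / 2 : ℝ) * √l * c₃ m n σx μhat * (c₁ Θ σx μhat
    + (√t)⁻¹ * c₂ n l σx ση μhat δ) := by positivity
  linarith

end Constants

-- The error of one agent on the good event

section Estimate

theorem toEuclideanLin_mul {p q r : ℕ} (A : Matrix (Fin p) (Fin q) ℝ) (B : Matrix (Fin q) (Fin r) ℝ)
    (u : EuclideanSpace ℝ (Fin r)) :
    (A * B).toEuclideanLin u = A.toEuclideanLin (B.toEuclideanLin u) := by
  ext i
  simp [Matrix.mulVec_mulVec]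

theorem isUnit_of_le_inner {k : ℕ} {A : Matrix (Fin k) (Fin k) ℝ} {a : ℝ} (ha : 0 < a)
    (h : ∀ u, a * ‖u‖ ^ 2 ≤ ⟪u, A.toEuclideanLin u⟫) : IsUnit A := by
  rw [← Matrix.mulVec_injective_iff_isUnit]
  intro u v huv
  have h1 : A.toEuclideanLin (WithLp.toLp 2 (u - v)) = 0 := by
    ext i
    simpa [Matrix.mulVec_sub, sub_eq_zero] using congrFun huv i
  have h2 := h (WithLp.toLp 2 (u - v))
  rw [h1, inner_zero_right] at h2
  have h3 : WithLp.toLp 2 (u - v) = (0 : EuclideanSpace ℝ (Fin k)) := by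
    rw [← norm_eq_zero, ← sq_eq_zero_iff]
    exact le_antisymm (nonpos_of_mul_nonpos_right h2 ha) (sq_nonneg _)
  rw [← sub_eq_zero]
  exact congrArg WithLp.ofLp h3

theorem pinv_eq_inv {k : ℕ} {A : Matrix (Fin k) (Fin k) ℝ} (h : IsUnit A) : pinv A = A⁻¹ := by
  have hd := (Matrix.isUnit_iff_isUnit_det A).1 h
  refine (IsPseudoinverse.eq_pinv ⟨?_, ?_, ?_, ?_⟩).symm
  · rw [Matrix.mul_nonsing_inv _ hd, one_mul]
  · rw [Matrix.nonsing_inv_mul _ hd, one_mul]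
  · rw [Matrix.mul_nonsing_inv _ hd, Matrix.conjTranspose_one]
  · rw [Matrix.nonsing_inv_mul _ hd, Matrix.conjTranspose_one]

variable {m n l : ℕ}

theorem inner_sum_smul_stat {p q : ℕ} (a : Fin m → ℕ → EuclideanSpace ℝ (Fin p))
    (b : Fin m → ℕ → EuclideanSpace ℝ (Fin q)) (w : Fin m → ℝ) (t : ℕ)
    (v : EuclideanSpace ℝ (Fin p)) (u : EuclideanSpace ℝ (Fin q)) :
    ⟪v, (∑ j, w j • stat (a j) (b j) t).toEuclideanLin u⟫ =
      ∑ j, w j * crossForm (Finset.Icc 1 t) (a j) (b j) v u := by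
  rw [map_sum, LinearMap.sum_apply, inner_sum]
  refine Finset.sum_congr rfl fun j _ => ?_
  rw [map_smul, LinearMap.smul_apply, real_inner_smul_right, inner_toEuclideanLin_stat]

theorem isHermitian_one_add_muBar (μ : Fin m → ℕ → EuclideanSpace ℝ (Fin n)) (σx : ℝ) (t : ℕ) :
    (1 + muBar μ σx t).IsHermitian := by
  ext i j
  simp [muBar, outer, Matrix.sum_apply, Matrix.vecMulVec_apply, Matrix.one_apply, eq_comm, mul_comm]

theorem inner_one_add_muBar (μ : Fin m → ℕ → EuclideanSpace ℝ (Fin n)) (σx : ℝ) (t : ℕ)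
    (u : EuclideanSpace ℝ (Fin n)) :
    ⟪u, (1 + muBar μ σx t).toEuclideanLin u⟫ = ‖u‖ ^ 2
      + 4 / ((m : ℝ) * t * σx ^ 2) * ∑ j, ∑ s ∈ Finset.Icc 1 t, ⟪u, μ j s⟫ ^ 2 := by
  have h1 : (1 : Matrix (Fin n) (Fin n) ℝ).toEuclideanLin u = u := by
    ext i
    simp
  have h2 : muBar μ σx t =
      ∑ j, (4 / ((m : ℝ) * t * σx ^ 2)) • stat (μ j) (μ j) t := by
    simp only [muBar, stat_eq_sum, Finset.smul_sum]
  rw [map_add, LinearMap.add_apply, inner_add_right, h1, real_inner_self_eq_norm_sq, h2,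
    inner_sum_smul_stat, ← Finset.mul_sum]
  simp only [crossForm_self]

theorem one_le_lambdaMin (hn : 1 ≤ n) (μ : Fin m → ℕ → EuclideanSpace ℝ (Fin n)) (σx : ℝ) (t : ℕ) :
    1 ≤ lambdaMin (1 + muBar μ σx t) := by
  obtain ⟨u, hu, h⟩ := exists_inner_eq_lambdaMin hn (isHermitian_one_add_muBar μ σx t)
  rw [← h, inner_one_add_muBar, hu]
  have : 0 ≤ ∑ j, ∑ s ∈ Finset.Icc 1 t, ⟪u, μ j s⟫ ^ 2 :=
    Finset.sum_nonneg fun _ _ => Finset.sum_nonneg fun _ _ => sq_nonneg _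
  have : 0 ≤ 4 / ((m : ℝ) * t * σx ^ 2) := by positivity
  nlinarith

/-- This upper bound allows one factor √L to be exchanged for σ_x and μ̂ in the statistical term, so
that the final denominator contains L itself. -/
theorem lambdaMin_le (hn : 1 ≤ n) (hm : 1 ≤ m) {μ : Fin m → ℕ → EuclideanSpace ℝ (Fin n)} {σx : ℝ}
    (hσx : 0 < σx) {t : ℕ} (ht : 1 ≤ t) {μhat : ℝ} (hμ : ∀ j s, 1 ≤ s → ‖μ j s‖ ≤ μhat) :
    lambdaMin (1 + muBar μ σx t) ≤ 1 + 4 * (μhat / σx) ^ 2 := by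
  obtain ⟨u, hu, h⟩ := exists_inner_eq_lambdaMin hn (isHermitian_one_add_muBar μ σx t)
  have hm0 : (0 : ℝ) < m := by exact_mod_cast hm
  have ht0 : (0 : ℝ) < t := by exact_mod_cast ht
  rw [← h, inner_one_add_muBar, hu]
  have h1 : ∑ j, ∑ s ∈ Finset.Icc 1 t, ⟪u, μ j s⟫ ^ 2 ≤ m * (t * μhat ^ 2) := by
    calc ∑ j, ∑ s ∈ Finset.Icc 1 t, ⟪u, μ j s⟫ ^ 2
        ≤ ∑ _j : Fin m, ∑ _s ∈ Finset.Icc 1 t, μhat ^ 2 := by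
          refine Finset.sum_le_sum fun j _ => Finset.sum_le_sum fun s hs => ?_
          refine sq_le_sq' ?_ ?_
          · have := neg_le_of_abs_le (abs_real_inner_le_norm u (μ j s))
            rw [hu, one_mul] at this
            linarith [hμ j s (Finset.mem_Icc.1 hs).1]
          · have := le_of_abs_le (abs_real_inner_le_norm u (μ j s))
            rw [hu, one_mul] at this
            exact this.trans (hμ j s (Finset.mem_Icc.1 hs).1)
      _ = _ := by simp
  calc (1 : ℝ) ^ 2 + 4 / ((m : ℝ) * t * σx ^ 2) * ∑ j, ∑ s ∈ Finset.Icc 1 t, ⟪u, μ j s⟫ ^ 2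
      ≤ 1 ^ 2 + 4 / ((m : ℝ) * t * σx ^ 2) * (m * (t * μhat ^ 2)) := by gcongr
    _ = _ := by field_simp

theorem IsGoodSample.norm_consensus_mul_pinv_sub_le {x : Fin m → ℕ → EuclideanSpace ℝ (Fin n)}
    {η : Fin m → ℕ → EuclideanSpace ℝ (Fin l)} {μ : Fin m → ℕ → EuclideanSpace ℝ (Fin n)}
    {σx ση μhat δhat δ : ℝ} {t : ℕ} (h : IsGoodSample x η μ σx ση μhat δhat δ t)
    {G : SimpleGraph (Fin m)} [DecidableRel G.Adj] {W : Matrix (Fin m) (Fin m) ℝ}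
    (hW : IsWeightMatrix G W) (Θ : Matrix (Fin l) (Fin n) ℝ) (hn : 1 ≤ n) (hm : 1 ≤ m)
    (ht : 1 ≤ t) (hσx : 0 < σx) (hση : 0 ≤ ση) (hμ0 : 0 ≤ μhat)
    (hμ : ∀ j s, 1 ≤ s → ‖μ j s‖ ≤ μhat) (hδhat : 0 < δhat) (hδhat1 : δhat ≤ 1) (hδ : 0 < δ)
    (hδ1 : δ ≤ 1) (T : ℕ) (i : Fin m) :
    ‖consensus G W (fun j => stat (fun s => label Θ (x j s) (η j s)) (x j) t) T i
        * pinv (consensus G W (fun j => stat (x j) (x j) t) T i) - Θ‖ ≤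
      rho W hW.symm ^ T * C₀ m Θ σx ση μhat δhat (rho W hW.symm) t T
        + C₁ n l σx ση μhat δ / (√(m * t) * σx ^ 2 * lambdaMin (1 + muBar μ σx t)) := by
  have hm0 : (0 : ℝ) < m := by exact_mod_cast hm
  have ht0 : (0 : ℝ) < t := by exact_mod_cast ht
  obtain ⟨a, ha⟩ : ∃ a : ℝ, a = t * σx ^ 2 / 8 := ⟨_, rfl⟩
  have ha0 : 0 < a := by rw [ha]; positivity
  obtain ⟨L, hL⟩ : ∃ L : ℝ, L = lambdaMin (1 + muBar μ σx t) := ⟨_, rfl⟩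
  have hL1 : 1 ≤ L := hL ▸ one_le_lambdaMin hn μ σx t
  have hL0 : 0 < L := by linarith
  have hLle : L ≤ 1 + 4 * (μhat / σx) ^ 2 := hL ▸ lambdaMin_le hn hm hσx ht hμ
  have hlower : ∀ j u, a * ‖u‖ ^ 2 ≤ crossForm (Finset.Icc 1 t) (x j) (x j) u u := by
    intro j u
    have h1 := h.lower j u
    have h2 : 0 ≤ ∑ s ∈ Finset.Icc 1 t, ⟪u, μ j s⟫ ^ 2 := Finset.sum_nonneg fun _ _ => sq_nonneg _
    rw [crossForm_self, ha]
    linarith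
  -- Averaging the lower bounds over the agents gives exactly a(I + μ̄_t), because a · 4/(tσ_x²) =
  -- 1/2.
  have havg : ∀ u, a * L * ‖u‖ ^ 2 ≤
      (m : ℝ)⁻¹ * ∑ j, crossForm (Finset.Icc 1 t) (x j) (x j) u u := by
    intro u
    have h1 := lambdaMin_mul_le_inner (isHermitian_one_add_muBar μ σx t) u
    rw [← hL, inner_one_add_muBar] at h1
    have h2 := mul_le_mul_of_nonneg_left h1 (mul_nonneg hm0.le ha0.le)
    rw [le_inv_mul_iff₀ hm0]
    calc m * (a * L * ‖u‖ ^ 2) = m * a * (L * ‖u‖ ^ 2) := by ring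
      _ ≤ _ := h2
      _ = ∑ j, (a * ‖u‖ ^ 2 + 1 / 2 * ∑ s ∈ Finset.Icc 1 t, ⟪u, μ j s⟫ ^ 2) := by
        simp only [Finset.sum_add_distrib, ← Finset.mul_sum, Finset.sum_const, Finset.card_univ,
          Fintype.card_fin, nsmul_eq_mul, ha]
        field_simp
        ring
      _ ≤ _ := Finset.sum_le_sum fun j _ => by
        rw [crossForm_self, ha]
        exact h.lower j u
  obtain ⟨K, hK⟩ : ∃ K : ℝ, K = √t * (μhat + 11 / 5 * σx) := ⟨_, rfl⟩
  have hK0 : 0 ≤ K := by rw [hK]; positivity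
  have hupper : ∀ j u, crossForm (Finset.Icc 1 t) (x j) (x j) u u ≤ K ^ 2 * ‖u‖ ^ 2 := by
    intro j u
    rw [crossForm_self, hK, mul_pow, Real.sq_sqrt ht0.le]
    exact h.upper j u
  obtain ⟨c, hc⟩ : ∃ c : ℝ, c = ση * gaussianNormBound (l + n) δhat := ⟨_, rfl⟩
  have hc0 : 0 ≤ c := hc ▸ mul_nonneg hση (Real.sqrt_nonneg _)
  obtain ⟨c', hc'⟩ : ∃ c' : ℝ, c' = ση * gaussianNormBound (l + n) δ := ⟨_, rfl⟩
  have hc'0 : 0 ≤ c' := hc' ▸ mul_nonneg hση (Real.sqrt_nonneg _)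
  obtain ⟨ε, hε⟩ : ∃ ε : ℝ, ε = √m * rho W hW.symm ^ T := ⟨_, rfl⟩
  have hρ := rho_nonneg hW.symm
  have hunit : ∀ p : Fin m → ℝ, (∀ j, 0 ≤ p j) → ∑ j, p j = 1 →
      IsUnit (∑ j, p j • stat (x j) (x j) t) := by
    intro p hp hp1
    refine isUnit_of_le_inner ha0 fun u => ?_
    rw [inner_sum_smul_stat]
    calc a * ‖u‖ ^ 2 = ∑ j, p j * (a * ‖u‖ ^ 2) := by rw [← Finset.sum_mul, hp1, one_mul]
      _ ≤ _ := Finset.sum_le_sum fun j _ => mul_le_mul_of_nonneg_left (hlower j u) (hp j)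
  have hsolve : ∀ p : Fin m → ℝ, IsUnit (∑ j, p j • stat (x j) (x j) t) → ∀ w y,
      ∑ j, p j * crossForm (Finset.Icc 1 t) (x j) (x j)
        ((∑ j, p j • stat (x j) (x j) t)⁻¹.toEuclideanLin w) y = ⟪w, y⟫ := by
    intro p hp w y
    have h1 : (∑ j, p j • stat (x j) (x j) t).toEuclideanLin
        ((∑ j, p j • stat (x j) (x j) t)⁻¹.toEuclideanLin w) = w := by
      rw [← toEuclideanLin_mul,
        Matrix.mul_nonsing_inv _ ((Matrix.isUnit_iff_isUnit_det _).1 hp)]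
      ext i
      simp
    conv_rhs => rw [← h1, real_inner_comm, inner_sum_smul_stat]
    exact Finset.sum_congr rfl fun j _ => congrArg (p j * ·)
      (Finset.sum_congr rfl fun s _ => mul_comm _ _)
  have hp1 := hW.sum_pow T i
  have hβ := hunit _ (hW.pow_apply_nonneg T i) hp1
  have hβ₀ := hunit (fun _ => (m : ℝ)⁻¹) (fun _ => by positivity) (by simp [hm0.ne'])
  rw [consensus_eq_sum_pow hW, consensus_eq_sum_pow hW, pinv_eq_inv hβ]
  obtain ⟨B, hB⟩ : ∃ B, B = ∑ j, (W ^ T) i j • stat (x j) (x j) t := ⟨_, rfl⟩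
  -- The signal Θ is removed exactly by the inverse.
  have herr : (∑ j, (W ^ T) i j • stat (fun s => label Θ (x j s) (η j s)) (x j) t) * B⁻¹ - Θ =
      (∑ j, (W ^ T) i j • stat (η j) (x j) t) * B⁻¹ := by
    have h1 : ∑ j, (W ^ T) i j • stat (fun s => label Θ (x j s) (η j s)) (x j) t =
        Θ * B + ∑ j, (W ^ T) i j • stat (η j) (x j) t := by
      simp only [stat_label, smul_add, Finset.sum_add_distrib, hB, Matrix.mul_sum, Matrix.mul_smul]
    rw [h1, Matrix.add_mul, Matrix.mul_assoc,
      Matrix.mul_nonsing_inv _ ((Matrix.isUnit_iff_isUnit_det _).1 (hB ▸ hβ)), Matrix.mul_one,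
      add_sub_cancel_left]
  rw [← hB, herr]
  have hbound : ε * (c * K ^ 2 / (a * √a) + c * K / a) + c' / √(m * a * L) ≤
      rho W hW.symm ^ T * C₀ m Θ σx ση μhat δhat (rho W hW.symm) t T
        + C₁ n l σx ση μhat δ / (√(m * t) * σx ^ 2 * L) := by
    rw [hε]
    refine add_le_add (network_term_le hn hσx hση hμ0 Θ hm ht hρ hδhat hδhat1 ha hK hc) ?_
    rw [hc', ha]
    exact statistical_term_le hn hσx hση hμ0 hL0 hLle hδ hδ1
  rw [← hL]
  refine (norm_le_of_inner_le ?_ fun v w => ?_).trans hbound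
  · rw [hε]
    positivity
  rw [toEuclideanLin_mul, inner_sum_smul_stat]
  refine (sum_mul_crossForm_le hm (S := Finset.Icc 1 t) (x := x) (η := η) ha0 hK0 hL0 hc0 hc'0
    hlower havg hupper ?_ ?_ (hW.pow_apply_nonneg T i) hp1
    ((hW.sum_abs_pow_sub_le hm T i).trans hε.ge) (hB ▸ hsolve _ hβ w)
    (u₀ := (∑ j, (m : ℝ)⁻¹ • stat (x j) (x j) t)⁻¹.toEuclideanLin w) ?_ v).trans (le_of_eq ?_)
  · intro j v u
    rw [crossForm_self, hc]
    exact h.cross j v u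
  · intro v u
    simp only [crossForm_self]
    rw [hc']
    exact h.cross_sum v u
  · intro y
    rw [Finset.mul_sum]
    exact hsolve (fun _ => (m : ℝ)⁻¹) hβ₀ w y
  · ring

theorem thetaBar_of_communication {G : SimpleGraph (Fin m)} [DecidableRel G.Adj]
    {W : Matrix (Fin m) (Fin m) ℝ} {ζ S T : ℕ} {x : Fin m → ℕ → EuclideanSpace ℝ (Fin n)}
    {y : Fin m → ℕ → EuclideanSpace ℝ (Fin l)} {i : Fin m} {t : ℕ} (ht : 1 ≤ t)
    (htζ : t % ζ = 0) (htS : t ≤ S) :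
    thetaBar G W ζ S T x y i t = consensus G W (fun j => stat (y j) (x j) t) T i
      * pinv (consensus G W (fun j => stat (x j) (x j) t) T i) := by
  obtain ⟨t, rfl⟩ := Nat.exists_eq_add_of_le' ht
  rw [thetaBar, if_pos ⟨htζ, htS⟩]

end Estimate

end DistributedEstimation

end

theorem theorem3 {Ω : Type*} [MeasurableSpace Ω] (P : Measure Ω) [IsProbabilityMeasure P]
    {m n l : ℕ} (hn : 1 ≤ n) (hl : 1 ≤ l)
    (G : SimpleGraph (Fin m)) [DecidableRel G.Adj] (hG : G.Connected)
    (W : Matrix (Fin m) (Fin m) ℝ) (hW : IsWeightMatrix G W)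
    (Θ : Matrix (Fin l) (Fin n) ℝ)
    (σx ση μhat : ℝ) (hσx : 0 < σx) (hση : 0 ≤ ση)
    (x : Fin m → ℕ → Ω → EuclideanSpace ℝ (Fin n))
    (η : Fin m → ℕ → Ω → EuclideanSpace ℝ (Fin l))
    (μ : Fin m → ℕ → EuclideanSpace ℝ (Fin n))
    (hdata : IsGaussianData P x η μ σx ση μhat)
    (ζ S T : ℕ) (hζ : 1 ≤ ζ) (hT : 1 ≤ T)
    (δhat δ : ℝ) (hδhat : 0 < δhat) (hδ : 0 < δ)
    (t : ℕ) (ht : 1 ≤ t) (htζ : t % ζ = 0) (htS : t ≤ S)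
    (ht₁ : t₁ n δhat ≤ t) (ht₂ : t₂ n σx μhat δhat ≤ t) (ht₃ : t₃ n l δhat ≤ t) :
    1 - 4 * m * δhat - 4 * δ ≤
      P.real {ω | ∀ i : Fin m,
        ‖thetaBar G W ζ S T (fun j s => x j s ω) (fun j s => label Θ (x j s ω) (η j s ω)) i t
            - Θ‖
          ≤ rho W hW.symm ^ T * C₀ m Θ σx ση μhat δhat (rho W hW.symm) t T
            + C₁ n l σx ση μhat δ / (√(m * t) * σx ^ 2 * lambdaMin (1 + muBar μ σx t))} := by

  have hm : 1 ≤ m := by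
    obtain ⟨i⟩ := hG.nonempty
    exact i.pos
  have hm' : (1 : ℝ) ≤ m := by exact_mod_cast hm
  -- In the first case the claimed probability is nonpositive. Otherwise both parameters are below
  -- 1/4, so the logarithms are positive.
  rcases le_or_gt 1 (4 * m * δhat + 4 * δ) with hbig | hsmall
  · exact le_trans (by linarith) measureReal_nonneg
  have hδhat4 : δhat < 1 / 4 := by nlinarith
  have hδ4 : δ < 1 / 4 := by nlinarith
  have hμ : ∀ j s, 1 ≤ s → ‖μ j s‖ ≤ μhat := fun j s hs => hdata.isLUB_mean.1 ⟨j, s, hs, rfl⟩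
  have hμ0 : 0 ≤ μhat := (norm_nonneg _).trans (hμ ⟨0, hm⟩ 1 le_rfl)
  -- From 2/δ̂ ≥ 8 and 3 log 2 > 33/16; with the first threshold this gives t ≥ 8n + 33.
  have hlog : 33 / 16 ≤ Real.log (2 / δhat) := by
    have h1 : Real.log (2 ^ 3) ≤ Real.log (2 / δhat) :=
      Real.log_le_log (by norm_num) (by rw [le_div_iff₀ hδhat]; linarith)
    rw [Real.log_pow] at h1
    push_cast at h1
    linarith [Real.log_two_gt_d9]
  rw [t₁] at ht₁
  -- Only the √(4n) part of the second threshold is kept: 16² · 4 = 1024.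
  have ht₂' : 1024 * (μhat / σx) ^ 2 * n ≤ t := by
    refine le_trans ?_ ht₂
    rw [t₂]
    calc 1024 * (μhat / σx) ^ 2 * n = (16 * μhat * √(4 * n) / σx) ^ 2 := by
          rw [div_pow, div_pow, mul_pow, Real.sq_sqrt (by positivity)]
          ring
      _ ≤ _ := by
          gcongr
          exact le_add_of_nonneg_right (Real.sqrt_nonneg _)
  have hbad := hdata.measure_not_isGoodSample hn hl hσx hση hμ0 ht hδhat (by linarith) hδ
    (by linarith) ht₁ (by linarith) ht₂'
  have hbad' := ENNReal.toReal_mono ENNReal.ofReal_ne_top hbad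
  rw [ENNReal.toReal_ofReal (by positivity)] at hbad'
  set good := {ω | ∀ i : Fin m, ‖thetaBar G W ζ S T (fun j s => x j s ω)
    (fun j s => label Θ (x j s ω) (η j s ω)) i t - Θ‖ ≤
      rho W hW.symm ^ T * C₀ m Θ σx ση μhat δhat (rho W hW.symm) t T
        + C₁ n l σx ση μhat δ / (√(m * t) * σx ^ 2 * lambdaMin (1 + muBar μ σx t))} with hgood
  set bad := {ω | ¬ IsGoodSample (fun j s => x j s ω) (fun j s => η j s ω) μ σx ση μhat δhat δ t}
    with hbad_def
  have hcover : Set.univ ⊆ good ∪ bad := by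
    intro ω _
    by_cases h : IsGoodSample (fun j s => x j s ω) (fun j s => η j s ω) μ σx ση μhat δhat δ t
    · left
      intro i
      rw [thetaBar_of_communication ht htζ htS]
      exact h.norm_consensus_mul_pinv_sub_le hW Θ hn hm ht hσx hση hμ0 hμ hδhat (by linarith) hδ
        (by linarith) T i
    · exact Or.inr h
  have h1 : 1 ≤ P.real good + P.real bad := by
    calc 1 = P.real Set.univ := by simp
      _ ≤ P.real (good ∪ bad) := measureReal_mono hcover
      _ ≤ _ := measureReal_union_le _ _
  have h2 : P.real bad ≤ 3 * m * δhat + δ := hbad'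
  nlinarith
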